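/- \textbf{Setting.} Let $c>1$, $0<2d<c-1$, $I_1=[-c-2d,-c+2d]$, $I_2=[-1,1]$. Let $(a(n,t),b(n,t))$, $n\in\mathbb Z$, $t\in\mathbb R$, be a real solution, bounded in $n$ locally uniformly in $t$, of the Toda lattice \[\dot b(n,t)=2\big(a(n,t)^2-a(n-1,t)^2\big),\qquad \dot a(n,t)=a(n,t)\big(b(n+1,t)-b(n,t)\big),\] with $a(n,0)>0$ and \[\sum_{n\le 0}e^{C|n|}\big(|a(n,0)-d|+|b(n,0)+c|\big)+\sum_{n\ge0}e^{Cn}\big(|a(n,0)-\tfrac12|+|b(n,0)|\big)<\infty\] for some $C\ge\max\{c+2d+\sqrt{(c+2d)^2-1},\ \tfrac1{2d}(1+c+\sqrt{(1+c)^2-4d^2})\}$. Let $(H(t)y)(n)=a(n-1,t)y(n-1)+b(n,t)y(n)+a(n,t)y(n+1)$. Let $\mathbb M$ be the compact Riemann surface of $w^2=(\lambda^2-1)((\lambda+c)^2-4d^2)$, $p=(\lambda,w)$, $p^*=(\lambda,-w)$. Here $\sqrt{\lambda^2-1}$ and $\sqrt{(\lambda+c)^2-4d^2}$ denote the branches holomorphic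 off $I_2$ resp. $I_1$ and asymptotic to $\lambda$ at infinity. The upper sheet $\Pi_U$ consists of the points with $\lambda\notin I_1\cup I_2$ and $w=-\sqrt{\lambda^2-1}\sqrt{(\lambda+c)^2-4d^2}$, together with $\infty_+$; the lower sheet is $\Pi_L=\{p^*: p\in\Pi_U\}$; $\Sigma_j$ is the closed curve over $I_j$, and $\Sigma=\Sigma_1\cup\Sigma_2$. For functions given on $\Pi_U$, values at points of $\Sigma$ are limits from $\Pi_U$. On $\Pi_U\cup\Sigma$ put $z_2=\lambda-\sqrt{\lambda^2-1}$ and $z_1=\frac1{2d}\big(\lambda+c-\sqrt{(\lambda+c)^2-4d^2}\big)$. Let $\psi_1,\psi_2$ be the Jost solutions, that is, $H(t)\psi_j=\lambda\psi_j$ with $z_1^{n}\psi_1(p,n,t)\to1$ as $n\to-\infty$ and $z_2^{-n}\psi_2(p,n,t)\to1$ as $n\to+\infty$, and let \[W(p,t)=a(n-1,t)\big(\psi_1(p,n-1,t)\psi_2(p,n,t)-\psi_1(p,n,t)\psi_2(p,n-1,t)\big),\] \[T_2=-\sqrt{\lambda^2-1}/W,\qquad T_1=-\sqrt{(\lambda+c)^2-4d^2}/W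 .\] Let $R_j(p,t)$, $p\in\Sigma_j$, be given by $T_2\psi_1=\overline{\psi_2}+R_2\psi_2$ on $\Sigma_2$ and $T_1\psi_2=\overline{\psi_1}+R_1\psi_1$ on $\Sigma_1$. Write $R_j(p)=R_j(p,0)$ and $\chi(p)=-\lim_{p'\in\Pi_U\to p}T_1(p',0)\overline{T_2(p',0)}$, $p\in\Sigma$. For $t\neq0$ and $\xi=n/t$ let, on $\Pi_U$, \[\Phi_1=d(z_1^{-1}-z_1)-\xi\log z_1,\qquad \Phi_2=\tfrac12(z_2-z_2^{-1})+\xi\log z_2,\] continued to $\Pi_L$ by $\Phi_j(p^*)=-\Phi_j(p)$. Subscripts $\pm$ denote limits at $p\in\Sigma$ from $\Pi_U$ and $\Pi_L$, respectively; $e^{t\Phi_{j,\pm}}$ is the limit of $e^{t\Phi_j}$, which does not depend on the branch of the logarithm. Let, on $\Pi_U$, \[m_2(p,n,t)=(T_2\psi_1z_2^n,\ \psi_2z_2^{-n}),\qquad m_1(p,n,t)=(T_1\psi_2z_1^{-n},\ \psi_1z_1^{n}),\] extended to $\Pi_L$ by $m_j(p^*)=m_j(p)\begin{pmatrix}0&1\\1&0\end{pmatrix}$.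 \textbf{Theorem.} Assume that $H(0)$ has no discrete spectrum, that is, no eigenvalues outside $I_1\cup I_2$, and that $W(p,0)\ne0$ at the four points with $\lambda\in\{-c-2d,-c+2d,-1,1\}$. Then, for every $t\in\mathbb R$, the Jost solutions exist on $\Pi_U\cup\Sigma$, the $T_j$ are holomorphic on $\Pi_U$ at finite $\lambda$ and continuous up to $\Sigma$, and there are $R_j$ satisfying the scattering relations on all of $\Sigma_j$. For all $n\in\mathbb Z$, $t\ne0$ and $j=1,2$ the function $m_j(\cdot,n,t)$ is holomorphic on $\mathbb M\setminus\Sigma$, and it satisfies: I. the limits $m_{j,\pm}(p)$ exist at every $p\in\Sigma$ and $m_{j,+}=m_{j,-}v_j$, where \[v_2=\begin{cases}\begin{pmatrix}0&-\overline{R_2}\,e^{-2t\Phi_2}\\R_2\,e^{2t\Phi_2}&1\end{pmatrix},&p\in\Sigma_2,\\[4mm]\begin{pmatrix}\chi\, e^{t(\Phi_{2,+}-\Phi_{2,-})}&e^{-t(\Phi_{2,+}+\Phi_{2,-})}\\e^{t(\Phi_{2,+}+\Phi_{2,-})}&0\end{pmatrix},&p\in\Sigma_1,\end{cases}\] \[v_1=\begin{cases}\begin{pmatrix}0&-\overline{R_1}\,e^{-2t\Phi_1}\\R_1\,e^{2t\Phi_1}&1\end{pmatrix},&p\in\Sigma_1,\\[4mm]\begin{pmatrix}\overline\chi\,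 e^{t(\Phi_{1,+}-\Phi_{1,-})}&e^{-t(\Phi_{1,+}+\Phi_{1,-})}\\e^{t(\Phi_{1,+}+\Phi_{1,-})}&0\end{pmatrix},&p\in\Sigma_2;\end{cases}\] II. $m_j(p^*)=m_j(p)\begin{pmatrix}0&1\\1&0\end{pmatrix}$ for $p\in\mathbb M\setminus\Sigma$; III. $\lim_{p\in\Pi_U\to\infty_+}m_j(p)=(\hat m_j,\tilde m_j)$ with $\hat m_j\tilde m_j=1$ and $\hat m_j>0$. -/

import Mathlib

open Filter Topology

namespace TodaShock

noncomputable section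

/-! ### The two-sheeted surface -/

/-- The branch of `√((lam - α)(lam - β))` which is holomorphic off the segment `[α, β]` and behaves
like `lam` at infinity. -/
def bandRoot (α β lam : ℂ) : ℂ := (lam - α) * ((lam - β) / (lam - α)) ^ (1 / 2 : ℂ)

theorem bandRoot_sq (α β lam : ℂ) : bandRoot α β lam ^ 2 = (lam - α) * (lam - β) := by
  unfold bandRoot
  have h : (((lam - β) / (lam - α)) ^ (1 / 2 : ℂ)) ^ 2 = (lam - β) / (lam - α) := by
    simp
  rw [mul_pow, h]
  by_cases h0 : lam - α = 0
  · simp [h0]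
  · field_simp

/-- `I₁ = [-c - 2d, -c + 2d]`, as a subset of `ℂ`. -/
def I1 (c d : ℝ) : Set ℂ := (fun x : ℝ => (x : ℂ)) '' Set.Icc (-c - 2 * d) (-c + 2 * d)

/-- `I₂ = [-1, 1]`, as a subset of `ℂ`. -/
def I2 : Set ℂ := (fun x : ℝ => (x : ℂ)) '' Set.Icc (-1) 1

/-- `I₁ ∪ I₂`. -/
def bands (c d : ℝ) : Set ℂ := I1 c d ∪ I2

/-- `√((lam + c)² - 4d²)`, holomorphic off `I₁`. -/
def root1 (c d : ℝ) (lam : ℂ) : ℂ := bandRoot (-c - 2 * d) (-c + 2 * d) lam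

/-- `√(lam² - 1)`, holomorphic off `I₂`. -/
def root2 (lam : ℂ) : ℂ := bandRoot (-1) 1 lam

/-- `R^{1/2}(lam) = -√((lam² - 1)((lam + c)² - 4d²))`, holomorphic off `I₁ ∪ I₂`. -/
def Rhalf (c d : ℝ) (lam : ℂ) : ℂ := -(root2 lam * root1 c d lam)

/-- The finite part of the surface `𝕄`: the curve `w² = (lam² - 1)((lam + c)² - 4d²)` in `ℂ × ℂ`.
A point is `p = (lam, w)`; the topology is the subspace topology, so that `(lam + i0, +)` and
`(lam - i0, -)` are the same point for `lam ∈ I₁ ∪ I₂`. -/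
abbrev Curve (c d : ℝ) : Type :=
  {p : ℂ × ℂ // p.2 ^ 2 = (p.1 ^ 2 - 1) * ((p.1 + c) ^ 2 - 4 * (d : ℂ) ^ 2)}

variable {c d : ℝ}

/-- The projection `π(p) = lam`. -/
def Curve.lam (p : Curve c d) : ℂ := p.1.1

/-- The second coordinate `w`. -/
def Curve.w (p : Curve c d) : ℂ := p.1.2

/-- The sheet exchange map `p ↦ p*`. -/
def Curve.star (p : Curve c d) : Curve c d := ⟨(p.1.1, -p.1.2), by simpa using p.2⟩

/-- The point `(lam, +)`. -/
def upperPt (c d : ℝ) (lam : ℂ) : Curve c d :=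
  ⟨(lam, Rhalf c d lam), by
    simp only [Rhalf, root1, root2, neg_sq, mul_pow, bandRoot_sq]
    ring⟩

/-- The upper sheet `Π_U` (without `∞₊`). -/
def PiU (c d : ℝ) : Set (Curve c d) := {p | p.lam ∉ bands c d ∧ p.w = Rhalf c d p.lam}

/-- The lower sheet `Π_L` (without `∞₋`). -/
def PiL (c d : ℝ) : Set (Curve c d) := {p | p.lam ∉ bands c d ∧ p.w = -Rhalf c d p.lam}

/-- The contour `Σ₁` over `I₁`. -/
def Sigma1 (c d : ℝ) : Set (Curve c d) := {p | p.lam ∈ I1 c d}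

/-- The contour `Σ₂` over `I₂`. -/
def Sigma2 (c d : ℝ) : Set (Curve c d) := {p | p.lam ∈ I2}

/-- `Σ = Σ₁ ∪ Σ₂`. -/
def Sig (c d : ℝ) : Set (Curve c d) := Sigma1 c d ∪ Sigma2 c d

/-- `clos Π_U = Π_U ∪ Σ`. -/
def closU (c d : ℝ) : Set (Curve c d) := PiU c d ∪ Sig c d

/-- The filter of `p ∈ Π_U`, `p → ∞₊`. -/
def atInfPlus (c d : ℝ) : Filter (Curve c d) :=
  comap Curve.lam (Bornology.cobounded ℂ) ⊓ 𝓟 (PiU c d)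

open Classical in
/-- A function of `lam` regarded as a function on `clos Π_U`: its value at `p ∈ Π_U` is `f lam`, its
value at `p ∈ Σ` is the limit from within `Π_U`. -/
def onClosU (f : ℂ → ℂ) (p : Curve c d) : ℂ :=
  if p ∈ PiU c d then f p.lam else limUnder (𝓝[PiU c d] p) (fun q => f q.lam)

/-- `√((lam + c)² - 4d²)` on `clos Π_U`. -/
def s1 (p : Curve c d) : ℂ := onClosU (root1 c d) p

/-- `√(lam² - 1)` on `clos Π_U`. -/
def s2 (p : Curve c d) : ℂ := onClosU root2 p

/-- The Joukovski variable `z₁` on `clos Π_U`. -/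
def z1 (p : Curve c d) : ℂ := (p.lam + c - s1 p) / (2 * d)

/-- The Joukovski variable `z₂` on `clos Π_U`. -/
def z2 (p : Curve c d) : ℂ := p.lam - s2 p

/-! ### Jacobi operators, Jost solutions and scattering data -/

/-- `ψ` solves `a(n-1)ψ(n-1) + b(n)ψ(n) + a(n)ψ(n+1) = lam ψ(n)`. -/
def IsJacobiSolution (a b : ℤ → ℝ) (lam : ℂ) (ψ : ℤ → ℂ) : Prop :=
  ∀ n : ℤ, (a (n - 1) : ℂ) * ψ (n - 1) + (b n : ℂ) * ψ n + (a n : ℂ) * ψ (n + 1) = lam * ψ n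

/-- The discrete spectrum of the Jacobi operator in `ℓ²(ℤ)`: its eigenvalues outside
`I₁ ∪ I₂`. -/
def discreteSpectrum (c d : ℝ) (a b : ℤ → ℝ) : Set ℝ :=
  {E | (E : ℂ) ∉ bands c d ∧
    ∃ y : ℤ → ℂ, y ≠ 0 ∧ Memℓp y 2 ∧ IsJacobiSolution a b (E : ℂ) y}

/-- `ψ` is the left Jost solution at `p`: `z₁ⁿ ψ(n) → 1` as `n → -∞`. -/
def IsJost1 (a b : ℤ → ℝ) (p : Curve c d) (ψ : ℤ → ℂ) : Prop :=
  IsJacobiSolution a b p.lam ψ ∧ Tendsto (fun n : ℤ => z1 p ^ n * ψ n) atBot (𝓝 1)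

/-- `ψ` is the right Jost solution at `p`: `z₂⁻ⁿ ψ(n) → 1` as `n → +∞`. -/
def IsJost2 (a b : ℤ → ℝ) (p : Curve c d) (ψ : ℤ → ℂ) : Prop :=
  IsJacobiSolution a b p.lam ψ ∧ Tendsto (fun n : ℤ => z2 p ^ (-n) * ψ n) atTop (𝓝 1)

/-- The left Jost solution `ψ₁(p, ·)`. -/
def jost1 (a b : ℤ → ℝ) (p : Curve c d) : ℤ → ℂ := Classical.epsilon (IsJost1 a b p)

/-- The right Jost solution `ψ₂(p, ·)`. -/
def jost2 (a b : ℤ → ℝ) (p : Curve c d) : ℤ → ℂ := Classical.epsilon (IsJost2 a b p)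

/-- `W(p) = a(n-1)(ψ₁(n-1)ψ₂(n) - ψ₁(n)ψ₂(n-1))`, which does not depend on `n`; here `n = 0`. -/
def wronskian (a b : ℤ → ℝ) (p : Curve c d) : ℂ :=
  (a (-1) : ℂ) * (jost1 a b p (-1) * jost2 a b p 0 - jost1 a b p 0 * jost2 a b p (-1))

/-- The left transmission coefficient on `clos Π_U`. -/
def T1 (a b : ℤ → ℝ) (p : Curve c d) : ℂ := -s1 p / wronskian a b p

/-- The right transmission coefficient on `clos Π_U`. -/
def T2 (a b : ℤ → ℝ) (p : Curve c d) : ℂ := -s2 p / wronskian a b p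

/-- The left reflection coefficient on `Σ₁`, given by the scattering relation
`T₁ψ₂ = conj ψ₁ + R₁ψ₁`. -/
def R1 (a b : ℤ → ℝ) (p : Curve c d) : ℂ :=
  Classical.epsilon fun r : ℂ =>
    ∀ n : ℤ, T1 a b p * jost2 a b p n = starRingEnd ℂ (jost1 a b p n) + r * jost1 a b p n

/-- The right reflection coefficient on `Σ₂`, given by the scattering relation
`T₂ψ₁ = conj ψ₂ + R₂ψ₂`. -/
def R2 (a b : ℤ → ℝ) (p : Curve c d) : ℂ :=
  Classical.epsilon fun r : ℂ =>
    ∀ n : ℤ, T2 a b p * jost1 a b p n = starRingEnd ℂ (jost2 a b p n) + r * jost2 a b p n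

/-- `χ(p) = -lim T₁(p') conj (T₂(p'))` as `p' ∈ Π_U` tends to `p ∈ Σ`. -/
def chi (a b : ℤ → ℝ) (p : Curve c d) : ℂ :=
  -limUnder (𝓝[PiU c d] p) (fun q => T1 a b q * starRingEnd ℂ (T2 a b q))

/-- The functions `ψ_j`, `T_j`, `R_j` are the Jost solutions, the transmission and the reflection
coefficients of the Jacobi operator with coefficients `a`, `b`: the Jost solutions exist on
`clos Π_U` and are normalized as required, and the coefficients are the ones of the scattering
relations on `Σ_j`, the `T_j` being continued holomorphically to `Π_U`. -/
structure IsScatteringData (a b : ℤ → ℝ) (ψ₁ ψ₂ : Curve c d → ℤ → ℂ)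
    (τ₁ τ₂ ρ₁ ρ₂ : Curve c d → ℂ) : Prop where
  jost_left : ∀ p ∈ closU c d, IsJost1 a b p (ψ₁ p)
  jost_right : ∀ p ∈ closU c d, IsJost2 a b p (ψ₂ p)
  left_relation : ∀ p ∈ Sigma1 c d, ∀ n : ℤ,
    τ₁ p * ψ₂ p n = starRingEnd ℂ (ψ₁ p n) + ρ₁ p * ψ₁ p n
  right_relation : ∀ p ∈ Sigma2 c d, ∀ n : ℤ,
    τ₂ p * ψ₁ p n = starRingEnd ℂ (ψ₂ p n) + ρ₂ p * ψ₂ p n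
  left_holomorphic : DifferentiableOn ℂ (fun lam => τ₁ (upperPt c d lam)) (bands c d)ᶜ
  right_holomorphic : DifferentiableOn ℂ (fun lam => τ₂ (upperPt c d lam)) (bands c d)ᶜ
  left_boundary : ∀ p ∈ Sig c d, Tendsto τ₁ (𝓝[PiU c d] p) (𝓝 (τ₁ p))
  right_boundary : ∀ p ∈ Sig c d, Tendsto τ₂ (𝓝[PiU c d] p) (𝓝 (τ₂ p))

/-! ### The vector functions and the Riemann-Hilbert problems -/

open Classical in
/-- Extension of a vector function from `Π_U` to `Π_L` by `m(p*) = m(p) (0 1; 1 0)`. -/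
def extendSym (f : Curve c d → Fin 2 → ℂ) (p : Curve c d) : Fin 2 → ℂ :=
  if p ∈ PiU c d then f p else ![f p.star 1, f p.star 0]

/-- `m₁ = (T₁ψ₂z₁⁻ⁿ, ψ₁z₁ⁿ)` on `Π_U`, extended by symmetry. -/
def m1 (a b : ℤ → ℝ) (n : ℤ) : Curve c d → Fin 2 → ℂ :=
  extendSym fun p => ![T1 a b p * jost2 a b p n * z1 p ^ (-n), jost1 a b p n * z1 p ^ n]

/-- `m₂ = (T₂ψ₁z₂ⁿ, ψ₂z₂⁻ⁿ)` on `Π_U`, extended by symmetry. -/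
def m2 (a b : ℤ → ℝ) (n : ℤ) : Curve c d → Fin 2 → ℂ :=
  extendSym fun p => ![T2 a b p * jost1 a b p n * z2 p ^ n, jost2 a b p n * z2 p ^ (-n)]

open Classical in
/-- Extension of a scalar function from `Π_U` to `Π_L` as an odd function, `f(p*) = -f(p)`. -/
def extendOdd (f : Curve c d → ℂ) (p : Curve c d) : ℂ :=
  if p ∈ PiU c d then f p else -f p.star

/-- The phase `Φ₁ = d(z₁⁻¹ - z₁) - ξ log z₁` on `Π_U`, continued to `Π_L` as an odd function. -/
def Phi1 (ξ : ℝ) : Curve c d → ℂ :=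
  extendOdd fun p => d * ((z1 p)⁻¹ - z1 p) - ξ * Complex.log (z1 p)

/-- The phase `Φ₂ = (z₂ - z₂⁻¹)/2 + ξ log z₂` on `Π_U`, continued to `Π_L` as an odd function. -/
def Phi2 (ξ : ℝ) : Curve c d → ℂ :=
  extendOdd fun p => (z2 p - (z2 p)⁻¹) / 2 + ξ * Complex.log (z2 p)

/-- `e^{tΦ₊(p)}`: the boundary value of `e^{tΦ}` at `p ∈ Σ` from `Π_U`. With `ξ = n/t` the function
`e^{tΦ_j}` does not depend on the branch of the logarithm and has such limits on all of `Σ`, also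
at the branch points. -/
def expPlus (t : ℝ) (Φ : Curve c d → ℂ) (p : Curve c d) : ℂ :=
  limUnder (𝓝[PiU c d] p) (fun q => Complex.exp (t * Φ q))

/-- `e^{tΦ₋(p)}`: the boundary value of `e^{tΦ}` at `p ∈ Σ` from `Π_L`. -/
def expMinus (t : ℝ) (Φ : Curve c d → ℂ) (p : Curve c d) : ℂ :=
  limUnder (𝓝[PiL c d] p) (fun q => Complex.exp (t * Φ q))

/-- The jump matrix on the contour `Σ_j` for the problem with index `j`:
`(0, -conj R e^{-2tΦ}; R e^{2tΦ}, 1)`. -/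
def jumpOwn (R Ep : ℂ) : Matrix (Fin 2) (Fin 2) ℂ :=
  !![0, -starRingEnd ℂ R * (Ep ^ 2)⁻¹; R * Ep ^ 2, 1]

/-- The jump matrix on the other contour:
`(X e^{t(Φ₊ - Φ₋)}, e^{-t(Φ₊ + Φ₋)}; e^{t(Φ₊ + Φ₋)}, 0)`. -/
def jumpOther (X Ep Em : ℂ) : Matrix (Fin 2) (Fin 2) ℂ :=
  !![X * (Ep / Em), (Ep * Em)⁻¹; Ep * Em, 0]

open Classical in
/-- The jump matrix `v₁` built from the scattering data of the initial data `a₀`, `b₀`. -/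
def v1 (a₀ b₀ : ℤ → ℝ) (n : ℤ) (t : ℝ) (p : Curve c d) : Matrix (Fin 2) (Fin 2) ℂ :=
  if p ∈ Sigma1 c d then jumpOwn (R1 a₀ b₀ p) (expPlus t (Phi1 (n / t)) p)
  else jumpOther (starRingEnd ℂ (chi a₀ b₀ p))
    (expPlus t (Phi1 (n / t)) p) (expMinus t (Phi1 (n / t)) p)

open Classical in
/-- The jump matrix `v₂` built from the scattering data of the initial data `a₀`, `b₀`. -/
def v2 (a₀ b₀ : ℤ → ℝ) (n : ℤ) (t : ℝ) (p : Curve c d) : Matrix (Fin 2) (Fin 2) ℂ :=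
  if p ∈ Sigma2 c d then jumpOwn (R2 a₀ b₀ p) (expPlus t (Phi2 (n / t)) p)
  else jumpOther (chi a₀ b₀ p)
    (expPlus t (Phi2 (n / t)) p) (expMinus t (Phi2 (n / t)) p)

/-- `m` solves the vector Riemann-Hilbert problem on `𝕄` with jump matrix `v` on `Σ`. Holomorphy on
the two sheets is expressed in the local coordinate `lam`; at `∞₊` and `∞₋` it amounts to the
existence of the limits, which is part of the normalization and the symmetry condition. -/
structure SolvesRHP (v : Curve c d → Matrix (Fin 2) (Fin 2) ℂ)
    (m : Curve c d → Fin 2 → ℂ) : Prop where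
  holomorphic_upper : DifferentiableOn ℂ (fun lam => m (upperPt c d lam)) (bands c d)ᶜ
  holomorphic_lower : DifferentiableOn ℂ (fun lam => m (upperPt c d lam).star) (bands c d)ᶜ
  jump : ∀ p ∈ Sig c d, ∃ mp mm : Fin 2 → ℂ,
    Tendsto m (𝓝[PiU c d] p) (𝓝 mp) ∧ Tendsto m (𝓝[PiL c d] p) (𝓝 mm) ∧
      mp = Matrix.vecMul mm (v p)
  symmetry : ∀ p ∈ PiU c d ∪ PiL c d, m p.star = Matrix.vecMul (m p) !![0, 1; 1, 0]
  normalization : ∃ mhat mtilde : ℝ, Tendsto m (atInfPlus c d) (𝓝 ![(mhat : ℂ), (mtilde : ℂ)]) ∧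
    mhat * mtilde = 1 ∧ 0 < mhat

/-! ### The Cauchy problem for the Toda lattice -/

/-- Solutions of the Toda lattice on `ℤ × ℝ`, bounded in `n` locally uniformly in `t` (the class in
which the Cauchy problem is uniquely solvable). -/
structure IsTodaSolution (a b : ℤ → ℝ → ℝ) : Prop where
  b_eq : ∀ n t, HasDerivAt (b n) (2 * (a n t ^ 2 - a (n - 1) t ^ 2)) t
  a_eq : ∀ n t, HasDerivAt (a n) (a n t * (b (n + 1) t - b n t)) t
  bounded : ∀ τ : ℝ, ∃ M : ℝ, ∀ n t, |t| ≤ τ → |a n t| ≤ M ∧ |b n t| ≤ M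

/-- Initial data decaying exponentially fast, with rate `C`, to the left background `(d, -c)` and
the right background `(1/2, 0)`. -/
structure SteplikeDecay (c d C : ℝ) (a₀ b₀ : ℤ → ℝ) : Prop where
  left : Summable fun n : ℕ => Real.exp (C * n) * (|a₀ (-(n : ℤ)) - d| + |b₀ (-(n : ℤ)) + c|)
  right : Summable fun n : ℕ => Real.exp (C * n) * (|a₀ (n : ℤ) - 1 / 2| + |b₀ (n : ℤ)|)

/-- The Wronskian of the Jost solutions does not vanish at the edges of the spectrum. -/
def NonResonant (c d : ℝ) (a₀ b₀ : ℤ → ℝ) : Prop :=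
  ∀ p : Curve c d, (p.lam = -c - 2 * d ∨ p.lam = -c + 2 * d ∨ p.lam = -1 ∨ p.lam = 1) →
    wronskian a₀ b₀ p ≠ 0

end

end TodaShock

open Filter Topology

namespace TodaShock

noncomputable section

section

/-! ### Normalized Jost functions -/

/-! Everything is expressed through the Joukovski variables. On `closU` they are nonzero, lie in the
closed unit disc and satisfy lam = B + A(z + 1/z), with A, B the constants of the background.
Writing ψ(n) = zⁿ F(n) turns the Jacobi equation into `NormEq`, which is regular at z = 0. Because
the coefficients approach the background exponentially, its solutions are stable towards -∞,
uniformly in |z| ≤ 1 (`Background.weightedSize_le`). Hence the solutions that equal 1 beyond a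
cutoff converge geometrically to a normalized Jost function `jostF`, continuous on the closed disc
and holomorphic inside. This gives Jost solutions on the sheet and on the cuts alike, branch points
included. The left solution is the right one of the reflected lattice.

Let ψ be the Jost solution of the band under consideration, s its root and φ the other Jost
solution, which is real there. The Plücker identity for φ, ψ and conj ψ gives W conj ψ - conj W ψ =
-s φ (`Steplike.relation_Sigma1`, `Steplike.relation_Sigma2`). This is the scattering relation, with
R = -conj W / W. It also shows that on a cut W can vanish only at a branch point; off the cuts a
zero of W would produce an eigenfunction decaying at both ends. So W has no zeros on `closU` at time
0 (`Steplike.wronskian_ne_zero`).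

Exponential decay persists under the Toda flow (`IsTodaSolution.exists_background`). For the
truncated Jost functions the defect in the Lax equation again solves `NormEq` and is tiny at the
cutoff, so the limit obeys the Lax equation (`hasDerivAt_jostF`). Up to the scalars -s₁ and s₂, both
Jost solutions move by ψ ↦ a(n)ψ(n+1) - a(n-1)ψ(n-1), which leaves Wronskians unchanged; therefore
W(0) = W(t) exp((s₁ - s₂)t) (`TodaSteplike.wronskian_zero`). On each cut one root is purely
imaginary and the other real, so conjugation flips just one sign in the exponent. Passing from data
at time 0 to data at time t thus produces exactly the exponentials in the jump matrices, and the
jump reduces to algebra (`jump_own`, `jump_other`).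

At infinity `NormEq` degenerates to first-order recursions. They give positivity, and they make the
product of the two normalized Jost functions scale like (2d)ⁿ, which cancels the limit of (z₂/z₁)ⁿ
(`Steplike.normalization`). -/

/-- The coefficients `a`, `b` are exponentially close to the constants `A`, `B` at `+∞`, and `a` is
bounded below by `m > 0`. -/
structure Background (A B m Q ρ : ℝ) (a b : ℤ → ℝ) : Prop where
  m_pos : 0 < m
  Q_nonneg : 0 ≤ Q
  rho_pos : 0 < ρ
  rho_lt : ρ < 1
  le_a : ∀ n, m ≤ a n
  a_sub : ∀ n, |a n - A| ≤ Q * (ρ ^ n) ^ 2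
  b_sub : ∀ n, |b n - B| ≤ Q * (ρ ^ n) ^ 2

/-- The equation at site `n` satisfied by `F n = z⁻ⁿ ψ n` when `ψ` solves the Jacobi equation with
`lam = B + A (z + z⁻¹)`. It makes sense at `z = 0`. -/
def NormEq (A B : ℝ) (a b : ℤ → ℝ) (z : ℂ) (F : ℤ → ℂ) (n : ℤ) : Prop :=
  (a (n - 1) : ℂ) * F (n - 1) =
    (A * (1 + z ^ 2) - (b n - B) * z) * F n - a n * z ^ 2 * F (n + 1)

theorem NormEq.sub {A B : ℝ} {a b : ℤ → ℝ} {z : ℂ} {F G : ℤ → ℂ} {n : ℤ}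
    (hF : NormEq A B a b z F n) (hG : NormEq A B a b z G n) :
    NormEq A B a b z (fun k => F k - G k) n := by
  unfold NormEq at *
  linear_combination hF - hG

/-- The weighted size of a solution of the normalized equation at site `n`. -/
def weightedSize (ρ : ℝ) (a : ℤ → ℝ) (F : ℤ → ℂ) (n : ℤ) : ℝ :=
  ‖F n‖ + (ρ ^ n)⁻¹ * ‖(a n : ℂ) * (F (n + 1) - F n)‖

theorem norm_le_weightedSize {ρ : ℝ} (hρ : 0 < ρ) (a : ℤ → ℝ) (F : ℤ → ℂ) (n : ℤ) :
    ‖F n‖ ≤ weightedSize ρ a F n := by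
  unfold weightedSize
  have : 0 ≤ (ρ ^ n)⁻¹ * ‖(a n : ℂ) * (F (n + 1) - F n)‖ := by positivity
  linarith

/-- The constant in the one-step estimate. -/
def stepConst (m Q ρ : ℝ) : ℝ := 3 * Q / ρ ^ 2 + 1 / (m * ρ)

/-- The constant in the exponential stability estimate. -/
def stabConst (m Q ρ : ℝ) : ℝ := 2 * stepConst m Q ρ * ρ / (1 - ρ)

variable {A B m Q ρ : ℝ} {a b : ℤ → ℝ} {z : ℂ}

namespace Background

theorem a_pos (h : Background A B m Q ρ a b) (n : ℤ) : 0 < a n := h.m_pos.trans_le (h.le_a n)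

theorem a_ne (h : Background A B m Q ρ a b) (n : ℤ) : (a n : ℂ) ≠ 0 := by
  exact_mod_cast (h.a_pos n).ne'

theorem stepConst_nonneg (h : Background A B m Q ρ a b) : 0 ≤ stepConst m Q ρ := by
  have := h.m_pos; have := h.Q_nonneg; have := h.rho_pos
  unfold stepConst; positivity

theorem stabConst_nonneg (h : Background A B m Q ρ a b) : 0 ≤ stabConst m Q ρ := by
  have := h.stepConst_nonneg; have := h.rho_pos; have := sub_pos.2 h.rho_lt
  unfold stabConst; positivity

/-- This is the coefficient by which `NormEq` deviates from the free equation. The three deviations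
share one bound; the loss of ρ⁻² comes from the site n - 1. -/
theorem norm_perturbation_le (h : Background A B m Q ρ a b) (hz : ‖z‖ ≤ 1) (n : ℤ) :
    ‖((a (n - 1) - A : ℝ) : ℂ) + z ^ 2 * ((a n - A : ℝ) : ℂ) + ((b n - B : ℝ) : ℂ) * z‖
      ≤ 3 * Q / ρ ^ 2 * (ρ ^ n) ^ 2 := by
  have hρ := h.rho_pos
  have h1 : (ρ ^ (n - 1)) ^ 2 = (ρ ^ n) ^ 2 / ρ ^ 2 := by
    rw [zpow_sub_one₀ hρ.ne']; field_simp
  have h2 : (ρ ^ n) ^ 2 ≤ (ρ ^ n) ^ 2 / ρ ^ 2 := by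
    rw [le_div_iff₀ (by positivity)]
    have : ρ ^ 2 ≤ 1 := pow_le_one₀ hρ.le h.rho_lt.le
    exact mul_le_of_le_one_right (by positivity) this
  have e1 := h.a_sub (n - 1)
  have e2 := h.a_sub n
  have e3 := h.b_sub n
  rw [h1] at e1
  have e2' := e2.trans (mul_le_mul_of_nonneg_left h2 h.Q_nonneg)
  have e3' := e3.trans (mul_le_mul_of_nonneg_left h2 h.Q_nonneg)
  refine (norm_add₃_le).trans ?_
  have t1 : ‖((a (n - 1) - A : ℝ) : ℂ)‖ = |a (n - 1) - A| := Complex.norm_real _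
  have t2 : ‖z ^ 2 * ((a n - A : ℝ) : ℂ)‖ ≤ |a n - A| := by
    rw [norm_mul, norm_pow, Complex.norm_real, Real.norm_eq_abs]
    exact mul_le_of_le_one_left (abs_nonneg _) (pow_le_one₀ (norm_nonneg _) hz)
  have t3 : ‖((b n - B : ℝ) : ℂ) * z‖ ≤ |b n - B| := by
    rw [norm_mul, Complex.norm_real, Real.norm_eq_abs]
    exact mul_le_of_le_one_right (abs_nonneg _) hz
  have : 3 * Q / ρ ^ 2 * (ρ ^ n) ^ 2 = 3 * (Q * ((ρ ^ n) ^ 2 / ρ ^ 2)) := by ring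
  linarith

/-- With Y(n) = a(n)(F(n+1) - F(n)) the equation reads Y(n-1) = z² Y(n) + q F(n), q of order ρ²ⁿ, so
|z| ≤ 1 makes the Y part non-expanding. Weighting Y by ρ⁻ⁿ balances the system: the influence of F
on Y and that of Y on F are both of order ρⁿ, hence summable. No spectral gap is needed, so z = ±1
is covered. -/
theorem weightedSize_step (h : Background A B m Q ρ a b) (hz : ‖z‖ ≤ 1) {F : ℤ → ℂ} {n : ℤ}
    (hF : NormEq A B a b z F n) :
    weightedSize ρ a F (n - 1) ≤ (1 + stepConst m Q ρ * ρ ^ n) ^ 2 * weightedSize ρ a F n := by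
  have hρ := h.rho_pos
  have hm := h.m_pos
  have hQ := h.Q_nonneg
  set q : ℂ := ((a (n - 1) - A : ℝ) : ℂ) + z ^ 2 * ((a n - A : ℝ) : ℂ) + ((b n - B : ℝ) : ℂ) * z
    with hq
  have hqn := h.norm_perturbation_le hz n
  rw [← hq] at hqn
  have hY : (a (n - 1) : ℂ) * (F n - F (n - 1)) = z ^ 2 * (a n * (F (n + 1) - F n)) + q * F n := by
    unfold NormEq at hF
    rw [hq]; push_cast
    linear_combination -hF
  unfold weightedSize
  rw [sub_add_cancel]
  set f := ‖F n‖
  set y := (ρ ^ n)⁻¹ * ‖(a n : ℂ) * (F (n + 1) - F n)‖ with hy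
  set y' := (ρ ^ (n - 1))⁻¹ * ‖(a (n - 1) : ℂ) * (F n - F (n - 1))‖ with hy'
  set κ := stepConst m Q ρ with hκ
  have hrn : 0 < ρ ^ n := by positivity
  have hf0 : 0 ≤ f := norm_nonneg _
  have hy0 : 0 ≤ y := by positivity
  have hy'0 : 0 ≤ y' := by positivity
  have hκ0 : 0 ≤ κ := h.stepConst_nonneg
  have hYn : ‖(a (n - 1) : ℂ) * (F n - F (n - 1))‖ ≤
      ‖(a n : ℂ) * (F (n + 1) - F n)‖ + 3 * Q / ρ ^ 2 * (ρ ^ n) ^ 2 * f := by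
    rw [hY]
    refine (norm_add_le _ _).trans (add_le_add ?_ ?_)
    · rw [norm_mul, norm_pow]
      exact mul_le_of_le_one_left (norm_nonneg _) (pow_le_one₀ (norm_nonneg _) hz)
    · rw [norm_mul]
      exact mul_le_mul_of_nonneg_right hqn hf0
  have s1 : y' ≤ y + κ * ρ ^ n * f := by
    have : y' ≤ (ρ ^ n)⁻¹ * ‖(a (n - 1) : ℂ) * (F n - F (n - 1))‖ := by
      rw [hy']
      refine mul_le_mul_of_nonneg_right ?_ (norm_nonneg _)
      rw [zpow_sub_one₀ hρ.ne', mul_inv, inv_inv]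
      exact mul_le_of_le_one_right (by positivity) h.rho_lt.le
    refine this.trans ((mul_le_mul_of_nonneg_left hYn (by positivity)).trans ?_)
    rw [mul_add, ← hy]
    have e : (ρ ^ n)⁻¹ * (3 * Q / ρ ^ 2 * (ρ ^ n) ^ 2 * f) = 3 * Q / ρ ^ 2 * (ρ ^ n * f) := by
      field_simp
    rw [e]
    have : 3 * Q / ρ ^ 2 ≤ κ := by
      rw [hκ, stepConst]; have : 0 ≤ 1 / (m * ρ) := by positivity
      linarith
    have := mul_le_mul_of_nonneg_right this (by positivity : 0 ≤ ρ ^ n * f)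
    linarith
  have s2 : ‖F (n - 1)‖ ≤ f + κ * ρ ^ n * y' := by
    have e1 : F (n - 1) = F n - (F n - F (n - 1)) := by ring
    have e2 : ‖F (n - 1)‖ ≤ f + ‖F n - F (n - 1)‖ := by
      conv_lhs => rw [e1]
      exact norm_sub_le _ _
    have e3 : ‖F n - F (n - 1)‖ ≤ 1 / (m * ρ) * ρ ^ n * y' := by
      have e4 : 1 / (m * ρ) * ρ ^ n * y' = ‖(a (n - 1) : ℂ) * (F n - F (n - 1))‖ / m := by
        rw [hy', zpow_sub_one₀ hρ.ne']; field_simp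
      rw [e4, le_div_iff₀ hm, norm_mul, Complex.norm_real, Real.norm_eq_abs,
        abs_of_pos (h.a_pos _), mul_comm]
      exact mul_le_mul_of_nonneg_right (h.le_a _) (norm_nonneg _)
    have : 1 / (m * ρ) ≤ κ := by
      rw [hκ, stepConst]; have : 0 ≤ 3 * Q / ρ ^ 2 := by positivity
      linarith
    have := mul_le_mul_of_nonneg_right this (by positivity : 0 ≤ ρ ^ n * y')
    linarith
  have hk : 0 ≤ κ * ρ ^ n := by positivity
  have s3 : f + y' ≤ (1 + κ * ρ ^ n) * (f + y) := by nlinarith [mul_nonneg hk hy0]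
  have s4 : ‖F (n - 1)‖ + y' ≤ (1 + κ * ρ ^ n) * (f + y') := by nlinarith [mul_nonneg hk hf0]
  calc _ ≤ _ := s4
    _ ≤ (1 + κ * ρ ^ n) * ((1 + κ * ρ ^ n) * (f + y)) :=
        mul_le_mul_of_nonneg_left s3 (by linarith)
    _ = _ := by ring

theorem weightedSize_nonneg (h : Background A B m Q ρ a b) (F : ℤ → ℂ) (n : ℤ) :
    0 ≤ weightedSize ρ a F n := by
  have := h.rho_pos
  unfold weightedSize; positivity

/-- Solutions of the normalized equation are stable in the backward direction. -/
theorem weightedSize_le (h : Background A B m Q ρ a b) (hz : ‖z‖ ≤ 1) {F : ℤ → ℂ} {N : ℤ}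
    (hF : ∀ n ≤ N, NormEq A B a b z F n) {n : ℤ} (hn : n ≤ N) :
    weightedSize ρ a F n ≤ weightedSize ρ a F N * Real.exp (stabConst m Q ρ * ρ ^ n) := by
  have hρ := h.rho_pos
  have hS := h.weightedSize_nonneg F N
  have hκ := h.stabConst_nonneg
  -- The one-step exponents 2κρᵏ, with κ = `stepConst`, sum to this difference; `stabConst` is
  -- chosen so that the geometric sum telescopes and the induction closes.
  suffices H : weightedSize ρ a F n ≤
      weightedSize ρ a F N * Real.exp (stabConst m Q ρ * (ρ ^ n - ρ ^ N)) by
    refine H.trans (mul_le_mul_of_nonneg_left (Real.exp_le_exp.2 ?_) hS)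
    have : 0 < ρ ^ N := by positivity
    exact mul_le_mul_of_nonneg_left (by linarith) hκ
  induction n, hn using Int.leInductionDown with
  | base => simp
  | pred n hn ih =>
    have hs := h.weightedSize_step hz (hF n hn)
    have hk := h.stepConst_nonneg
    have h0 : 0 < ρ ^ n := by positivity
    have e1 : (1 + stepConst m Q ρ * ρ ^ n) ^ 2 ≤ Real.exp (2 * (stepConst m Q ρ * ρ ^ n)) := by
      rw [two_mul, Real.exp_add, ← sq]
      refine pow_le_pow_left₀ (by positivity) ?_ 2
      rw [add_comm]; exact Real.add_one_le_exp _
    refine hs.trans ((mul_le_mul e1 ih (h.weightedSize_nonneg F n) (Real.exp_pos _).le).trans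
      (le_of_eq ?_))
    rw [mul_left_comm, ← Real.exp_add]
    congr 2
    have : 1 - ρ ≠ 0 := (sub_pos.2 h.rho_lt).ne'
    rw [stabConst, zpow_sub_one₀ hρ.ne']
    field_simp
    ring

end Background

/-! ### Truncated Jost functions and their limit. -/

/-- The pair `(F (N - k), F (N - k + 1))`, where `F` solves the normalized equation with
`F N = F (N + 1) = 1`. -/
def jostPair (a b : ℤ → ℝ) (A B : ℝ) (z : ℂ) (N : ℤ) : ℕ → ℂ × ℂ
  | 0 => (1, 1)
  | k + 1 =>
    (((A * (1 + z ^ 2) - (b (N - k) - B) * z) * (jostPair a b A B z N k).1 -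
      a (N - k) * z ^ 2 * (jostPair a b A B z N k).2) / a (N - k - 1), (jostPair a b A B z N k).1)

/-- The solution of the normalized equation at sites `n ≤ N` which is `1` on `[N, ∞)`. -/
def jostApprox (a b : ℤ → ℝ) (A B : ℝ) (z : ℂ) (N n : ℤ) : ℂ :=
  (jostPair a b A B z N (N - n).toNat).1

theorem jostApprox_of_le {N n : ℤ} (hn : N ≤ n) : jostApprox a b A B z N n = 1 := by
  have : (N - n).toNat = 0 := by omega
  simp [jostApprox, this, jostPair]

theorem jostPair_snd (N n : ℤ) (hn : n ≤ N) :
    (jostPair a b A B z N (N - n).toNat).2 = jostApprox a b A B z N (n + 1) := by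
  rcases hn.eq_or_lt with rfl | hlt
  · simp [jostApprox, jostPair]
  · have h1 : (N - n).toNat = (N - (n + 1)).toNat + 1 := by omega
    rw [h1]; rfl

theorem jostApprox_pred {N n : ℤ} (hn : n ≤ N) :
    jostApprox a b A B z N (n - 1) = ((A * (1 + z ^ 2) - (b n - B) * z) * jostApprox a b A B z N n -
      a n * z ^ 2 * jostApprox a b A B z N (n + 1)) / a (n - 1) := by
  have h1 : (N - (n - 1)).toNat = (N - n).toNat + 1 := by omega
  have h2 : N - ((N - n).toNat : ℤ) = n := by omega
  rw [jostApprox, h1, jostPair, h2, jostPair_snd N n hn]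
  rfl

/-- Induction principle for the approximations: downward from `N`. -/
theorem jostApprox_induction {P : ℤ → Prop} (N : ℤ) (h1 : ∀ n, N ≤ n → P n)
    (h2 : ∀ n ≤ N, P n → P (n + 1) → P (n - 1)) (n : ℤ) : P n := by
  have key : ∀ k : ℕ, P (N - k) ∧ P (N - k + 1) := by
    intro k
    induction k with
    | zero => exact ⟨h1 _ (by simp), h1 _ (by simp)⟩
    | succ k ih =>
      have := h2 (N - k) (by omega) ih.1 ih.2
      refine ⟨by convert this using 1; push_cast; ring, by convert ih.1 using 1; push_cast; ring⟩
  rcases le_total N n with h | h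
  · exact h1 n h
  · have := (key (N - n).toNat).1
    have e : N - ((N - n).toNat : ℤ) = n := by omega
    rwa [e] at this

/-- The recursion divides by a(n-1) only, never by z, so each truncation is a polynomial in z. -/
theorem jostApprox_differentiable (N n : ℤ) :
    Differentiable ℂ (fun z => jostApprox a b A B z N n) := by
  induction n using jostApprox_induction N with
  | h1 n hn => simp only [jostApprox_of_le hn]; fun_prop
  | h2 n hn i1 i2 => simp only [jostApprox_pred hn]; fun_prop

theorem jostApprox_conj (z : ℂ) (N n : ℤ) :
    jostApprox a b A B (starRingEnd ℂ z) N n = starRingEnd ℂ (jostApprox a b A B z N n) := by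
  induction n using jostApprox_induction N with
  | h1 n hn => simp [jostApprox_of_le hn]
  | h2 n hn i1 i2 => simp [jostApprox_pred hn, i1, i2]

/-- The normalized Jost function `z ↦ z⁻ⁿ ψ(z, n)`. -/
def jostF (a b : ℤ → ℝ) (A B : ℝ) (n : ℤ) (z : ℂ) : ℂ :=
  limUnder atTop fun N : ℕ => jostApprox a b A B z N n

/-- The constant in the estimate of the truncation error. -/
def errConst (m Q ρ : ℝ) (n : ℤ) : ℝ :=
  3 * Q / ρ ^ 2 * (1 / m + 1) * Real.exp (stabConst m Q ρ * ρ ^ n)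

namespace Background

theorem normEq_jostApprox (h : Background A B m Q ρ a b) (z : ℂ) {N n : ℤ} (hn : n ≤ N) :
    NormEq A B a b z (jostApprox a b A B z N) n := by
  have := h.a_ne (n - 1)
  rw [NormEq, jostApprox_pred hn]
  field_simp

theorem errConst_nonneg (h : Background A B m Q ρ a b) (n : ℤ) : 0 ≤ errConst m Q ρ n := by
  have := h.m_pos; have := h.Q_nonneg; have := h.rho_pos
  unfold errConst; positivity

/-- Consecutive truncations solve the same equation at all sites up to N, so their difference is
controlled by its size at N. There it comes from a single use of the equation at N + 1 on constant
data, which leaves the perturbation coefficient of order ρ²ᴺ; the weight ρ⁻ᴺ reduces this to ρᴺ. -/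
theorem dist_jostApprox_succ (h : Background A B m Q ρ a b) (hz : ‖z‖ ≤ 1) (n : ℤ) (N : ℕ) :
    dist (jostApprox a b A B z N n) (jostApprox a b A B z (N + 1 : ℕ) n)
      ≤ errConst m Q ρ n * ρ ^ N := by
  have hρ := h.rho_pos
  have hm := h.m_pos
  have hQ := h.Q_nonneg
  have hE := h.errConst_nonneg n
  rcases lt_or_ge (N : ℤ) n with hn | hn
  · rw [jostApprox_of_le hn.le, jostApprox_of_le (by push_cast; omega), dist_self]
    positivity
  rw [dist_comm, dist_eq_norm]
  have hD : ∀ k ≤ (N : ℤ), NormEq A B a b z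
      (fun k => jostApprox a b A B z (N + 1 : ℕ) k - jostApprox a b A B z N k) k := fun k hk =>
    (h.normEq_jostApprox z (by push_cast; omega)).sub (h.normEq_jostApprox z hk)
  refine (norm_le_weightedSize hρ a (fun k => jostApprox a b A B z (N + 1 : ℕ) k -
    jostApprox a b A B z N k) n).trans ((h.weightedSize_le hz hD hn).trans ?_)
  have e0 : a N * (jostApprox a b A B z (N + 1 : ℕ) N - 1) =
      -(((a N - A : ℝ) : ℂ) + z ^ 2 * ((a (N + 1 : ℕ) - A : ℝ) : ℂ) +
        ((b (N + 1 : ℕ) - B : ℝ) : ℂ) * z) := by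
    have := h.normEq_jostApprox z (le_refl ((N + 1 : ℕ) : ℤ))
    have e : ((N + 1 : ℕ) : ℤ) - 1 = N := by push_cast; ring
    rw [NormEq, e, jostApprox_of_le le_rfl, jostApprox_of_le (Int.le_add_one le_rfl)] at this
    push_cast at this ⊢
    linear_combination this
  have e1 : ‖(a N : ℂ) * (jostApprox a b A B z (N + 1 : ℕ) N - 1)‖ ≤
      3 * Q / ρ ^ 2 * (ρ ^ N) ^ 2 := by
    rw [e0, norm_neg]
    have := h.norm_perturbation_le hz ((N + 1 : ℕ) : ℤ)
    have e : ((N + 1 : ℕ) : ℤ) - 1 = N := by push_cast; ring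
    rw [e] at this
    refine this.trans (mul_le_mul_of_nonneg_left ?_ (by positivity))
    rw [zpow_natCast]
    refine pow_le_pow_left₀ (by positivity) ?_ 2
    exact pow_le_pow_of_le_one hρ.le h.rho_lt.le (by omega)
  have e2 : ‖jostApprox a b A B z (N + 1 : ℕ) N - 1‖ ≤ 3 * Q / ρ ^ 2 * (ρ ^ N) ^ 2 / m := by
    rw [le_div_iff₀ hm]
    refine le_trans ?_ e1
    rw [norm_mul, Complex.norm_real, Real.norm_eq_abs, abs_of_pos (h.a_pos _), mul_comm]
    exact mul_le_mul_of_nonneg_right (h.le_a _) (norm_nonneg _)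
  have e3 : weightedSize ρ a (fun k => jostApprox a b A B z (N + 1 : ℕ) k -
      jostApprox a b A B z N k) N ≤ 3 * Q / ρ ^ 2 * (1 / m + 1) * ρ ^ N := by
    unfold weightedSize
    simp only [jostApprox_of_le (le_refl (N : ℤ)), jostApprox_of_le (Int.le_add_one le_rfl),
      jostApprox_of_le (show ((N + 1 : ℕ) : ℤ) ≤ (N : ℤ) + 1 by push_cast; omega)]
    rw [sub_self, zero_sub, mul_neg, norm_neg]
    have hp : 0 < ρ ^ N := by positivity
    have hp1 : ρ ^ N ≤ 1 := pow_le_one₀ hρ.le h.rho_lt.le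
    have e4 : (ρ ^ (N : ℤ))⁻¹ * ‖(a N : ℂ) * (jostApprox a b A B z (N + 1 : ℕ) N - 1)‖ ≤
        3 * Q / ρ ^ 2 * ρ ^ N := by
      refine (mul_le_mul_of_nonneg_left e1 (by positivity)).trans (le_of_eq ?_)
      rw [zpow_natCast]; field_simp
    have e5 : 3 * Q / ρ ^ 2 * (ρ ^ N) ^ 2 / m ≤ 3 * Q / ρ ^ 2 * (1 / m) * ρ ^ N := by
      have : 3 * Q / ρ ^ 2 * (ρ ^ N) ^ 2 / m = 3 * Q / ρ ^ 2 * (1 / m) * ρ ^ N * ρ ^ N := by ring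
      rw [this]
      exact mul_le_of_le_one_right (by positivity) hp1
    have := add_le_add (e2.trans e5) e4
    linarith
  refine (mul_le_mul_of_nonneg_right e3 (Real.exp_pos _).le).trans (le_of_eq ?_)
  rw [errConst]; ring

theorem tendsto_jostApprox (h : Background A B m Q ρ a b) (hz : ‖z‖ ≤ 1) (n : ℤ) :
    Tendsto (fun N : ℕ => jostApprox a b A B z N n) atTop (𝓝 (jostF a b A B n z)) :=
  tendsto_nhds_limUnder (cauchySeq_tendsto_of_complete
    (cauchySeq_of_le_geometric ρ _ h.rho_lt (h.dist_jostApprox_succ hz n)))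

theorem dist_jostApprox_jostF (h : Background A B m Q ρ a b) (hz : ‖z‖ ≤ 1) (n : ℤ) (N : ℕ) :
    dist (jostApprox a b A B z N n) (jostF a b A B n z) ≤ errConst m Q ρ n * ρ ^ N / (1 - ρ) :=
  dist_le_of_le_geometric_of_tendsto ρ _ h.rho_lt (h.dist_jostApprox_succ hz n)
    (h.tendsto_jostApprox hz n) N

theorem normEq_jostF (h : Background A B m Q ρ a b) (hz : ‖z‖ ≤ 1) (n : ℤ) :
    NormEq A B a b z (fun k => jostF a b A B k z) n := by
  have h1 := (h.tendsto_jostApprox hz (n - 1)).const_mul (a (n - 1) : ℂ)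
  have h2 := ((h.tendsto_jostApprox hz n).const_mul (A * (1 + z ^ 2) - (b n - B) * z)).sub
    ((h.tendsto_jostApprox hz (n + 1)).const_mul (a n * z ^ 2))
  refine tendsto_nhds_unique (h1.congr' ?_) h2
  filter_upwards [eventually_ge_atTop n.toNat] with N hN
  exact h.normEq_jostApprox z (by omega)

theorem tendsto_errBound (h : Background A B m Q ρ a b) (n : ℤ) :
    Tendsto (fun N : ℕ => errConst m Q ρ n * ρ ^ N / (1 - ρ)) atTop (𝓝 0) := by
  have := ((tendsto_pow_atTop_nhds_zero_of_lt_one h.rho_pos.le h.rho_lt).const_mul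
    (errConst m Q ρ n)).div_const (1 - ρ)
  simpa using this

theorem tendstoUniformlyOn_jostApprox (h : Background A B m Q ρ a b) (n : ℤ) :
    TendstoUniformlyOn (fun (N : ℕ) z => jostApprox a b A B z N n) (jostF a b A B n) atTop
      (Metric.closedBall 0 1) := by
  rw [Metric.tendstoUniformlyOn_iff]
  intro ε hε
  filter_upwards [(h.tendsto_errBound n).eventually_lt_const hε] with N hN w hw
  rw [dist_comm]
  exact (h.dist_jostApprox_jostF (by simpa using hw) n N).trans_lt hN

/-- The convergence is uniform up to the unit circle, onto which a band is mapped by its own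
Joukovski variable. This is what provides boundary values on the cuts. -/
theorem continuousOn_jostF (h : Background A B m Q ρ a b) (n : ℤ) :
    ContinuousOn (jostF a b A B n) (Metric.closedBall 0 1) :=
  (h.tendstoUniformlyOn_jostApprox n).continuousOn
    (Frequently.of_forall fun N => (jostApprox_differentiable N n).continuous.continuousOn)

theorem differentiableOn_jostF (h : Background A B m Q ρ a b) (n : ℤ) :
    DifferentiableOn ℂ (jostF a b A B n) (Metric.ball 0 1) :=
  ((h.tendstoUniformlyOn_jostApprox n).mono
    Metric.ball_subset_closedBall).tendstoLocallyUniformlyOn.differentiableOn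
    (Eventually.of_forall fun N => (jostApprox_differentiable N n).differentiableOn)
    Metric.isOpen_ball

theorem jostF_conj (h : Background A B m Q ρ a b) (hz : ‖z‖ ≤ 1) (n : ℤ) :
    jostF a b A B n (starRingEnd ℂ z) = starRingEnd ℂ (jostF a b A B n z) := by
  have h1 := h.tendsto_jostApprox (z := starRingEnd ℂ z) (by simpa using hz) n
  simp only [jostApprox_conj] at h1
  exact tendsto_nhds_unique h1 ((Complex.continuous_conj.tendsto _).comp (h.tendsto_jostApprox hz n))

theorem tendsto_jostF_atTop (h : Background A B m Q ρ a b) (hz : ‖z‖ ≤ 1) :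
    Tendsto (fun n => jostF a b A B n z) atTop (𝓝 1) := by
  have hρ := h.rho_pos
  have hlim : Tendsto (fun n : ℤ => errConst m Q ρ 0 * ρ ^ n.toNat / (1 - ρ)) atTop (𝓝 0) :=
    (h.tendsto_errBound 0).comp (tendsto_atTop.2 fun k => by
      filter_upwards [eventually_ge_atTop (k : ℤ)] with n hn; omega)
  rw [tendsto_iff_dist_tendsto_zero]
  refine squeeze_zero' (Eventually.of_forall fun _ => dist_nonneg) ?_ hlim
  filter_upwards [eventually_ge_atTop 0] with n hn
  -- With the cutoff placed at n itself the truncation equals 1 at n, so the truncation error is the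
  -- distance of the Jost function from 1.
  have h1 := h.dist_jostApprox_jostF hz n n.toNat
  rw [jostApprox_of_le (by omega), dist_comm] at h1
  refine h1.trans ?_
  have h3 : errConst m Q ρ n ≤ errConst m Q ρ 0 := by
    have := h.m_pos; have := h.Q_nonneg
    unfold errConst
    refine mul_le_mul_of_nonneg_left (Real.exp_le_exp.2 ?_) (by positivity)
    refine mul_le_mul_of_nonneg_left ?_ h.stabConst_nonneg
    lift n to ℕ using hn
    simpa using pow_le_one₀ hρ.le h.rho_lt.le
  have := sub_pos.2 h.rho_lt
  gcongr

/-- At z = 0 the second-order equation loses its forward neighbour and becomes a first-order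
recursion. -/
theorem jostF_zero_pred (h : Background A B m Q ρ a b) (n : ℤ) :
    (a (n - 1) : ℂ) * jostF a b A B (n - 1) 0 = A * jostF a b A B n 0 := by
  have := h.normEq_jostF (z := 0) (by simp) n
  simpa [NormEq] using this

/-- At `z = 0` the normalized Jost function is a positive real number. -/
theorem jostF_zero_pos (h : Background A B m Q ρ a b) (hA : 0 < A) (n : ℤ) :
    ∃ r : ℝ, 0 < r ∧ jostF a b A B n 0 = r := by
  have hconj : ∀ k, ∃ r : ℝ, jostF a b A B k 0 = r := fun k => by
    have := h.jostF_conj (z := 0) (by simp) k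
    rw [map_zero] at this
    exact ⟨_, (Complex.conj_eq_iff_re.1 this.symm).symm⟩
  choose r hr using hconj
  have hstep : ∀ k, a (k - 1) * r (k - 1) = A * r k := fun k => by
    have := h.jostF_zero_pred k
    rw [hr, hr] at this
    exact_mod_cast this
  have hlim : Tendsto r atTop (𝓝 1) := by
    have := (Complex.continuous_re.tendsto _).comp (h.tendsto_jostF_atTop (z := 0) (by simp))
    simpa [Function.comp_def, hr] using this
  -- Positivity holds far to the right because the limit is 1; the first-order recursion with
  -- positive coefficients carries it down to n.
  obtain ⟨N, hN1, hN2⟩ :=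
    ((hlim.eventually_const_lt zero_lt_one).and (eventually_ge_atTop n)).exists
  refine ⟨r n, ?_, hr n⟩
  induction n, hN2 using Int.leInductionDown with
  | base => exact hN1
  | pred k hk ih =>
    have := hstep k
    exact pos_of_mul_pos_right (a := a (k - 1)) (by rw [this]; positivity) (h.a_pos _).le

end Background

end

section

/-! ### Time dependence of the normalized Jost functions -/

section TimeDerivative

variable {A B m Q ρ : ℝ} {a b : ℤ → ℝ → ℝ} {z : ℂ}

theorem jostApprox_differentiable_time (hT : IsTodaSolution a b) (ha : ∀ n t, a n t ≠ 0)
    (N n : ℤ) : Differentiable ℝ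
      (fun t => jostApprox (fun k => a k t) (fun k => b k t) A B z N n) := by
  have hda : ∀ k, Differentiable ℝ (fun t => (a k t : ℂ)) := fun k t =>
    (hT.a_eq k t).ofReal_comp.differentiableAt
  have hdb : ∀ k, Differentiable ℝ (fun t => (b k t : ℂ)) := fun k t =>
    (hT.b_eq k t).ofReal_comp.differentiableAt
  induction n using jostApprox_induction N with
  | h1 n hn => simp only [jostApprox_of_le hn]; fun_prop
  | h2 n hn i1 i2 =>
    simp only [jostApprox_pred hn]
    have := hda n
    have := hdb n
    refine Differentiable.fun_div (by fun_prop) (hda _) fun t => ?_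
    exact_mod_cast ha (n - 1) t

/-- The deviation of the truncated Jost function from the Lax equation, times `z`. -/
def laxDefect (a b : ℤ → ℝ → ℝ) (A B : ℝ) (z : ℂ) (N : ℤ) (t : ℝ) (n : ℤ) : ℂ :=
  z * deriv (fun t => jostApprox (fun k => a k t) (fun k => b k t) A B z N n) t +
    ((b n t - B) * z - 2 * A) * jostApprox (fun k => a k t) (fun k => b k t) A B z N n +
    2 * a (n - 1) t * jostApprox (fun k => a k t) (fun k => b k t) A B z N (n - 1)

/-- This is the Lax pair property: if ψ solves the Jacobi equation for all times, its time
derivative minus the Lax operator applied to ψ solves it too. In normalized form the defect equation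
combines the time derivative of the recursion at n with the recursions at n and n - 1, the Toda
equations supplying the derivatives of the coefficients. -/
theorem normEq_laxDefect (hT : IsTodaSolution a b) (ha : ∀ n t, a n t ≠ 0) {N n : ℤ} (hn : n ≤ N)
    (t : ℝ) : NormEq A B (fun k => a k t) (fun k => b k t) z (laxDefect a b A B z N t) n := by
  set F : ℤ → ℝ → ℂ := fun n t => jostApprox (fun k => a k t) (fun k => b k t) A B z N n with hF
  have hE : ∀ k ≤ N, ∀ t, (a (k - 1) t : ℂ) * F (k - 1) t =
      (A * (1 + z ^ 2) - (b k t - B) * z) * F k t - a k t * z ^ 2 * F (k + 1) t := by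
    intro k hk t
    have : (a (k - 1) t : ℂ) ≠ 0 := by exact_mod_cast ha (k - 1) t
    simp only [hF]
    rw [jostApprox_pred hk]
    field_simp
  have hd : ∀ k, HasDerivAt (F k) (deriv (F k) t) t := fun k =>
    (jostApprox_differentiable_time hT ha N k t).hasDerivAt
  have hdE : HasDerivAt (fun t => (a (n - 1) t : ℂ) * F (n - 1) t) _ t :=
    (hT.a_eq (n - 1) t).ofReal_comp.mul (hd (n - 1))
  have hdE' : HasDerivAt (fun t => (A * (1 + z ^ 2) - (b n t - B) * z) * F n t -
      a n t * z ^ 2 * F (n + 1) t) _ t :=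
    (((((hT.b_eq n t).ofReal_comp.sub_const (B : ℂ)).mul_const z).const_sub
      (A * (1 + z ^ 2) : ℂ)).mul (hd n)).sub
      (((hT.a_eq n t).ofReal_comp.mul_const (z ^ 2)).mul (hd (n + 1)))
  have key := hdE.unique (hdE'.congr_of_eventuallyEq (Eventually.of_forall fun s => hE n hn s))
  have e1 := hE n hn t
  have e2 := hE (n - 1) (by omega) t
  simp only [NormEq, laxDefect]
  change (a (n - 1) t : ℂ) * (z * deriv (F (n - 1)) t + ((b (n - 1) t - B) * z - 2 * A) *
    F (n - 1) t + 2 * a (n - 1 - 1) t * F (n - 1 - 1) t) =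
    (A * (1 + z ^ 2) - (b n t - B) * z) * (z * deriv (F n) t + ((b n t - B) * z - 2 * A) *
    F n t + 2 * a (n - 1) t * F (n - 1) t) - a n t * z ^ 2 * (z * deriv (F (n + 1)) t +
    ((b (n + 1) t - B) * z - 2 * A) * F (n + 1) t + 2 * a (n + 1 - 1) t * F (n + 1 - 1) t)
  simp only [add_sub_cancel_right, sub_add_cancel] at *
  push_cast at key
  linear_combination z * key + 2 * (a (n - 1) t : ℂ) * e2 + ((b n t - B) * z - 2 * A) * e1

/-- From the cutoff onwards the truncation is constantly 1, so at N and N + 1 the defect consists of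
coefficient deviations of order ρ²ᴺ. Stability transports this bound back to n. -/
theorem norm_laxDefect_le (hT : IsTodaSolution a b) (ha : ∀ n t, a n t ≠ 0) {t : ℝ}
    (h : Background A B m Q ρ (fun k => a k t) (fun k => b k t)) (hz : ‖z‖ ≤ 1) {n : ℤ} {N : ℕ}
    (hn : n ≤ N) : ‖laxDefect a b A B z N t n‖ ≤
      (3 * Q + 6 * Q * (|A| + Q)) * Real.exp (stabConst m Q ρ * ρ ^ n) * ρ ^ N := by
  have hρ := h.rho_pos
  have hQ := h.Q_nonneg
  refine (norm_le_weightedSize hρ (fun k => a k t) (laxDefect a b A B z N t) n).trans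
    ((h.weightedSize_le hz (fun k hk => normEq_laxDefect hT ha hk t) hn).trans ?_)
  have d1 : ∀ k : ℤ, (N : ℤ) ≤ k →
      deriv (fun t => jostApprox (fun k => a k t) (fun k => b k t) A B z N k) t = 0 := by
    intro k hk; simp only [jostApprox_of_le hk, deriv_const]
  have e1 : laxDefect a b A B z N t N =
      -((b N t - B : ℝ) * z) - 2 * (a N t - A : ℝ) * z ^ 2 := by
    have e := h.normEq_jostApprox z (le_refl (N : ℤ))
    rw [NormEq, jostApprox_of_le le_rfl, jostApprox_of_le (Int.le_add_one le_rfl)] at e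
    rw [laxDefect, d1 _ le_rfl, jostApprox_of_le le_rfl]
    push_cast
    linear_combination 2 * e
  have e2 : laxDefect a b A B z N t (N + 1) =
      (b (N + 1) t - B : ℝ) * z + 2 * (a N t - A : ℝ) := by
    rw [laxDefect, d1 _ (Int.le_add_one le_rfl), add_sub_cancel_right, jostApprox_of_le le_rfl,
      jostApprox_of_le (Int.le_add_one le_rfl)]
    push_cast
    ring
  have hp : 0 < ρ ^ N := by positivity
  have hp1 : ρ ^ N ≤ 1 := pow_le_one₀ hρ.le h.rho_lt.le
  have ba : |a N t - A| ≤ Q * (ρ ^ N) ^ 2 := by simpa using h.a_sub N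
  have bb : |b N t - B| ≤ Q * (ρ ^ N) ^ 2 := by simpa using h.b_sub N
  have bb' : |b (N + 1) t - B| ≤ Q * (ρ ^ N) ^ 2 := by
    refine (h.b_sub (N + 1)).trans (mul_le_mul_of_nonneg_left ?_ hQ)
    refine pow_le_pow_left₀ (by positivity) ?_ 2
    have : ρ ^ ((N : ℤ) + 1) = ρ ^ (N + 1) := by exact_mod_cast zpow_natCast ρ (N + 1)
    rw [this]
    exact pow_le_pow_of_le_one hρ.le h.rho_lt.le (by omega)
  have n1 : ‖laxDefect a b A B z N t N‖ ≤ 3 * Q * (ρ ^ N) ^ 2 := by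
    rw [e1]
    refine (norm_sub_le _ _).trans ?_
    rw [norm_neg, norm_mul, norm_mul, norm_mul, norm_pow, Complex.norm_real, Complex.norm_real,
      Real.norm_eq_abs, Real.norm_eq_abs, Complex.norm_two]
    have t1 := mul_le_of_le_one_right (abs_nonneg (b N t - B)) hz
    have t2 := mul_le_of_le_one_right (by positivity : 0 ≤ 2 * |a N t - A|)
      (pow_le_one₀ (norm_nonneg z) hz : ‖z‖ ^ 2 ≤ 1)
    linarith
  have n2 : ‖laxDefect a b A B z N t (N + 1)‖ ≤ 3 * Q * (ρ ^ N) ^ 2 := by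
    rw [e2]
    refine (norm_add_le _ _).trans ?_
    rw [norm_mul, norm_mul, Complex.norm_real, Complex.norm_real,
      Real.norm_eq_abs, Real.norm_eq_abs, Complex.norm_two]
    have t1 := mul_le_of_le_one_right (abs_nonneg (b (N + 1) t - B)) hz
    linarith
  have n3 : ‖(a N t : ℂ)‖ ≤ |A| + Q := by
    rw [Complex.norm_real, Real.norm_eq_abs]
    have t1 : |a N t| ≤ |A| + |a N t - A| := by
      have := abs_add_le A (a N t - A); simpa using this
    have t2 : Q * (ρ ^ N) ^ 2 ≤ Q := mul_le_of_le_one_right hQ (pow_le_one₀ hp.le hp1)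
    linarith
  have n4 : weightedSize ρ (fun k => a k t) (laxDefect a b A B z N t) N ≤
      (3 * Q + 6 * Q * (|A| + Q)) * ρ ^ N := by
    unfold weightedSize
    have t1 : 3 * Q * (ρ ^ N) ^ 2 ≤ 3 * Q * ρ ^ N := by
      refine mul_le_mul_of_nonneg_left ?_ (by positivity)
      rw [sq]; exact mul_le_of_le_one_right hp.le hp1
    have t2 : ‖(a N t : ℂ) * (laxDefect a b A B z N t (N + 1) - laxDefect a b A B z N t N)‖ ≤
        (|A| + Q) * (6 * Q * (ρ ^ N) ^ 2) := by
      rw [norm_mul]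
      refine mul_le_mul n3 ((norm_sub_le _ _).trans (by linarith)) (norm_nonneg _) (by positivity)
    have t3 := mul_le_mul_of_nonneg_left t2 (by positivity : 0 ≤ (ρ ^ (N : ℤ))⁻¹)
    have t4 : (ρ ^ (N : ℤ))⁻¹ * ((|A| + Q) * (6 * Q * (ρ ^ N) ^ 2)) =
        6 * Q * (|A| + Q) * ρ ^ N := by
      rw [zpow_natCast]; field_simp
    linarith
  refine (mul_le_mul_of_nonneg_right n4 (Real.exp_pos _).le).trans (le_of_eq ?_)
  ring

/-- The Lax equation for the normalized Jost functions. -/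
theorem hasDerivAt_jostF (hT : IsTodaSolution a b) (ha : ∀ n t, a n t ≠ 0) {s : Set ℝ}
    (hs : IsOpen s)
    (h : ∀ t ∈ s, Background A B m Q ρ (fun k => a k t) (fun k => b k t)) (hz : ‖z‖ ≤ 1)
    (hz0 : z ≠ 0) (n : ℤ) {t : ℝ} (ht : t ∈ s) :
    HasDerivAt (fun t => jostF (fun k => a k t) (fun k => b k t) A B n z)
      (z⁻¹ * ((2 * A - (b n t - B) * z) * jostF (fun k => a k t) (fun k => b k t) A B n z -
        2 * a (n - 1) t * jostF (fun k => a k t) (fun k => b k t) A B (n - 1) z)) t := by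
  have h0 := h t ht
  have hρ := h0.rho_pos
  have hQ := h0.Q_nonneg
  have hρ1 := sub_pos.2 h0.rho_lt
  refine hasDerivAt_of_tendstoUniformlyOn (l := (atTop : Filter ℕ)) hs
    (f := fun N t => jostApprox (fun k => a k t) (fun k => b k t) A B z N n)
    (f' := fun N t => deriv
      (fun t => jostApprox (fun k => a k t) (fun k => b k t) A B z N n) t)
    (g' := fun t => z⁻¹ * ((2 * A - (b n t - B) * z) *
      jostF (fun k => a k t) (fun k => b k t) A B n z -
        2 * a (n - 1) t * jostF (fun k => a k t) (fun k => b k t) A B (n - 1) z))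
    ?_ ?_ ?_ ht
  -- K is independent of time because all times in s share the background constants; hence the
  -- derivatives of the truncations converge uniformly and the limit may be differentiated.
  · set K : ℝ := ‖z⁻¹‖ * ((3 * Q + 6 * Q * (|A| + Q)) * Real.exp (stabConst m Q ρ * ρ ^ n) +
      (2 * |A| + Q * (ρ ^ n) ^ 2) * (errConst m Q ρ n / (1 - ρ)) +
      2 * (|A| + Q * (ρ ^ (n - 1)) ^ 2) * (errConst m Q ρ (n - 1) / (1 - ρ))) with hK
    have hKlim : Tendsto (fun N : ℕ => K * ρ ^ N) atTop (𝓝 0) := by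
      simpa using (tendsto_pow_atTop_nhds_zero_of_lt_one hρ.le h0.rho_lt).const_mul K
    rw [Metric.tendstoUniformlyOn_iff]
    intro ε hε
    filter_upwards [hKlim.eventually_lt_const hε, eventually_ge_atTop n.toNat] with N hN hNn u hu
    have hb := h u hu
    refine lt_of_le_of_lt ?_ hN
    rw [dist_comm, dist_eq_norm]
    -- The difference between the truncated and the limiting right-hand side is the Lax defect plus
    -- two truncation errors, divided by z.
    have e : deriv (fun t => jostApprox (fun k => a k t) (fun k => b k t) A B z N n) u -
        z⁻¹ * ((2 * A - (b n u - B) * z) * jostF (fun k => a k u) (fun k => b k u) A B n z -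
        2 * a (n - 1) u * jostF (fun k => a k u) (fun k => b k u) A B (n - 1) z) =
        z⁻¹ * (laxDefect a b A B z N u n + (2 * A - (b n u - B : ℝ) * z) *
          (jostApprox (fun k => a k u) (fun k => b k u) A B z N n -
            jostF (fun k => a k u) (fun k => b k u) A B n z) -
          2 * a (n - 1) u * (jostApprox (fun k => a k u) (fun k => b k u) A B z N (n - 1) -
            jostF (fun k => a k u) (fun k => b k u) A B (n - 1) z)) := by
      rw [laxDefect]; push_cast; field_simp; ring
    rw [e, norm_mul, hK, mul_assoc ‖z⁻¹‖]
    refine mul_le_mul_of_nonneg_left ?_ (norm_nonneg _)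
    have c1 := norm_laxDefect_le hT ha hb hz (n := n) (N := N) (by omega)
    have c2 := hb.dist_jostApprox_jostF hz n N
    have c3 := hb.dist_jostApprox_jostF hz (n - 1) N
    rw [dist_eq_norm] at c2 c3
    have c4 : ‖(2 * A - (b n u - B : ℝ) * z : ℂ)‖ ≤ 2 * |A| + Q * (ρ ^ n) ^ 2 := by
      refine (norm_sub_le _ _).trans (add_le_add ?_ ?_)
      · rw [norm_mul, Complex.norm_two, Complex.norm_real, Real.norm_eq_abs]
      · rw [norm_mul, Complex.norm_real, Real.norm_eq_abs]
        exact (mul_le_of_le_one_right (abs_nonneg _) hz).trans (hb.b_sub n)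
    have c5 : ‖(2 * a (n - 1) u : ℂ)‖ ≤ 2 * (|A| + Q * (ρ ^ (n - 1)) ^ 2) := by
      rw [norm_mul, Complex.norm_two, Complex.norm_real, Real.norm_eq_abs]
      have t1 : |a (n - 1) u| ≤ |A| + |a (n - 1) u - A| := by
        have := abs_add_le A (a (n - 1) u - A); simpa using this
      have := hb.a_sub (n - 1)
      linarith
    have hE1 := hb.errConst_nonneg n
    have hE2 := hb.errConst_nonneg (n - 1)
    have d2 := mul_le_mul c4 c2 (norm_nonneg _) (by positivity)
    have d3 := mul_le_mul c5 c3 (norm_nonneg _) (by positivity)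
    rw [← norm_mul] at d2 d3
    refine (norm_sub_le _ _).trans ((add_le_add ((norm_add_le _ _).trans (add_le_add c1 d2))
      d3).trans (le_of_eq ?_))
    ring
  · exact Eventually.of_forall fun N u _ =>
      (jostApprox_differentiable_time hT ha N n u).hasDerivAt
  · exact fun u hu => (h u hu).tendsto_jostApprox hz n

end TimeDerivative

end

section

/-! ### Persistence of exponential decay under the Toda flow -/

/-- Propagation of exponential weights for lattice systems with nearest neighbour interaction. -/
theorem norm_le_of_nearest_neighbour {E : Type*} [NormedAddCommGroup E] [NormedSpace ℝ E]
    {x x' : ℤ → ℝ → E} {τ K M D w : ℝ} (hK : 0 ≤ K) (hD : 0 ≤ D) (hw : 0 < w)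
    (hx : ∀ n t, HasDerivAt (x n) (x' n t) t)
    (hx' : ∀ n, ∀ t ∈ Set.Icc 0 τ,
      ‖x' n t‖ ≤ K * (‖x (n - 1) t‖ + ‖x n t‖ + ‖x (n + 1) t‖))
    (hb : ∀ n, ∀ t ∈ Set.Icc 0 τ, ‖x n t‖ ≤ M) (h0 : ∀ n, ‖x n 0‖ ≤ D * w ^ n)
    (n : ℤ) {t : ℝ} (ht : t ∈ Set.Icc 0 τ) :
    ‖x n t‖ ≤ D * w ^ n * Real.exp (K * (w⁻¹ + 1 + w) * t) := by
  set L := K * (w⁻¹ + 1 + w) with hL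
  have hL0 : 0 ≤ L := by positivity
  -- Picard iteration started from the a priori bound M. The weighted exponential reproduces itself
  -- since the sum over neighbours costs the factor w⁻¹ + 1 + w, while the remainder gains t/k at
  -- each round and vanishes as k → ∞.
  have key : ∀ k : ℕ, ∀ n, ∀ t ∈ Set.Icc 0 τ,
      ‖x n t‖ ≤ D * w ^ n * Real.exp (L * t) + M * ((3 * K * t) ^ k / k.factorial) := by
    intro k
    induction k with
    | zero =>
      intro n t ht
      have := hb n t ht
      have h1 : 0 ≤ D * w ^ n * Real.exp (L * t) := by positivity
      simp; linarith
    | succ k ih =>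
      intro n t ht
      refine image_norm_le_of_norm_deriv_right_le_deriv_boundary (a := 0) (b := τ)
        (f := x n) (f' := x' n)
        (B := fun t => D * w ^ n * Real.exp (L * t) +
          M * ((3 * K * t) ^ (k + 1) / (k + 1).factorial))
        (B' := fun t => D * w ^ n * (Real.exp (L * t) * L) +
          M * ((3 * K * t) ^ k / k.factorial * (3 * K)))
        (fun s _ => (hx n s).continuousAt.continuousWithinAt)
        (fun s _ => (hx n s).hasDerivWithinAt) (by simpa using h0 n) ?_ ?_ ht
      · intro s
        have e1 : HasDerivAt (fun t => Real.exp (L * t)) (Real.exp (L * s) * L) s := by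
          simpa using ((hasDerivAt_id s).const_mul L).exp
        have e2 : HasDerivAt (fun t => (3 * K * t) ^ (k + 1) / ((k + 1).factorial : ℝ))
            ((3 * K * s) ^ k / k.factorial * (3 * K)) s := by
          have := (((hasDerivAt_id s).const_mul (3 * K)).pow (k + 1)).div_const
            ((k + 1).factorial : ℝ)
          refine this.congr_deriv ?_
          have : (k.factorial : ℝ) ≠ 0 := by positivity
          rw [Nat.factorial_succ]
          push_cast
          simp only [id, mul_one]
          field_simp
        exact (e1.const_mul _).add (e2.const_mul M)
      · intro s hs
        have hs' := Set.Ico_subset_Icc_self hs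
        refine (hx' n s hs').trans ?_
        have i1 := ih (n - 1) s hs'
        have i2 := ih n s hs'
        have i3 := ih (n + 1) s hs'
        rw [zpow_sub_one₀ hw.ne'] at i1
        rw [zpow_add_one₀ hw.ne'] at i3
        refine (mul_le_mul_of_nonneg_left (add_le_add (add_le_add i1 i2) i3) hK).trans
          (le_of_eq ?_)
        rw [hL]; ring
  have hlim : Tendsto (fun k : ℕ => D * w ^ n * Real.exp (L * t) +
      M * ((3 * K * t) ^ k / k.factorial)) atTop (𝓝 (D * w ^ n * Real.exp (L * t) + M * 0)) :=
    ((FloorSemiring.tendsto_pow_div_factorial_atTop (3 * K * t)).const_mul M).const_add _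
  rw [mul_zero, add_zero] at hlim
  exact ge_of_tendsto' hlim fun k => key k n t ht

/-- Reflection `n ↦ -n`, combined with time reversal, preserves the Toda lattice. -/
theorem IsTodaSolution.reflect {a b : ℤ → ℝ → ℝ} (h : IsTodaSolution a b) :
    IsTodaSolution (fun n t => a (-n - 1) (-t)) (fun n t => b (-n) (-t)) where
  b_eq n t := by
    have := (h.b_eq (-n) (-t)).scomp t (hasDerivAt_neg t)
    refine this.congr_deriv ?_
    simp only [neg_smul, one_smul]
    rw [show -(n - 1) - 1 = -n by ring]
    ring
  a_eq n t := by
    have := (h.a_eq (-n - 1) (-t)).scomp t (hasDerivAt_neg t)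
    refine this.congr_deriv ?_
    simp only [neg_smul, one_smul]
    rw [show -n - 1 + 1 = -n by ring, show -(n + 1) = -n - 1 by ring]
    ring
  bounded τ := by
    obtain ⟨M, hM⟩ := h.bounded τ
    exact ⟨M, fun n t ht =>
      ⟨(hM (-n - 1) (-t) (by simpa using ht)).1, (hM (-n) (-t) (by simpa using ht)).2⟩⟩

section

variable {a b : ℤ → ℝ → ℝ}

/-- The equation for a(n) is linear and scalar, so a(n) cannot change sign and positivity survives
the flow. -/
theorem IsTodaSolution.a_eq_exp (h : IsTodaSolution a b) (n : ℤ) (t : ℝ) :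
    a n t = a n 0 * Real.exp (∫ s in (0 : ℝ)..t, (b (n + 1) s - b n s)) := by
  set G : ℝ → ℝ := fun t => ∫ s in (0 : ℝ)..t, (b (n + 1) s - b n s) with hG
  have hc : Continuous fun s => b (n + 1) s - b n s :=
    continuous_iff_continuousAt.2 fun s =>
      (h.b_eq (n + 1) s).continuousAt.sub (h.b_eq n s).continuousAt
  have hGd : ∀ t, HasDerivAt G (b (n + 1) t - b n t) t := fun t =>
    hc.integral_hasStrictDerivAt 0 t |>.hasDerivAt
  have hd : ∀ t, HasDerivAt (fun t => a n t * Real.exp (-G t)) 0 t := fun t =>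
    ((h.a_eq n t).mul (hGd t).neg.exp).congr_deriv (by ring)
  have := is_const_of_deriv_eq_zero (fun t => (hd t).differentiableAt)
    (fun t => (hd t).deriv) t 0
  simp only [hG, intervalIntegral.integral_same, neg_zero, Real.exp_zero, mul_one] at this
  rw [← this, mul_assoc, ← Real.exp_add]
  simp

/-- In the exponential formula for a(n) the integrand is at most 2M in modulus, uniformly in n. -/
theorem IsTodaSolution.le_a (h : IsTodaSolution a b) {m M τ : ℝ} (hm : 0 < m)
    (h0 : ∀ n, m ≤ a n 0) (hM : ∀ n t, |t| ≤ τ → |a n t| ≤ M ∧ |b n t| ≤ M) (n : ℤ) {t : ℝ}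
    (ht : |t| ≤ τ) : m * Real.exp (-(2 * M * τ)) ≤ a n t := by
  rw [h.a_eq_exp n t]
  have hM0 : 0 ≤ M := (abs_nonneg _).trans (hM n t ht).1
  refine mul_le_mul (h0 n) (Real.exp_le_exp.2 ?_) (Real.exp_pos _).le (hm.le.trans (h0 n))
  have h1 : ‖∫ s in (0 : ℝ)..t, (b (n + 1) s - b n s)‖ ≤ 2 * M * |t - 0| := by
    refine intervalIntegral.norm_integral_le_of_norm_le_const fun s hs => ?_
    have hs' : |s| ≤ τ := by
      refine le_trans ?_ ht
      rw [Set.mem_uIoc] at hs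
      rcases hs with hs | hs
      · rw [abs_of_pos hs.1, abs_of_pos (hs.1.trans_le hs.2)]; exact hs.2
      · rw [abs_of_nonpos hs.2, abs_of_nonpos (hs.1.le.trans hs.2)]; linarith
    have := (hM (n + 1) s hs').2
    have := (hM n s hs').2
    rw [Real.norm_eq_abs]
    refine (abs_sub _ _).trans ?_
    linarith
  rw [Real.norm_eq_abs, sub_zero] at h1
  have h2 := neg_le_of_abs_le h1
  have : 2 * M * |t| ≤ 2 * M * τ := mul_le_mul_of_nonneg_left ht (by positivity)
  linarith

/-- The distance to a constant background. -/
def bgDiff (A B : ℝ) (a b : ℤ → ℝ → ℝ) (n : ℤ) (t : ℝ) : ℝ × ℝ := (a n t - A, b n t - B)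

theorem IsTodaSolution.hasDerivAt_bgDiff (h : IsTodaSolution a b) (A B : ℝ) (n : ℤ) (t : ℝ) :
    HasDerivAt (bgDiff A B a b n)
      (a n t * (b (n + 1) t - b n t), 2 * (a n t ^ 2 - a (n - 1) t ^ 2)) t :=
  ((h.a_eq n t).sub_const A).prodMk ((h.b_eq n t).sub_const B)

/-- Constant coefficients are equilibria of the lattice, so each component of the field is a
difference in which the background drops out; factoring the difference of squares makes it linear in
the deviation. -/
theorem norm_todaField_le {A B M : ℝ} {n : ℤ} {t : ℝ} (hM : ∀ n, |a n t| ≤ M ∧ |b n t| ≤ M) :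
    ‖((a n t * (b (n + 1) t - b n t), 2 * (a n t ^ 2 - a (n - 1) t ^ 2)) : ℝ × ℝ)‖ ≤
      4 * M * (‖bgDiff A B a b (n - 1) t‖ + ‖bgDiff A B a b n t‖ +
        ‖bgDiff A B a b (n + 1) t‖) := by
  have hM0 : 0 ≤ M := (abs_nonneg _).trans (hM n).1
  have ha : ∀ k, |a k t - A| ≤ ‖bgDiff A B a b k t‖ := fun k => norm_fst_le (bgDiff A B a b k t)
  have hb : ∀ k, |b k t - B| ≤ ‖bgDiff A B a b k t‖ := fun k => norm_snd_le (bgDiff A B a b k t)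
  have p1 := norm_nonneg (bgDiff A B a b (n - 1) t)
  have p2 := norm_nonneg (bgDiff A B a b n t)
  have p3 := norm_nonneg (bgDiff A B a b (n + 1) t)
  rw [Prod.norm_def, max_le_iff]
  constructor
  · rw [Real.norm_eq_abs, abs_mul]
    have e1 : |b (n + 1) t - b n t| ≤ ‖bgDiff A B a b (n + 1) t‖ + ‖bgDiff A B a b n t‖ := by
      have : b (n + 1) t - b n t = (b (n + 1) t - B) - (b n t - B) := by ring
      rw [this]
      exact (abs_sub _ _).trans (add_le_add (hb _) (hb _))
    refine (mul_le_mul (hM n).1 e1 (abs_nonneg _) hM0).trans ?_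
    nlinarith [mul_nonneg hM0 p1, mul_nonneg hM0 p2, mul_nonneg hM0 p3]
  · have e0 : 2 * (a n t ^ 2 - a (n - 1) t ^ 2) =
        2 * ((a n t + a (n - 1) t) * ((a n t - A) - (a (n - 1) t - A))) := by ring
    rw [e0, Real.norm_eq_abs, abs_mul, abs_two, abs_mul]
    have e1 : |a n t - A - (a (n - 1) t - A)| ≤
        ‖bgDiff A B a b n t‖ + ‖bgDiff A B a b (n - 1) t‖ :=
      (abs_sub _ _).trans (add_le_add (ha _) (ha _))
    have e2 : |a n t + a (n - 1) t| ≤ 2 * M := by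
      refine (abs_add_le _ _).trans ?_
      linarith [(hM n).1, (hM (n - 1)).1]
    have := mul_le_mul e2 e1 (abs_nonneg _) (by positivity)
    nlinarith [mul_nonneg hM0 p1, mul_nonneg hM0 p2, mul_nonneg hM0 p3]

/-- Exponential decay to the background persists, locally uniformly in time. -/
theorem IsTodaSolution.exists_background (h : IsTodaSolution a b) {A B m D w : ℝ} (hm : 0 < m)
    (hD : 0 ≤ D) (hw : 0 < w) (hw1 : w < 1) (h0 : ∀ n, m ≤ a n 0)
    (hA : ∀ n, |a n 0 - A| ≤ D * w ^ n) (hB : ∀ n, |b n 0 - B| ≤ D * w ^ n) (τ : ℝ) :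
    ∃ m' Q, ∀ t, |t| ≤ τ →
      Background A B m' Q (Real.sqrt w) (fun k => a k t) (fun k => b k t) := by
  obtain ⟨M, hM⟩ := h.bounded τ
  set K := 4 * |M| with hK
  set M' := |M| + |A| + |B| with hM'
  set Q := D * Real.exp (K * (w⁻¹ + 1 + w) * |τ|) with hQ
  have hMM : ∀ n t, |t| ≤ τ → |a n t| ≤ |M| ∧ |b n t| ≤ |M| := fun n t ht =>
    ⟨(hM n t ht).1.trans (le_abs_self _), (hM n t ht).2.trans (le_abs_self _)⟩
  have hx0 : ∀ n, ‖bgDiff A B a b n 0‖ ≤ D * w ^ n := fun n => max_le (hA n) (hB n)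
  have hbd : ∀ n t, |t| ≤ τ → ‖bgDiff A B a b n t‖ ≤ M' := by
    intro n t ht
    have p1 := abs_nonneg A
    have p2 := abs_nonneg B
    refine max_le ?_ ?_
    · have := abs_sub (a n t) A
      have := (hMM n t ht).1
      rw [Real.norm_eq_abs]; simp only [bgDiff]; linarith
    · have := abs_sub (b n t) B
      have := (hMM n t ht).2
      rw [Real.norm_eq_abs]; simp only [bgDiff]; linarith
  have hmain : ∀ n t, |t| ≤ τ → ‖bgDiff A B a b n t‖ ≤ Q * w ^ n := by
    have hfin : ∀ (n : ℤ) t, 0 ≤ t → t ≤ τ →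
        D * w ^ n * Real.exp (K * (w⁻¹ + 1 + w) * t) ≤ Q * w ^ n := by
      intro n t h0t ht
      rw [hQ, mul_right_comm]
      refine mul_le_mul_of_nonneg_right (mul_le_mul_of_nonneg_left (Real.exp_le_exp.2 ?_) hD)
        (by positivity)
      exact mul_le_mul_of_nonneg_left (ht.trans (le_abs_self _)) (by positivity)
    intro n t ht
    rcases le_total 0 t with hp | hp
    · rw [abs_of_nonneg hp] at ht
      refine (norm_le_of_nearest_neighbour (τ := τ) (K := K) (M := M') (by positivity)
        hD hw (fun n t => h.hasDerivAt_bgDiff A B n t) (fun n s hs => ?_)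
        (fun n s hs => ?_) hx0 n (t := t) ⟨hp, ht⟩).trans (hfin n t hp ht)
      · exact norm_todaField_le fun k => hMM k s (by rw [abs_of_nonneg hs.1]; exact hs.2)
      · exact hbd n s (by rw [abs_of_nonneg hs.1]; exact hs.2)
    · rw [abs_of_nonpos hp] at ht
      -- Negative times follow by running the same propagation estimate along s ↦ -s.
      have := norm_le_of_nearest_neighbour (τ := τ) (K := K) (M := M') (D := D) (w := w)
        (x := fun n s => bgDiff A B a b n (-s))
        (x' := fun n s => -((a n (-s) * (b (n + 1) (-s) - b n (-s)),
          2 * (a n (-s) ^ 2 - a (n - 1) (-s) ^ 2)) : ℝ × ℝ))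
        (by positivity) hD hw (fun n s => ?_) (fun n s hs => ?_)
        (fun n s hs => ?_) (fun n => by simpa using hx0 n) n (t := -t) ⟨by linarith, ht⟩
      · simp only [neg_neg] at this
        exact this.trans (hfin n (-t) (by linarith) ht)
      · have := (h.hasDerivAt_bgDiff A B n (-s)).scomp s (hasDerivAt_neg s)
        refine this.congr_deriv ?_
        rw [neg_one_smul]
      · rw [norm_neg]
        exact norm_todaField_le fun k => hMM k (-s) (by
          rw [abs_neg, abs_of_nonneg hs.1]; exact hs.2)
      · exact hbd n (-s) (by rw [abs_neg, abs_of_nonneg hs.1]; exact hs.2)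
  -- `Background` asks for decay like (ρⁿ)², so the rate w of the data corresponds to ρ = √w.
  have hsq : ∀ n : ℤ, (Real.sqrt w ^ n) ^ 2 = w ^ n := fun n => by
    rw [← zpow_natCast, ← zpow_mul, mul_comm, zpow_mul, zpow_natCast, Real.sq_sqrt hw.le]
  refine ⟨m * Real.exp (-(2 * |M| * τ)), Q, fun t ht => ⟨by positivity, by positivity,
    Real.sqrt_pos.2 hw, ?_, fun n => h.le_a hm h0 hMM n ht, fun n => ?_, fun n => ?_⟩⟩
  · rw [Real.sqrt_lt' one_pos]; simpa using hw1
  · rw [hsq]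
    exact (norm_fst_le (bgDiff A B a b n t)).trans (hmain n t ht)
  · rw [hsq]
    exact (norm_snd_le (bgDiff A B a b n t)).trans (hmain n t ht)

end

/-! ### The two backgrounds -/

/-- The terms of a convergent series are bounded, which converts the weighted sum into pointwise
decay. -/
theorem exists_bound_of_summable {C : ℝ} {f : ℕ → ℝ}
    (h : Summable fun n : ℕ => Real.exp (C * n) * f n) :
    ∃ D, 0 ≤ D ∧ ∀ n, f n ≤ D * Real.exp (-C) ^ n := by
  obtain ⟨D, hD⟩ := h.tendsto_atTop_zero.bddAbove_range
  refine ⟨max D 0, le_max_right _ _, fun n => ?_⟩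
  have h1 : Real.exp (C * n) * f n ≤ max D 0 := (hD ⟨n, rfl⟩).trans (le_max_left _ _)
  have h2 : Real.exp (-C) ^ n = (Real.exp (C * n))⁻¹ := by
    rw [← Real.exp_nat_mul, ← Real.exp_neg]; congr 1; ring
  rw [h2, ← div_eq_mul_inv, le_div_iff₀ (Real.exp_pos _)]
  linarith

/-- A bounded sequence on `ℤ` with geometric decay on `ℕ` has a global geometric bound. -/
theorem exists_zpow_bound {f : ℤ → ℝ} {M D w : ℝ} (hw : 0 < w) (hw1 : w < 1)
    (hM : ∀ n, f n ≤ M) (hD : 0 ≤ D) (h : ∀ n : ℕ, f n ≤ D * w ^ n) :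
    ∃ D', 0 ≤ D' ∧ ∀ n : ℤ, f n ≤ D' * w ^ n := by
  refine ⟨D + |M|, by positivity, fun n => ?_⟩
  rcases le_total 0 n with hn | hn
  · lift n to ℕ using hn
    refine (h n).trans ?_
    rw [zpow_natCast]
    exact mul_le_mul_of_nonneg_right (by linarith [abs_nonneg M]) (by positivity)
  · have h1 : 1 ≤ w ^ n := one_le_zpow_of_nonpos₀ hw hw1.le hn
    calc f n ≤ |M| := (hM n).trans (le_abs_self _)
      _ ≤ D + |M| := by linarith
      _ ≤ (D + |M|) * w ^ n := le_mul_of_one_le_right (by positivity) h1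

theorem exists_pos_lower_bound {f : ℤ → ℝ} {x y : ℝ} (hf : ∀ n, 0 < f n) (hx : 0 < x)
    (hy : 0 < y) (h1 : Tendsto f atTop (𝓝 x)) (h2 : Tendsto f atBot (𝓝 y)) :
    ∃ m, 0 < m ∧ ∀ n, m ≤ f n := by
  obtain ⟨N1, hN1⟩ := eventually_atTop.1 (h1.eventually_const_lt (half_lt_self hx))
  obtain ⟨N2, hN2⟩ := eventually_atBot.1 (h2.eventually_const_lt (half_lt_self hy))
  obtain ⟨k, hk⟩ : ∃ k, ∀ n ∈ Set.Icc N2 N1, f k ≤ f n := by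
    rcases (Set.Icc N2 N1).eq_empty_or_nonempty with he | hne
    · exact ⟨0, by simp [he]⟩
    · obtain ⟨k, -, hk⟩ := Set.exists_min_image _ f (Set.finite_Icc N2 N1) hne
      exact ⟨k, hk⟩
  refine ⟨min (f k) (min (x / 2) (y / 2)), by have := hf k; positivity, fun n => ?_⟩
  rcases lt_or_ge N1 n with h | h
  · exact ((min_le_right _ _).trans (min_le_left _ _)).trans (hN1 n h.le).le
  rcases lt_or_ge n N2 with h' | h'
  · exact ((min_le_right _ _).trans (min_le_right _ _)).trans (hN2 n h'.le).le
  · exact (min_le_left _ _).trans (hk n ⟨h', h⟩)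

section

variable {a b : ℤ → ℝ → ℝ} {c d C : ℝ}

theorem SteplikeDecay.exists_bounds {a₀ b₀ : ℤ → ℝ} (hC : 0 < C)
    (h : SteplikeDecay c d C a₀ b₀) {M : ℝ} (hM : ∀ n, |a₀ n| ≤ M ∧ |b₀ n| ≤ M) :
    ∃ D, 0 ≤ D ∧ (∀ n : ℤ, |a₀ n - 1 / 2| + |b₀ n| ≤ D * Real.exp (-C) ^ n) ∧
      ∀ n : ℤ, |a₀ (-n) - d| + |b₀ (-n) + c| ≤ D * Real.exp (-C) ^ n := by
  have hw : Real.exp (-C) < 1 := Real.exp_lt_one_iff.2 (by linarith)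
  obtain ⟨D1, hD1, h1⟩ := exists_bound_of_summable h.right
  obtain ⟨D2, hD2, h2⟩ := exists_bound_of_summable h.left
  obtain ⟨E1, hE1, k1⟩ := exists_zpow_bound (f := fun n => |a₀ n - 1 / 2| + |b₀ n|)
    (M := M + |(1 / 2 : ℝ)| + M) (Real.exp_pos _) hw
    (fun n => add_le_add ((abs_sub _ _).trans (add_le_add_left (hM n).1 _)) (hM n).2) hD1 h1
  obtain ⟨E2, hE2, k2⟩ := exists_zpow_bound (f := fun n => |a₀ (-n) - d| + |b₀ (-n) + c|)
    (M := M + |d| + (M + |c|)) (Real.exp_pos _) hw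
    (fun n => add_le_add ((abs_sub _ _).trans (add_le_add_left (hM (-n)).1 _))
      ((abs_add_le _ _).trans (add_le_add_left (hM (-n)).2 _))) hD2 h2
  refine ⟨max E1 E2, le_max_of_le_left hE1, fun n => (k1 n).trans ?_, fun n => (k2 n).trans ?_⟩
  · exact mul_le_mul_of_nonneg_right (le_max_left _ _) (by positivity)
  · exact mul_le_mul_of_nonneg_right (le_max_right _ _) (by positivity)

theorem tendsto_of_zpow_bound {f : ℤ → ℝ} {x D w : ℝ} (hw : 0 < w) (hw1 : w < 1)
    (h : ∀ n, |f n - x| ≤ D * w ^ n) : Tendsto f atTop (𝓝 x) := by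
  have h1 : Tendsto (fun n : ℤ => D * w ^ n.toNat) atTop (𝓝 0) := by
    have := (tendsto_pow_atTop_nhds_zero_of_lt_one hw.le hw1).const_mul D
    rw [mul_zero] at this
    exact this.comp (tendsto_atTop.2 fun k => by
      filter_upwards [eventually_ge_atTop (k : ℤ)] with n hn; omega)
  rw [tendsto_iff_dist_tendsto_zero]
  refine squeeze_zero' (Eventually.of_forall fun _ => dist_nonneg) ?_ h1
  filter_upwards [eventually_ge_atTop 0] with n hn
  rw [Real.dist_eq]
  refine (h n).trans (le_of_eq ?_)
  lift n to ℕ using hn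
  simp

/-- Both backgrounds persist under the flow, locally uniformly in time; the left one is expressed
for the reflected coefficients. -/
theorem IsTodaSolution.exists_backgrounds (h : IsTodaSolution a b) (hC : 0 < C) (hd : 0 < d)
    (hpos : ∀ n, 0 < a n 0)
    (hdecay : SteplikeDecay c d C (fun n => a n 0) (fun n => b n 0)) (τ : ℝ) :
    ∃ ρ m₁ Q₁ m₂ Q₂, ∀ t, |t| ≤ τ →
      Background d (-c) m₁ Q₁ ρ (fun k => a (-k - 1) t) (fun k => b (-k) t) ∧
      Background (1 / 2) 0 m₂ Q₂ ρ (fun k => a k t) (fun k => b k t) := by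
  obtain ⟨M, hM⟩ := h.bounded 0
  have hw : Real.exp (-C) < 1 := Real.exp_lt_one_iff.2 (by linarith)
  have hw0 := Real.exp_pos (-C)
  obtain ⟨D, hD, h1, h2⟩ := hdecay.exists_bounds hC fun n => hM n 0 (by simp)
  have r1 : ∀ n, |a n 0 - 1 / 2| ≤ D * Real.exp (-C) ^ n := fun n =>
    (le_add_of_nonneg_right (abs_nonneg _)).trans (h1 n)
  have r2 : ∀ n, |b n 0 - 0| ≤ D * Real.exp (-C) ^ n := fun n => by
    rw [sub_zero]; exact (le_add_of_nonneg_left (abs_nonneg _)).trans (h1 n)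
  have l1 : ∀ n, |a (-n) 0 - d| ≤ D * Real.exp (-C) ^ n := fun n =>
    (le_add_of_nonneg_right (abs_nonneg _)).trans (h2 n)
  -- Reflection moves the bond between n and n + 1 to the index -n - 1, one site further out, where
  -- the bound is only better.
  have l1' : ∀ n, |a (-n - 1) 0 - d| ≤ D * Real.exp (-C) ^ n := fun n => by
    have := l1 (n + 1)
    rw [show -(n + 1) = -n - 1 by ring] at this
    refine this.trans (mul_le_mul_of_nonneg_left ?_ hD)
    rw [zpow_add_one₀ hw0.ne']
    exact mul_le_of_le_one_right (by positivity) hw.le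
  have l2 : ∀ n, |b (-n) 0 - -c| ≤ D * Real.exp (-C) ^ n := fun n => by
    rw [sub_neg_eq_add]; exact (le_add_of_nonneg_left (abs_nonneg _)).trans (h2 n)
  have hbot : Tendsto (fun n => a n 0) atBot (𝓝 d) := by
    have := (tendsto_of_zpow_bound (f := fun n => a (-n) 0) hw0 hw l1).comp
      tendsto_neg_atBot_atTop
    simpa [Function.comp_def] using this
  obtain ⟨m, hm, hma⟩ := exists_pos_lower_bound hpos (by norm_num) hd
    (tendsto_of_zpow_bound hw0 hw r1) hbot
  obtain ⟨m₂, Q₂, hr⟩ := h.exists_background hm hD hw0 hw hma r1 r2 τ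
  obtain ⟨m₁, Q₁, hl⟩ := h.reflect.exists_background (A := d) (B := -c) hm hD hw0 hw
    (fun n => by simpa using hma (-n - 1)) (by simpa using l1') (by simpa using l2) τ
  refine ⟨_, m₁, Q₁, m₂, Q₂, fun t ht => ⟨?_, hr t ht⟩⟩
  simpa using hl (-t) (by simpa using ht)

end

end

section

/-! ### The Joukovski variable of a band -/

/-- The band `[B - 2A, B + 2A]` as a subset of `ℂ`. -/
def band (A B : ℝ) : Set ℂ := (fun x : ℝ => (x : ℂ)) '' Set.Icc (B - 2 * A) (B + 2 * A)

/-- `√((lam - B)² - 4A²)`, holomorphic off the band. -/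
def root (A B : ℝ) (lam : ℂ) : ℂ := bandRoot (B - 2 * A) (B + 2 * A) lam

/-- The Joukovski variable of the band, of modulus less than one off the band. -/
def jouk (A B : ℝ) (lam : ℂ) : ℂ := (lam - B - root A B lam) / (2 * A)

theorem root1_eq (c d : ℝ) : root1 c d = root d (-c) := by
  funext lam; simp [root1, root]

theorem root2_eq : root2 = root (1 / 2) 0 := by
  funext lam; simp [root2, root]

theorem I1_eq (c d : ℝ) : I1 c d = band d (-c) := rfl

theorem I2_eq : I2 = band (1 / 2) 0 := by
  simp [I2, band]

theorem root_sq (A B : ℝ) (lam : ℂ) : root A B lam ^ 2 = (lam - B) ^ 2 - 4 * A ^ 2 := by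
  rw [root, bandRoot_sq]; ring

variable {A B : ℝ} {lam : ℂ}

theorem ofReal_mem_band {x : ℝ} : (x : ℂ) ∈ band A B ↔ x ∈ Set.Icc (B - 2 * A) (B + 2 * A) := by
  simp [band]

theorem not_mem_band_of_im (h : lam.im ≠ 0) : lam ∉ band A B := by
  rintro ⟨x, -, rfl⟩; simp at h

theorem sub_ne_zero_of_not_mem_band (hA : 0 < A) (h : lam ∉ band A B) :
    lam - (B - 2 * A) ≠ 0 := by
  intro h0
  refine h ⟨B - 2 * A, ⟨le_rfl, by linarith⟩, ?_⟩
  push_cast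
  linear_combination -h0

theorem root_ne_zero (hA : 0 < A) (h : lam ∉ band A B) : root A B lam ≠ 0 := by
  intro h0
  have h1 : root A B lam ^ 2 = (lam - (B - 2 * A)) * (lam - (B + 2 * A)) := bandRoot_sq _ _ _
  rw [h0, zero_pow two_ne_zero, zero_eq_mul] at h1
  rcases h1 with h1 | h1
  · exact sub_ne_zero_of_not_mem_band hA h h1
  · refine h ⟨B + 2 * A, ⟨by linarith, le_rfl⟩, ?_⟩
    push_cast
    linear_combination -h1

/-- The Möbius quotient takes nonpositive real values only on the band: solving for lam at a value x
≤ 0 gives a convex combination of the two band edges. -/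
theorem quot_mem_slitPlane (hA : 0 < A) (h : lam ∉ band A B) :
    (lam - (B + 2 * A)) / (lam - (B - 2 * A)) ∈ Complex.slitPlane := by
  have h0 := sub_ne_zero_of_not_mem_band hA h
  by_contra hs
  rw [Complex.mem_slitPlane_iff, not_or, not_lt, not_not] at hs
  set w := (lam - (B + 2 * A)) / (lam - (B - 2 * A)) with hw
  have hx : w = (w.re : ℂ) := Complex.ext rfl (by simpa using hs.2)
  set x := w.re
  have hx0 : x ≤ 0 := hs.1
  have e1 : lam - (B + 2 * A) = x * (lam - (B - 2 * A)) := by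
    rw [← hx, hw, div_mul_cancel₀ _ h0]
  have h1x : (0 : ℝ) < 1 - x := by linarith
  have h1x' : (1 - x : ℂ) ≠ 0 := by exact_mod_cast h1x.ne'
  have e2 : lam = (((B + 2 * A) - x * (B - 2 * A)) / (1 - x) : ℝ) := by
    push_cast
    rw [eq_div_iff h1x']
    linear_combination e1
  refine h ?_
  rw [e2, ofReal_mem_band]
  constructor
  · rw [le_div_iff₀ h1x]; nlinarith
  · rw [div_le_iff₀ h1x]; nlinarith

theorem differentiableAt_root (hA : 0 < A) (h : lam ∉ band A B) :
    DifferentiableAt ℂ (root A B) lam := by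
  have h0 := sub_ne_zero_of_not_mem_band hA h
  unfold root bandRoot
  refine DifferentiableAt.fun_mul (by fun_prop) ?_
  refine DifferentiableAt.cpow ?_ (by fun_prop) (quot_mem_slitPlane hA h)
  exact DifferentiableAt.fun_div (by fun_prop) (by fun_prop) h0

theorem differentiableAt_jouk (hA : 0 < A) (h : lam ∉ band A B) :
    DifferentiableAt ℂ (jouk A B) lam := by
  have := differentiableAt_root hA h
  unfold jouk
  fun_prop

/-- The principal power commutes with conjugation away from argument π, and off the band the
quotient avoids that ray. -/
theorem root_conj (hA : 0 < A) (h : lam ∉ band A B) :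
    root A B (starRingEnd ℂ lam) = starRingEnd ℂ (root A B lam) := by
  have hs := quot_mem_slitPlane hA h
  have := Complex.conj_cpow _ (1 / 2 : ℂ) (Complex.mem_slitPlane_iff_arg.1 hs).1
  simp only [map_div₀, map_sub, map_add, map_mul, Complex.conj_ofReal, map_ofNat, map_one] at this
  simp only [root, bandRoot, map_mul, map_sub, Complex.conj_ofReal, map_ofNat]
  rw [this]

/-- The principal square root on the slit plane has positive real part. -/
theorem re_cpow_half_pos {w : ℂ} (hw : w ∈ Complex.slitPlane) : 0 < (w ^ (1 / 2 : ℂ)).re := by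
  have h0 := Complex.slitPlane_ne_zero hw
  rw [Complex.cpow_def_of_ne_zero h0, Complex.exp_re]
  refine mul_pos (Real.exp_pos _) (Real.cos_pos_of_mem_Ioo ?_)
  have e : (Complex.log w * (1 / 2)).im = w.arg / 2 := by
    rw [show Complex.log w * (1 / 2) = Complex.log w * ((1 / 2 : ℝ) : ℂ) by norm_num,
      Complex.im_mul_ofReal, Complex.log_im]
    ring
  rw [e]
  have h1 := (Complex.mem_slitPlane_iff_arg.1 hw).1
  have h2 := Complex.neg_pi_lt_arg w
  have h3 := lt_of_le_of_ne (Complex.arg_le_pi w) h1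
  constructor <;> linarith

/-- The Joukovski variable is the Cayley transform of `√((lam - (B + 2A)) / (lam - (B - 2A)))`. -/
theorem jouk_eq_cayley (hA : 0 < A) (h : lam ∉ band A B) :
    jouk A B lam = (1 - ((lam - (B + 2 * A)) / (lam - (B - 2 * A))) ^ (1 / 2 : ℂ)) /
      (1 + ((lam - (B + 2 * A)) / (lam - (B - 2 * A))) ^ (1 / 2 : ℂ)) := by
  have h0 := sub_ne_zero_of_not_mem_band hA h
  have hA' : (A : ℂ) ≠ 0 := by exact_mod_cast hA.ne'
  have hre := re_cpow_half_pos (quot_mem_slitPlane hA h)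
  simp only [jouk, root, bandRoot]
  set r := ((lam - (B + 2 * A)) / (lam - (B - 2 * A))) ^ (1 / 2 : ℂ) with hr
  have hr2 : r ^ 2 * (lam - (B - 2 * A)) = lam - (B + 2 * A) := by
    have : r ^ 2 = (lam - (B + 2 * A)) / (lam - (B - 2 * A)) := by rw [hr]; simp
    rw [this, div_mul_cancel₀ _ h0]
  have h1 : 1 + r ≠ 0 := by
    intro h1
    have := congrArg Complex.re h1
    simp at this
    linarith
  rw [div_eq_div_iff (by simpa using hA') h1]
  linear_combination -hr2

/-- The Cayley transform maps the right half-plane into the unit disc, and the principal square root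
on the slit plane has positive real part. -/
theorem norm_jouk_lt_one (hA : 0 < A) (h : lam ∉ band A B) : ‖jouk A B lam‖ < 1 := by
  have hre := re_cpow_half_pos (quot_mem_slitPlane hA h)
  rw [jouk_eq_cayley hA h]
  set r := ((lam - (B + 2 * A)) / (lam - (B - 2 * A))) ^ (1 / 2 : ℂ)
  have h1 : 0 < ‖1 + r‖ := by
    rw [norm_pos_iff]
    intro h1
    have := congrArg Complex.re h1
    simp at this
    linarith
  rw [norm_div, div_lt_one h1]
  refine lt_of_pow_lt_pow_left₀ 2 h1.le ?_
  rw [Complex.sq_norm, Complex.sq_norm, Complex.normSq_apply, Complex.normSq_apply]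
  simp
  nlinarith

/-- The Cayley form avoids the cancellation between lam - B and the root: the quotient under the
square root simply tends to 1. -/
theorem tendsto_jouk_cobounded (hA : 0 < A) :
    Tendsto (jouk A B) (Bornology.cobounded ℂ) (𝓝 0) := by
  have h1 : Tendsto (fun lam : ℂ => lam - (B - 2 * A)) (Bornology.cobounded ℂ)
      (Bornology.cobounded ℂ) := by
    rw [← tendsto_norm_atTop_iff_cobounded]
    refine tendsto_atTop_mono (fun lam => norm_sub_norm_le lam _) ?_
    simpa only [sub_eq_add_neg] using
      tendsto_atTop_add_const_right _ (-‖(B : ℂ) - 2 * A‖) tendsto_norm_cobounded_atTop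
  have h2 : Tendsto (fun lam : ℂ => 1 - 4 * A * (lam - (B - 2 * A))⁻¹) (Bornology.cobounded ℂ)
      (𝓝 1) := by
    have := ((tendsto_inv₀_cobounded.comp h1).const_mul (4 * A : ℂ)).const_sub 1
    simpa [Function.comp_def] using this
  have hev : ∀ᶠ lam in Bornology.cobounded ℂ, lam ∉ band A B :=
    (isCompact_Icc.image Complex.continuous_ofReal).isBounded
  have h3 : Tendsto (fun lam : ℂ => ((lam - (B + 2 * A)) / (lam - (B - 2 * A))) ^ (1 / 2 : ℂ))
      (Bornology.cobounded ℂ) (𝓝 1) := by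
    have hc : ContinuousAt (fun w : ℂ => w ^ (1 / 2 : ℂ)) 1 :=
      continuousAt_cpow_const (by simp)
    have := hc.tendsto.comp h2
    rw [Complex.one_cpow] at this
    refine this.congr' ?_
    filter_upwards [hev] with lam hl
    have h0 := sub_ne_zero_of_not_mem_band hA hl
    simp only [Function.comp_apply]
    congr 1
    rw [eq_div_iff h0, sub_mul, mul_assoc, inv_mul_cancel₀ h0]
    ring
  have h4 := (h3.const_sub 1).div (h3.const_add 1) (by norm_num)
  rw [sub_self, zero_div] at h4
  refine h4.congr' ?_
  filter_upwards [hev] with lam hl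
  exact (jouk_eq_cayley hA hl).symm

/-- Algebraic relations between `lam`, the root `s` and the Joukovski variable. -/
theorem joukowski_relations {A B lam s z : ℂ} (hA : A ≠ 0) (hs : s ^ 2 = (lam - B) ^ 2 - 4 * A ^ 2)
    (hz : z = (lam - B - s) / (2 * A)) :
    z ≠ 0 ∧ lam = B + A * (z + z⁻¹) ∧ s = A * (z⁻¹ - z) := by
  have h1 : z * ((lam - B + s) / (2 * A)) = 1 := by
    rw [hz]; field_simp; linear_combination -hs
  have h0 : z ≠ 0 := left_ne_zero_of_mul_eq_one h1
  have h2 : z⁻¹ = (lam - B + s) / (2 * A) := inv_eq_of_mul_eq_one_right h1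
  refine ⟨h0, ?_, ?_⟩
  · rw [h2, hz]; field_simp; ring
  · rw [h2, hz]; field_simp; ring

end

section

/-! ### The two-sheeted surface -/

section Surface

variable {c d : ℝ}

/-- The standing assumptions on the position of the bands. -/
structure BandGap (c d : ℝ) : Prop where
  d_pos : 0 < d
  gap : 2 * d < c - 1

theorem BandGap.disjoint (h : BandGap c d) {x : ℂ} (h1 : x ∈ I1 c d) : x ∉ I2 := by
  rintro ⟨y, hy, rfl⟩
  obtain ⟨x, hx, hxy⟩ := h1
  have : x = y := Complex.ofReal_injective hxy
  have := h.gap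
  have := hx.2
  have := hy.1
  linarith

theorem Curve.continuous_lam : Continuous (Curve.lam : Curve c d → ℂ) :=
  continuous_fst.comp continuous_subtype_val

theorem Curve.continuous_w : Continuous (Curve.w : Curve c d → ℂ) :=
  continuous_snd.comp continuous_subtype_val

theorem Curve.continuous_star : Continuous (Curve.star : Curve c d → Curve c d) :=
  Continuous.subtype_mk (Curve.continuous_lam.prodMk Curve.continuous_w.neg) _

@[simp] theorem Curve.star_star (p : Curve c d) : p.star.star = p := by
  simp [Curve.star]

@[simp] theorem Curve.lam_star (p : Curve c d) : p.star.lam = p.lam := rfl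

@[simp] theorem Curve.w_star (p : Curve c d) : p.star.w = -p.w := rfl

theorem star_mem_Sig {p : Curve c d} : p.star ∈ Sig c d ↔ p ∈ Sig c d := Iff.rfl

theorem star_mem_PiU {p : Curve c d} : p.star ∈ PiU c d ↔ p ∈ PiL c d := by
  simp [PiU, PiL, neg_eq_iff_eq_neg]

theorem star_mem_PiL {p : Curve c d} : p.star ∈ PiL c d ↔ p ∈ PiU c d := by
  simp [PiU, PiL]

theorem upperPt_mem {lam : ℂ} (h : lam ∉ bands c d) : upperPt c d lam ∈ PiU c d := ⟨h, rfl⟩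

theorem not_mem_PiU_of_mem_Sig {p : Curve c d} (hp : p ∈ Sig c d) : p ∉ PiU c d :=
  fun h => h.1 hp

theorem lam_not_mem_I1 {p : Curve c d} (hp : p ∈ PiU c d) : p.lam ∉ band d (-c) :=
  fun h => hp.1 (Or.inl h)

theorem lam_not_mem_I2 {p : Curve c d} (hp : p ∈ PiU c d) : p.lam ∉ band (1 / 2) 0 :=
  fun h => hp.1 (Or.inr (I2_eq ▸ h))

theorem tendsto_star_PiL (p : Curve c d) :
    Tendsto Curve.star (𝓝[PiL c d] p) (𝓝[PiU c d] p.star) :=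
  tendsto_nhdsWithin_iff.2 ⟨Curve.continuous_star.continuousAt.tendsto.mono_left
    nhdsWithin_le_nhds, eventually_nhdsWithin_of_forall fun _ hq => star_mem_PiU.2 hq⟩

theorem tendsto_star_PiU (p : Curve c d) :
    Tendsto Curve.star (𝓝[PiU c d] p) (𝓝[PiL c d] p.star) :=
  tendsto_nhdsWithin_iff.2 ⟨Curve.continuous_star.continuousAt.tendsto.mono_left
    nhdsWithin_le_nhds, eventually_nhdsWithin_of_forall fun _ hq => star_mem_PiL.2 hq⟩

namespace BandGap

theorem not_mem_band1 (h : BandGap c d) {p : Curve c d} (hp : p ∈ Sigma2 c d) :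
    p.lam ∉ band d (-c) := fun h1 => h.disjoint h1 hp

theorem not_mem_band2 (h : BandGap c d) {p : Curve c d} (hp : p ∈ Sigma1 c d) :
    p.lam ∉ band (1 / 2) 0 := I2_eq ▸ h.disjoint hp

theorem not_mem_PiU_of_mem_PiL (h : BandGap c d) {p : Curve c d} (hp : p ∈ PiL c d) :
    p ∉ PiU c d := by
  intro hU
  have h1 : Rhalf c d p.lam = 0 := by
    have := hp.2.symm.trans hU.2
    linear_combination (-1 / 2) * this
  rw [Rhalf, neg_eq_zero, mul_eq_zero, root1_eq, root2_eq] at h1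
  rcases h1 with h1 | h1
  · exact root_ne_zero (by norm_num) (lam_not_mem_I2 hU) h1
  · exact root_ne_zero h.d_pos (lam_not_mem_I1 hU) h1

theorem lam_real {p : Curve c d} (hp : p ∈ Sig c d) : ∃ x : ℝ, p.lam = x := by
  rcases hp with ⟨x, -, hx⟩ | ⟨x, -, hx⟩ <;> exact ⟨x, hx.symm⟩

/-- On the cuts the coordinate `w` is purely imaginary. -/
theorem conj_w (h : BandGap c d) {p : Curve c d} (hp : p ∈ Sig c d) :
    starRingEnd ℂ p.w = -p.w := by
  obtain ⟨x, hx⟩ := lam_real hp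
  have hd := h.d_pos
  have hg := h.gap
  -- The bands are disjoint, so over either of them one quadratic factor is nonpositive and the
  -- other nonnegative; w² is then a nonpositive real.
  have hsign : (x ^ 2 - 1) * ((x + c) ^ 2 - 4 * d ^ 2) ≤ 0 := by
    rcases hp with hp | hp
    · have hx1 : x ∈ Set.Icc (-c - 2 * d) (-c + 2 * d) := by
        have : ((x : ℝ) : ℂ) ∈ I1 c d := hx ▸ hp
        simpa [I1] using this
      refine mul_nonpos_of_nonneg_of_nonpos ?_ ?_
      · nlinarith [hx1.1, hx1.2]
      · nlinarith [hx1.1, hx1.2]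
    · have hx1 : x ∈ Set.Icc (-1 : ℝ) 1 := by
        have : ((x : ℝ) : ℂ) ∈ I2 := hx ▸ hp
        simpa [I2] using this
      refine mul_nonpos_of_nonpos_of_nonneg ?_ ?_
      · nlinarith [hx1.1, hx1.2]
      · nlinarith [hx1.1, hx1.2]
  have hw : p.w ^ 2 = (((x ^ 2 - 1) * ((x + c) ^ 2 - 4 * d ^ 2) : ℝ) : ℂ) := by
    have := p.2
    change p.w ^ 2 = (p.lam ^ 2 - 1) * ((p.lam + c) ^ 2 - 4 * (d : ℂ) ^ 2) at this
    rw [this, hx]; push_cast; ring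
  set y := (x ^ 2 - 1) * ((x + c) ^ 2 - 4 * d ^ 2)
  have hre := congrArg Complex.re hw
  have him := congrArg Complex.im hw
  simp [sq] at hre him
  have hre0 : p.w.re = 0 := by
    by_contra hne
    have : p.w.im = 0 := by
      have : p.w.re * p.w.im = 0 := by linarith
      exact (mul_eq_zero.1 this).resolve_left hne
    rw [this] at hre
    have := mul_self_pos.2 hne
    linarith
  exact Complex.ext (by simp [hre0]) (by simp)

theorem Rhalf_conj (h : BandGap c d) {lam : ℂ} (hl : lam ∉ bands c d) :
    Rhalf c d (starRingEnd ℂ lam) = starRingEnd ℂ (Rhalf c d lam) := by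
  rw [Rhalf, Rhalf, root1_eq, root2_eq, root_conj h.d_pos (fun h => hl (Or.inl h)),
    root_conj (by norm_num) (fun h => hl (Or.inr (I2_eq ▸ h)))]
  simp

/-- Every point of `Σ` is a limit of points of the upper sheet. -/
theorem mem_closure_PiU (h : BandGap c d) {p : Curve c d} (hp : p ∈ Sig c d) :
    p ∈ closure (PiU c d) := by
  rw [Metric.mem_closure_iff]
  intro ε hε
  obtain ⟨x, hx⟩ := lam_real hp
  have hw := p.2
  change p.w ^ 2 = (p.lam ^ 2 - 1) * ((p.lam + c) ^ 2 - 4 * (d : ℂ) ^ 2) at hw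
  have hc : ContinuousAt (fun y : ℝ => ((x + y * Complex.I : ℂ) ^ 2 - 1) *
      (((x + y * Complex.I : ℂ) + c) ^ 2 - 4 * (d : ℂ) ^ 2)) 0 := by fun_prop
  have hc' := Metric.continuousAt_iff.1 hc (ε ^ 2) (by positivity)
  obtain ⟨δ, hδ, hδ'⟩ := hc'
  set y := min (δ / 2) (ε / 2) with hy
  have hy0 : 0 < y := by positivity
  have hyε : y < ε := (min_le_right _ _).trans_lt (by linarith)
  have hyδ : y < δ := (min_le_left _ _).trans_lt (by linarith)
  set lam : ℂ := x + y * Complex.I with hlam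
  have him : lam.im = y := by simp [hlam]
  have hl : ∀ l : ℂ, l.im ≠ 0 → l ∉ bands c d := by
    rintro l hl (hl' | hl')
    · exact not_mem_band_of_im hl (I1_eq c d ▸ hl')
    · exact not_mem_band_of_im hl (I2_eq ▸ hl')
  have hl1 : lam ∉ bands c d := hl _ (by rw [him]; exact hy0.ne')
  have hl2 : starRingEnd ℂ lam ∉ bands c d := hl _ (by
    rw [Complex.conj_im, him]; exact neg_ne_zero.2 hy0.ne')
  have hdist : dist p.lam lam < ε := by
    rw [hx, dist_comm, dist_eq_norm, hlam]
    simpa [abs_of_pos hy0] using hyε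
  have hdist' : dist p.lam (starRingEnd ℂ lam) < ε := by
    rw [hx, dist_comm, dist_eq_norm, hlam]
    simpa [abs_of_pos hy0] using hyε
  -- Only the squares of `Rhalf` and w are compared, so one of the two factors must be small. This
  -- avoids deciding which side of the cut belongs to p and treats branch points uniformly.
  have hR : ‖Rhalf c d lam - p.w‖ * ‖Rhalf c d lam + p.w‖ < ε ^ 2 := by
    rw [← norm_mul]
    have e : (Rhalf c d lam - p.w) * (Rhalf c d lam + p.w) = Rhalf c d lam ^ 2 - p.w ^ 2 := by ring
    have hU : Rhalf c d lam ^ 2 = (lam ^ 2 - 1) * ((lam + c) ^ 2 - 4 * (d : ℂ) ^ 2) :=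
      (upperPt c d lam).2
    rw [e, hw, hU, hx, ← dist_eq_norm]
    have := hδ' (x := y) (by simpa [abs_of_pos hy0] using hyδ)
    simpa [← hlam] using this
  have hor : ‖Rhalf c d lam - p.w‖ < ε ∨ ‖Rhalf c d lam + p.w‖ < ε := by
    by_contra! hcon
    have := mul_le_mul hcon.1 hcon.2 hε.le (norm_nonneg _)
    nlinarith
  -- If `Rhalf` at lam is near -w instead of w, the conjugate of lam serves: conjugation changes the
  -- sign of w on the cut.
  rcases hor with h1 | h1
  · refine ⟨upperPt c d lam, upperPt_mem hl1, ?_⟩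
    rw [Subtype.dist_eq, Prod.dist_eq]
    exact max_lt hdist (by rw [dist_comm, dist_eq_norm]; exact h1)
  · refine ⟨upperPt c d (starRingEnd ℂ lam), upperPt_mem hl2, ?_⟩
    rw [Subtype.dist_eq, Prod.dist_eq]
    refine max_lt hdist' ?_
    rw [dist_comm, dist_eq_norm]
    change ‖Rhalf c d (starRingEnd ℂ lam) - p.w‖ < ε
    rw [h.Rhalf_conj hl1, ← Complex.norm_conj, map_sub, Complex.conj_conj, h.conj_w hp,
      sub_neg_eq_add]
    exact h1

theorem neBot_PiU (h : BandGap c d) {p : Curve c d} (hp : p ∈ Sig c d) :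
    (𝓝[PiU c d] p).NeBot := mem_closure_iff_nhdsWithin_neBot.1 (h.mem_closure_PiU hp)

theorem neBot_PiL (h : BandGap c d) {p : Curve c d} (hp : p ∈ Sig c d) :
    (𝓝[PiL c d] p).NeBot := by
  have := h.neBot_PiU (star_mem_Sig.2 hp)
  have := (tendsto_star_PiU p.star).neBot
  rwa [Curve.star_star] at this

end BandGap

/-! ### Boundary values and reality of the roots and Joukovski variables on the cuts. -/

theorem onClosU_of_mem {f : ℂ → ℂ} {p : Curve c d} (hp : p ∈ PiU c d) :
    onClosU f p = f p.lam := if_pos hp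

theorem onClosU_eq_of_tendsto (h : BandGap c d) {f : ℂ → ℂ} {p : Curve c d} (hp : p ∈ Sig c d)
    {y : ℂ} (hf : Tendsto (fun q : Curve c d => f q.lam) (𝓝[PiU c d] p) (𝓝 y)) :
    onClosU f p = y := by
  have := h.neBot_PiU hp
  rw [onClosU, if_neg (not_mem_PiU_of_mem_Sig hp)]
  exact hf.limUnder_eq

/-- The values of a root at the points over the other band, as limits from the upper sheet. -/
theorem tendsto_of_continuousAt_lam {f : ℂ → ℂ} {p : Curve c d} (hf : ContinuousAt f p.lam) :
    Tendsto (fun q : Curve c d => f q.lam) (𝓝[PiU c d] p) (𝓝 (f p.lam)) :=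
  (hf.tendsto.comp Curve.continuous_lam.continuousAt.tendsto).mono_left nhdsWithin_le_nhds

/-- The values of a root at the points over its own band, as limits from the upper sheet. -/
theorem tendsto_of_mul_eq {f g : ℂ → ℂ} {p : Curve c d} (hg : ContinuousAt g p.lam)
    (hg0 : g p.lam ≠ 0) (hfg : ∀ q ∈ PiU c d, f q.lam * g q.lam = -q.w) :
    Tendsto (fun q : Curve c d => f q.lam) (𝓝[PiU c d] p) (𝓝 (-p.w / g p.lam)) := by
  have h1 := tendsto_of_continuousAt_lam (p := p) hg
  have h2 : Tendsto (fun q : Curve c d => -q.w) (𝓝[PiU c d] p) (𝓝 (-p.w)) :=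
    Curve.continuous_w.neg.continuousAt.tendsto.mono_left nhdsWithin_le_nhds
  refine (h2.div h1 hg0).congr' ?_
  filter_upwards [h1.eventually_ne hg0, self_mem_nhdsWithin] with q hq hqU
  change -q.w / g q.lam = f q.lam
  rw [div_eq_iff hq, hfg q hqU]

/-- The coordinate w is continuous on the whole curve, and over a band the root of the other band is
continuous and nonzero. Dividing therefore gives the boundary value of the root that jumps. -/
theorem root1_mul_root2 {p : Curve c d} (hp : p ∈ PiU c d) :
    root1 c d p.lam * root2 p.lam = -p.w := by
  rw [hp.2, Rhalf]; ring

namespace BandGap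

theorem s1_of_mem {p : Curve c d} (hp : p ∈ PiU c d) : s1 p = root d (-c) p.lam := by
  rw [s1, onClosU_of_mem hp, root1_eq]

theorem s2_of_mem {p : Curve c d} (hp : p ∈ PiU c d) : s2 p = root (1 / 2) 0 p.lam := by
  rw [s2, onClosU_of_mem hp, root2_eq]

theorem z1_of_mem {p : Curve c d} (hp : p ∈ PiU c d) : z1 p = jouk d (-c) p.lam := by
  rw [z1, s1_of_mem hp, jouk]; simp

theorem z2_of_mem {p : Curve c d} (hp : p ∈ PiU c d) : z2 p = jouk (1 / 2) 0 p.lam := by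
  rw [z2, s2_of_mem hp, jouk]; simp

theorem continuousAt_root1 (h : BandGap c d) {p : Curve c d} (hp : p ∈ Sigma2 c d) :
    ContinuousAt (root1 c d) p.lam := by
  rw [root1_eq]; exact (differentiableAt_root h.d_pos (h.not_mem_band1 hp)).continuousAt

theorem continuousAt_root2 (h : BandGap c d) {p : Curve c d} (hp : p ∈ Sigma1 c d) :
    ContinuousAt root2 p.lam := by
  rw [root2_eq]; exact (differentiableAt_root (by norm_num) (h.not_mem_band2 hp)).continuousAt

theorem root1_ne (h : BandGap c d) {p : Curve c d} (hp : p ∈ Sigma2 c d) :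
    root1 c d p.lam ≠ 0 := by
  rw [root1_eq]; exact root_ne_zero h.d_pos (h.not_mem_band1 hp)

theorem root2_ne (h : BandGap c d) {p : Curve c d} (hp : p ∈ Sigma1 c d) :
    root2 p.lam ≠ 0 := by
  rw [root2_eq]; exact root_ne_zero (by norm_num) (h.not_mem_band2 hp)

theorem s1_eq_root (h : BandGap c d) {p : Curve c d} (hp : p ∈ Sigma2 c d) :
    s1 p = root1 c d p.lam :=
  onClosU_eq_of_tendsto h (Or.inr hp) (tendsto_of_continuousAt_lam (h.continuousAt_root1 hp))

theorem s2_eq_root (h : BandGap c d) {p : Curve c d} (hp : p ∈ Sigma1 c d) :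
    s2 p = root2 p.lam :=
  onClosU_eq_of_tendsto h (Or.inl hp) (tendsto_of_continuousAt_lam (h.continuousAt_root2 hp))

theorem s1_eq_div (h : BandGap c d) {p : Curve c d} (hp : p ∈ Sigma1 c d) :
    s1 p = -p.w / root2 p.lam :=
  onClosU_eq_of_tendsto h (Or.inl hp) (tendsto_of_mul_eq (h.continuousAt_root2 hp)
    (h.root2_ne hp) fun _ hq => root1_mul_root2 hq)

theorem s2_eq_div (h : BandGap c d) {p : Curve c d} (hp : p ∈ Sigma2 c d) :
    s2 p = -p.w / root1 c d p.lam :=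
  onClosU_eq_of_tendsto h (Or.inr hp) (tendsto_of_mul_eq (h.continuousAt_root1 hp)
    (h.root1_ne hp) fun _ hq => (mul_comm _ _).trans (root1_mul_root2 hq))

theorem tendsto_s1 (h : BandGap c d) {p : Curve c d} (hp : p ∈ Sig c d) :
    Tendsto s1 (𝓝[PiU c d] p) (𝓝 (s1 p)) := by
  have hev : ∀ᶠ q in 𝓝[PiU c d] p, root1 c d q.lam = s1 q :=
    eventually_nhdsWithin_of_forall fun q hq => (onClosU_of_mem hq).symm
  refine Tendsto.congr' hev ?_
  rcases hp with hp | hp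
  · rw [h.s1_eq_div hp]
    exact tendsto_of_mul_eq (h.continuousAt_root2 hp) (h.root2_ne hp)
      fun _ hq => root1_mul_root2 hq
  · rw [h.s1_eq_root hp]
    exact tendsto_of_continuousAt_lam (h.continuousAt_root1 hp)

theorem tendsto_s2 (h : BandGap c d) {p : Curve c d} (hp : p ∈ Sig c d) :
    Tendsto s2 (𝓝[PiU c d] p) (𝓝 (s2 p)) := by
  have hev : ∀ᶠ q in 𝓝[PiU c d] p, root2 q.lam = s2 q :=
    eventually_nhdsWithin_of_forall fun q hq => (onClosU_of_mem hq).symm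
  refine Tendsto.congr' hev ?_
  rcases hp with hp | hp
  · rw [h.s2_eq_root hp]
    exact tendsto_of_continuousAt_lam (h.continuousAt_root2 hp)
  · rw [h.s2_eq_div hp]
    exact tendsto_of_mul_eq (h.continuousAt_root1 hp) (h.root1_ne hp)
      fun _ hq => (mul_comm _ _).trans (root1_mul_root2 hq)

theorem tendsto_lam (p : Curve c d) : Tendsto Curve.lam (𝓝[PiU c d] p) (𝓝 p.lam) :=
  Curve.continuous_lam.continuousAt.tendsto.mono_left nhdsWithin_le_nhds

theorem tendsto_z1 (h : BandGap c d) {p : Curve c d} (hp : p ∈ Sig c d) :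
    Tendsto z1 (𝓝[PiU c d] p) (𝓝 (z1 p)) :=
  (((tendsto_lam p).add_const _).sub (h.tendsto_s1 hp)).div_const _

theorem tendsto_z2 (h : BandGap c d) {p : Curve c d} (hp : p ∈ Sig c d) :
    Tendsto z2 (𝓝[PiU c d] p) (𝓝 (z2 p)) :=
  (tendsto_lam p).sub (h.tendsto_s2 hp)

theorem s1_sq (h : BandGap c d) {p : Curve c d} (hp : p ∈ closU c d) :
    s1 p ^ 2 = (p.lam - (-c : ℂ)) ^ 2 - 4 * d ^ 2 := by
  rcases hp with hp | hp
  · rw [s1_of_mem hp, root_sq]; push_cast; ring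
  · have := h.neBot_PiU hp
    refine tendsto_nhds_unique ((h.tendsto_s1 hp).pow 2) ((((tendsto_lam p).sub_const
      (-c : ℂ)).pow 2).sub_const (4 * d ^ 2 : ℂ) |>.congr' ?_)
    refine eventually_nhdsWithin_of_forall fun q hq => ?_
    simp only [s1_of_mem hq, root_sq]; push_cast; ring

theorem s2_sq (h : BandGap c d) {p : Curve c d} (hp : p ∈ closU c d) :
    s2 p ^ 2 = (p.lam - 0) ^ 2 - 4 * (1 / 2) ^ 2 := by
  rcases hp with hp | hp
  · rw [s2_of_mem hp, root_sq]; push_cast; ring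
  · have := h.neBot_PiU hp
    refine tendsto_nhds_unique ((h.tendsto_s2 hp).pow 2) ((((tendsto_lam p).sub_const
      (0 : ℂ)).pow 2).sub_const (4 * (1 / 2) ^ 2 : ℂ) |>.congr' ?_)
    refine eventually_nhdsWithin_of_forall fun q hq => ?_
    simp only [s2_of_mem hq, root_sq]; push_cast; ring

theorem z1_relations (h : BandGap c d) {p : Curve c d} (hp : p ∈ closU c d) :
    z1 p ≠ 0 ∧ p.lam = -c + d * (z1 p + (z1 p)⁻¹) ∧ s1 p = d * ((z1 p)⁻¹ - z1 p) :=
  joukowski_relations (by exact_mod_cast h.d_pos.ne') (h.s1_sq hp) (by rw [z1]; ring)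

theorem z2_relations (h : BandGap c d) {p : Curve c d} (hp : p ∈ closU c d) :
    z2 p ≠ 0 ∧ p.lam = 0 + 1 / 2 * (z2 p + (z2 p)⁻¹) ∧ s2 p = 1 / 2 * ((z2 p)⁻¹ - z2 p) :=
  joukowski_relations (by norm_num) (h.s2_sq hp) (by rw [z2]; ring)

theorem conj_lam {p : Curve c d} (hp : p ∈ Sig c d) : starRingEnd ℂ p.lam = p.lam := by
  obtain ⟨x, hx⟩ := lam_real hp
  rw [hx, Complex.conj_ofReal]

theorem conj_s1_of_Sigma2 (h : BandGap c d) {p : Curve c d} (hp : p ∈ Sigma2 c d) :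
    starRingEnd ℂ (s1 p) = s1 p := by
  rw [h.s1_eq_root hp, root1_eq, ← root_conj h.d_pos (h.not_mem_band1 hp), conj_lam (Or.inr hp)]

theorem conj_s2_of_Sigma1 (h : BandGap c d) {p : Curve c d} (hp : p ∈ Sigma1 c d) :
    starRingEnd ℂ (s2 p) = s2 p := by
  rw [h.s2_eq_root hp, root2_eq, ← root_conj (by norm_num) (h.not_mem_band2 hp),
    conj_lam (Or.inl hp)]

/-- A band's own root is -w divided by the root of the other band; over the band the former is
purely imaginary and the latter real. -/
theorem conj_s1_of_Sigma1 (h : BandGap c d) {p : Curve c d} (hp : p ∈ Sigma1 c d) :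
    starRingEnd ℂ (s1 p) = -s1 p := by
  have := h.conj_s2_of_Sigma1 hp
  rw [h.s2_eq_root hp] at this
  rw [h.s1_eq_div hp, map_div₀, map_neg, h.conj_w (Or.inl hp), this]
  ring

theorem conj_s2_of_Sigma2 (h : BandGap c d) {p : Curve c d} (hp : p ∈ Sigma2 c d) :
    starRingEnd ℂ (s2 p) = -s2 p := by
  have := h.conj_s1_of_Sigma2 hp
  rw [h.s1_eq_root hp] at this
  rw [h.s2_eq_div hp, map_div₀, map_neg, h.conj_w (Or.inr hp), this]
  ring

/-- Over a band, `star` changes the sign of w and fixes lam. It thus flips the root that is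
imaginary there and keeps the real one, just as conjugation does. -/
theorem s1_star (h : BandGap c d) {p : Curve c d} (hp : p ∈ Sig c d) :
    s1 p.star = starRingEnd ℂ (s1 p) := by
  rcases hp with hp | hp
  · rw [h.conj_s1_of_Sigma1 hp, h.s1_eq_div hp, h.s1_eq_div (p := p.star) hp]
    simp; ring
  · rw [h.conj_s1_of_Sigma2 hp, h.s1_eq_root hp, h.s1_eq_root (p := p.star) hp]
    simp

theorem s2_star (h : BandGap c d) {p : Curve c d} (hp : p ∈ Sig c d) :
    s2 p.star = starRingEnd ℂ (s2 p) := by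
  rcases hp with hp | hp
  · rw [h.conj_s2_of_Sigma1 hp, h.s2_eq_root hp, h.s2_eq_root (p := p.star) hp]
    simp
  · rw [h.conj_s2_of_Sigma2 hp, h.s2_eq_div hp, h.s2_eq_div (p := p.star) hp]
    simp; ring

theorem z1_star (h : BandGap c d) {p : Curve c d} (hp : p ∈ Sig c d) :
    z1 p.star = starRingEnd ℂ (z1 p) := by
  rw [z1, z1, h.s1_star hp]
  simp [conj_lam hp, map_ofNat]

theorem z2_star (h : BandGap c d) {p : Curve c d} (hp : p ∈ Sig c d) :
    z2 p.star = starRingEnd ℂ (z2 p) := by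
  rw [z2, z2, h.s2_star hp]
  simp [conj_lam hp]

theorem conj_z1_of_Sigma2 (h : BandGap c d) {p : Curve c d} (hp : p ∈ Sigma2 c d) :
    starRingEnd ℂ (z1 p) = z1 p := by
  simp [z1, conj_lam (Or.inr hp), h.conj_s1_of_Sigma2 hp, map_ofNat]

theorem conj_z2_of_Sigma1 (h : BandGap c d) {p : Curve c d} (hp : p ∈ Sigma1 c d) :
    starRingEnd ℂ (z2 p) = z2 p := by
  simp [z2, conj_lam (Or.inl hp), h.conj_s2_of_Sigma1 hp]

/-- With lam real and s₁ imaginary, z₁ conj z₁ is ((lam + c)² - s₁²)/4d², which the equation for s₁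
makes equal to 1. -/
theorem conj_z1_of_Sigma1 (h : BandGap c d) {p : Curve c d} (hp : p ∈ Sigma1 c d) :
    starRingEnd ℂ (z1 p) = (z1 p)⁻¹ := by
  have hd : (d : ℂ) ≠ 0 := by exact_mod_cast h.d_pos.ne'
  refine eq_inv_of_mul_eq_one_left ?_
  have := h.s1_sq (Or.inr (Or.inl hp))
  simp only [z1, map_div₀, map_sub, map_add, conj_lam (Or.inl hp), h.conj_s1_of_Sigma1 hp,
    Complex.conj_ofReal, map_mul, map_ofNat]
  field_simp
  linear_combination -this

theorem conj_z2_of_Sigma2 (h : BandGap c d) {p : Curve c d} (hp : p ∈ Sigma2 c d) :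
    starRingEnd ℂ (z2 p) = (z2 p)⁻¹ := by
  refine eq_inv_of_mul_eq_one_left ?_
  have := h.s2_sq (Or.inr (Or.inr hp))
  simp only [z2, map_sub, conj_lam (Or.inr hp), h.conj_s2_of_Sigma2 hp]
  linear_combination -this

theorem norm_eq_one_of_conj_eq_inv {z : ℂ} (hz : z ≠ 0) (h : starRingEnd ℂ z = z⁻¹) :
    ‖z‖ = 1 := by
  have h1 : starRingEnd ℂ z * z = 1 := by rw [h, inv_mul_cancel₀ hz]
  have h2 := congrArg norm h1
  rw [norm_mul, Complex.norm_conj, norm_one, ← sq] at h2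
  exact (pow_eq_one_iff_of_nonneg (norm_nonneg z) two_ne_zero).1 h2

theorem norm_z1_lt (h : BandGap c d) {p : Curve c d} (hp : p ∈ PiU c d ∪ Sigma2 c d) :
    ‖z1 p‖ < 1 := by
  rcases hp with hp | hp
  · rw [z1_of_mem hp]; exact norm_jouk_lt_one h.d_pos (lam_not_mem_I1 hp)
  · have : z1 p = jouk d (-c) p.lam := by
      rw [z1, h.s1_eq_root hp, root1_eq, jouk]; simp
    rw [this]; exact norm_jouk_lt_one h.d_pos (h.not_mem_band1 hp)

theorem norm_z2_lt (h : BandGap c d) {p : Curve c d} (hp : p ∈ PiU c d ∪ Sigma1 c d) :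
    ‖z2 p‖ < 1 := by
  rcases hp with hp | hp
  · rw [z2_of_mem hp]; exact norm_jouk_lt_one (by norm_num) (lam_not_mem_I2 hp)
  · have : z2 p = jouk (1 / 2) 0 p.lam := by
      rw [z2, h.s2_eq_root hp, root2_eq, jouk]; simp
    rw [this]; exact norm_jouk_lt_one (by norm_num) (h.not_mem_band2 hp)

theorem norm_z1_le (h : BandGap c d) {p : Curve c d} (hp : p ∈ closU c d) : ‖z1 p‖ ≤ 1 := by
  have h0 := (h.z1_relations hp).1
  rcases hp with hp | hp | hp
  · exact (h.norm_z1_lt (Or.inl hp)).le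
  · exact (norm_eq_one_of_conj_eq_inv h0 (h.conj_z1_of_Sigma1 hp)).le
  · exact (h.norm_z1_lt (Or.inr hp)).le

theorem norm_z2_le (h : BandGap c d) {p : Curve c d} (hp : p ∈ closU c d) : ‖z2 p‖ ≤ 1 := by
  have h0 := (h.z2_relations hp).1
  rcases hp with hp | hp | hp
  · exact (h.norm_z2_lt (Or.inl hp)).le
  · exact (h.norm_z2_lt (Or.inr hp)).le
  · exact (norm_eq_one_of_conj_eq_inv h0 (h.conj_z2_of_Sigma2 hp)).le

theorem tendsto_lam_atInfPlus :
    Tendsto Curve.lam (atInfPlus c d) (Bornology.cobounded ℂ) :=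
  tendsto_comap.mono_left inf_le_left

theorem eventually_mem_atInfPlus : ∀ᶠ p in atInfPlus c d, p ∈ PiU c d :=
  mem_inf_of_right (mem_principal_self _)

theorem tendsto_z1_atInfPlus (h : BandGap c d) : Tendsto z1 (atInfPlus c d) (𝓝 0) := by
  refine ((tendsto_jouk_cobounded (B := -c) h.d_pos).comp tendsto_lam_atInfPlus).congr' ?_
  filter_upwards [eventually_mem_atInfPlus] with p hp
  exact (z1_of_mem hp).symm

theorem tendsto_z2_atInfPlus : Tendsto z2 (atInfPlus c d) (𝓝 0) := by
  refine ((tendsto_jouk_cobounded (A := 1 / 2) (B := 0) (by norm_num)).comp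
    tendsto_lam_atInfPlus).congr' ?_
  filter_upwards [eventually_mem_atInfPlus] with p hp
  exact (z2_of_mem hp).symm

end BandGap

end Surface

end

section

/-! ### Wronskians of solutions of the Jacobi equation -/

/-- The Wronskian `a(n-1)(u(n-1)v(n) - u(n)v(n-1))`. -/
def wr (a : ℤ → ℝ) (u v : ℤ → ℂ) (n : ℤ) : ℂ :=
  (a (n - 1) : ℂ) * (u (n - 1) * v n - u n * v (n - 1))

section Jacobi

variable {a b : ℤ → ℝ} {lam : ℂ} {u v w : ℤ → ℂ}

theorem wr_succ (hu : IsJacobiSolution a b lam u) (hv : IsJacobiSolution a b lam v) (n : ℤ) :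
    wr a u v (n + 1) = wr a u v n := by
  have h1 := hu n
  have h2 := hv n
  simp only [wr, add_sub_cancel_right]
  linear_combination u n * h2 - v n * h1

theorem wr_const (hu : IsJacobiSolution a b lam u) (hv : IsJacobiSolution a b lam v) (n k : ℤ) :
    wr a u v n = wr a u v k := by
  have : ∀ n, wr a u v n = wr a u v 0 := fun n => by
    induction n using Int.induction_on with
    | zero => rfl
    | succ i ih => rw [wr_succ hu hv, ih]
    | pred i ih => rw [← ih, ← wr_succ hu hv, sub_add_cancel]
  rw [this n, this k]

/-- This is the Plücker relation between the 2×2 minors formed from three vectors in the plane. It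
is the source of the scattering relations. -/
theorem wr_plucker (a : ℤ → ℝ) (u v w : ℤ → ℂ) (n : ℤ) :
    wr a u v n * w n + wr a v w n * u n + wr a w u n * v n = 0 := by
  simp only [wr]; ring

theorem IsJacobiSolution.eq_zero (ha : ∀ n, a n ≠ 0) (hu : IsJacobiSolution a b lam u) {k : ℤ}
    (h0 : u (k - 1) = 0) (h1 : u k = 0) : u = 0 := by
  have ha' : ∀ n, (a n : ℂ) ≠ 0 := fun n => by exact_mod_cast ha n
  have up : ∀ j : ℕ, u (k - 1 + j) = 0 ∧ u (k + j) = 0 := fun j => by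
    induction j with
    | zero => simpa using ⟨h0, h1⟩
    | succ j ih =>
      have e := hu (k + j)
      rw [show k + (j : ℤ) - 1 = k - 1 + j by ring, ih.1, ih.2] at e
      simp only [mul_zero, zero_add, mul_eq_zero, ha', false_or] at e
      push_cast
      exact ⟨by rw [show k - 1 + ((j : ℤ) + 1) = k + j by ring]; exact ih.2, by
        rw [← add_assoc]; exact e⟩
  have down : ∀ j : ℕ, u (k - 1 - j) = 0 ∧ u (k - j) = 0 := fun j => by
    induction j with
    | zero => simpa using ⟨h0, h1⟩
    | succ j ih =>
      have e := hu (k - 1 - j)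
      rw [show k - 1 - (j : ℤ) + 1 = k - j by ring, ih.1, ih.2] at e
      simp only [mul_zero, add_zero, mul_eq_zero, ha', false_or] at e
      push_cast
      exact ⟨by rw [show k - 1 - ((j : ℤ) + 1) = k - 1 - j - 1 by ring]; exact e, by
        rw [show k - ((j : ℤ) + 1) = k - 1 - j by ring]; exact ih.1⟩
  funext n
  rcases le_total k n with h | h
  · have := (up (n - k).toNat).2
    rwa [show k + ((n - k).toNat : ℤ) = n by omega] at this
  · have := (down (k - n).toNat).2
    rwa [show k - ((k - n).toNat : ℤ) = n by omega] at this

theorem IsJacobiSolution.sub_smul (hu : IsJacobiSolution a b lam u)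
    (hv : IsJacobiSolution a b lam v) (k : ℂ) :
    IsJacobiSolution a b lam (fun n => v n - k * u n) := fun n => by
  linear_combination hv n - k * hu n

/-- Solutions with vanishing Wronskian are proportional. -/
theorem exists_smul_of_wr_eq_zero (ha : ∀ n, a n ≠ 0) (hu : IsJacobiSolution a b lam u)
    (hv : IsJacobiSolution a b lam v) (hu0 : u ≠ 0) {n : ℤ} (h : wr a u v n = 0) :
    ∃ k : ℂ, ∀ n, v n = k * u n := by
  have ha' : ∀ n, (a n : ℂ) ≠ 0 := fun n => by exact_mod_cast ha n
  obtain ⟨j, hj⟩ := Function.ne_iff.1 hu0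
  have hj0 : u j ≠ 0 := hj
  have hw : wr a u v j = 0 := (wr_const hu hv j n).trans h
  rw [wr, mul_eq_zero, or_iff_right (ha' _)] at hw
  refine ⟨v j / u j, fun n => ?_⟩
  -- The difference vanishes at j by the choice of the factor and at j - 1 by the vanishing
  -- Wronskian.
  have := (hu.sub_smul hv (v j / u j)).eq_zero ha (k := j)
    (by field_simp; linear_combination -hw) (by field_simp; ring)
  have := congrFun this n
  simp only [Pi.zero_apply] at this
  linear_combination this

theorem IsJacobiSolution.conj {x : ℂ} (hx : starRingEnd ℂ x = x) (hu : IsJacobiSolution a b x u) :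
    IsJacobiSolution a b x (fun n => starRingEnd ℂ (u n)) := fun n => by
  have := congrArg (starRingEnd ℂ) (hu n)
  simpa [hx] using this

theorem IsJacobiSolution.reflect (hu : IsJacobiSolution a b lam u) :
    IsJacobiSolution (fun k => a (-k - 1)) (fun k => b (-k)) lam (fun k => u (-k)) := fun n => by
  have := hu (-n)
  simp only [show -(n - 1) = -n + 1 by ring, show -(n + 1) = -n - 1 by ring,
    add_sub_cancel_right]
  linear_combination this

theorem IsJacobiSolution.of_reflect
    (hu : IsJacobiSolution (fun k => a (-k - 1)) (fun k => b (-k)) lam u) :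
    IsJacobiSolution a b lam (fun k => u (-k)) := by
  simpa using hu.reflect

theorem wr_reflect (a : ℤ → ℝ) (u v : ℤ → ℂ) (n : ℤ) :
    wr (fun k => a (-k - 1)) (fun k => u (-k)) (fun k => v (-k)) n = -wr a u v (-n + 1) := by
  simp only [wr, show -(n - 1) = -n + 1 by ring, add_sub_cancel_right]
  ring

/-- An eigenfunction decaying at both ends belongs to a real eigenvalue. -/
theorem IsJacobiSolution.eq_zero_of_im (hu : IsJacobiSolution a b lam u) (him : lam.im ≠ 0)
    {M : ℝ} (hM : ∀ n, |a n| ≤ M) (h1 : Tendsto u atTop (𝓝 0)) (h2 : Tendsto u atBot (𝓝 0)) :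
    u = 0 := by
  -- q is the probability current. Its increments are Im lam · |u(n)|², of one sign, while it tends
  -- to 0 at both ends; so it vanishes identically, and with it u.
  set q : ℤ → ℝ := fun n => a n * (u (n + 1) * starRingEnd ℂ (u n)).im with hq
  have step : ∀ n, q n - q (n - 1) = lam.im * Complex.normSq (u n) := fun n => by
    have e := congrArg (fun x => (x * starRingEnd ℂ (u n)).im) (hu n)
    simp only [hq, sub_add_cancel, Complex.normSq_apply]
    simp at e ⊢
    linear_combination e
  have lim : ∀ l : Filter ℤ, Tendsto u l (𝓝 0) → Tendsto (fun n => u (n + 1)) l (𝓝 0) →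
      Tendsto q l (𝓝 0) := fun l h h' => by
    have h3 : Tendsto (fun n => M * ‖u (n + 1) * starRingEnd ℂ (u n)‖) l (𝓝 0) := by
      have := ((h'.mul ((Complex.continuous_conj.tendsto _).comp h)).norm).const_mul M
      simpa [Function.comp_def] using this
    refine squeeze_zero_norm (fun n => ?_) h3
    rw [Real.norm_eq_abs, abs_mul]
    exact mul_le_mul (hM n) (Complex.abs_im_le_norm _) (abs_nonneg _)
      ((abs_nonneg _).trans (hM n))
  have l1 := lim atTop h1 (h1.comp (tendsto_atTop_add_const_right _ 1 tendsto_id))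
  have l2 := lim atBot h2 (h2.comp (tendsto_atBot_add_const_right _ 1 tendsto_id))
  have hq0 : ∀ n, q n = 0 := by
    rcases lt_or_gt_of_ne him with hneg | hpos
    · have hanti : Antitone q := antitone_int_of_succ_le fun n => by
        have := step (n + 1)
        rw [add_sub_cancel_right] at this
        nlinarith [Complex.normSq_nonneg (u (n + 1))]
      exact fun n => le_antisymm (hanti.ge_of_tendsto l2 n) (hanti.le_of_tendsto l1 n)
    · have hmono : Monotone q := monotone_int_of_le_succ fun n => by
        have := step (n + 1)
        rw [add_sub_cancel_right] at this
        nlinarith [Complex.normSq_nonneg (u (n + 1))]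
      exact fun n => le_antisymm (hmono.ge_of_tendsto l1 n) (hmono.le_of_tendsto l2 n)
  funext n
  have := step n
  rw [hq0, hq0, sub_zero, zero_eq_mul, or_iff_right him] at this
  exact Complex.normSq_eq_zero.1 this

end Jacobi

/-! ### Jost solutions at `+∞` -/

section Jost

variable {A B m Q ρ : ℝ} {a b : ℤ → ℝ} {z lam : ℂ} {u v : ℤ → ℂ}

namespace Background

theorem tendsto_a (h : Background A B m Q ρ a b) : Tendsto a atTop (𝓝 A) := by
  have hρ := h.rho_pos
  refine tendsto_of_zpow_bound (D := Q) (w := ρ ^ 2) (by positivity)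
    (pow_lt_one₀ hρ.le h.rho_lt two_ne_zero) fun n => ?_
  refine (h.a_sub n).trans (le_of_eq ?_)
  rw [← zpow_natCast, ← zpow_natCast, ← zpow_mul, ← zpow_mul, mul_comm n]

theorem isJacobiSolution (h : Background A B m Q ρ a b) (hz : ‖z‖ ≤ 1) (hz0 : z ≠ 0)
    (hl : lam = B + A * (z + z⁻¹)) :
    IsJacobiSolution a b lam (fun n => z ^ n * jostF a b A B n z) := fun n => by
  have e := h.normEq_jostF hz n
  unfold NormEq at e
  beta_reduce at e ⊢
  have h1 : z ^ n = z ^ (n - 1) * z := by rw [← zpow_add_one₀ hz0, sub_add_cancel]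
  have h2 : z ^ (n + 1) = z ^ (n - 1) * z * z := by rw [← h1, zpow_add_one₀ hz0]
  rw [h1, h2, hl]
  have h3 : z * z⁻¹ = 1 := mul_inv_cancel₀ hz0
  linear_combination z ^ (n - 1) * e - z ^ (n - 1) * A * jostF a b A B n z * h3

theorem tendsto_jost (h : Background A B m Q ρ a b) (hz : ‖z‖ ≤ 1) (hz0 : z ≠ 0) :
    Tendsto (fun n : ℤ => z ^ (-n) * (z ^ n * jostF a b A B n z)) atTop (𝓝 1) := by
  refine (h.tendsto_jostF_atTop hz).congr fun n => ?_
  rw [← mul_assoc, ← zpow_add₀ hz0, neg_add_cancel, zpow_zero, one_mul]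

theorem tendsto_pred {f : ℤ → ℂ} {x : ℂ} (hf : Tendsto f atTop (𝓝 x)) :
    Tendsto (fun n => f (n - 1)) atTop (𝓝 x) :=
  hf.comp (tendsto_atTop_add_const_right _ (-1) tendsto_id)

theorem tendsto_a_pred (h : Background A B m Q ρ a b) :
    Tendsto (fun n => (a (n - 1) : ℂ)) atTop (𝓝 (A : ℂ)) :=
  tendsto_pred (f := fun n => (a n : ℂ)) ((Complex.continuous_ofReal.tendsto _).comp h.tendsto_a)

/-- Uniqueness of the Jost solution. -/
theorem jost_unique (h : Background A B m Q ρ a b) (hz : ‖z‖ ≤ 1) (hz0 : z ≠ 0)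
    (hu : IsJacobiSolution a b lam u) (hv : IsJacobiSolution a b lam v)
    (hu1 : Tendsto (fun n : ℤ => z ^ (-n) * u n) atTop (𝓝 1))
    (hv1 : Tendsto (fun n : ℤ => z ^ (-n) * v n) atTop (𝓝 1)) : v = u := by
  have ha : ∀ n, a n ≠ 0 := fun n => (h.a_pos n).ne'
  have key : Tendsto (fun n => wr a u v n) atTop (𝓝 0) := by
    have h1 := h.tendsto_a_pred.mul (((tendsto_pred hu1).mul hv1).sub (hu1.mul (tendsto_pred hv1)))
    rw [mul_one, sub_self, mul_zero, tendsto_zero_iff_norm_tendsto_zero] at h1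
    rw [tendsto_zero_iff_norm_tendsto_zero]
    refine squeeze_zero' (Eventually.of_forall fun _ => norm_nonneg _) ?_ h1
    filter_upwards [eventually_ge_atTop 1] with n hn
    -- The factor z²ⁿ⁻¹ has modulus at most 1 for n ≥ 1 and the bracket tends to 1 - 1 = 0. Strict
    -- decay is not needed, so the argument also covers |z| = 1.
    have e : wr a u v n = z ^ (2 * n - 1) * ((a (n - 1) : ℂ) *
        (z ^ (-(n - 1)) * u (n - 1) * (z ^ (-n) * v n) -
          z ^ (-n) * u n * (z ^ (-(n - 1)) * v (n - 1)))) := by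
      have e1 : z ^ (2 * n - 1) * (z ^ (-(n - 1)) * z ^ (-n)) = 1 := by
        rw [← zpow_add₀ hz0, ← zpow_add₀ hz0,
          show 2 * n - 1 + (-(n - 1) + -n) = 0 by ring, zpow_zero]
      simp only [wr]
      linear_combination -((a (n - 1) : ℂ) * (u (n - 1) * v n - u n * v (n - 1))) * e1
    rw [e, norm_mul, norm_zpow]
    refine mul_le_of_le_one_left (norm_nonneg _) ?_
    lift 2 * n - 1 to ℕ using by omega with k
    simpa using pow_le_one₀ (norm_nonneg z) hz
  have hw : wr a u v 0 = 0 :=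
    tendsto_nhds_unique (tendsto_const_nhds.congr fun n => wr_const hu hv 0 n) key
  have hu0 : u ≠ 0 := by
    rintro rfl
    simp only [Pi.zero_apply, mul_zero] at hu1
    exact zero_ne_one (tendsto_nhds_unique tendsto_const_nhds hu1)
  obtain ⟨k, hk⟩ := exists_smul_of_wr_eq_zero ha hu hv hu0 hw
  have hk1 : k = 1 := by
    have := hu1.const_mul k
    rw [mul_one] at this
    refine tendsto_nhds_unique (this.congr fun n => ?_) hv1
    rw [hk]; ring
  funext n
  rw [hk, hk1, one_mul]

/-- The Wronskian of solutions asymptotic to `zⁿ` and `z⁻ⁿ`. -/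
theorem wr_eq_of_asymptotics (h : Background A B m Q ρ a b) (hz0 : z ≠ 0)
    (hu : IsJacobiSolution a b lam u) (hv : IsJacobiSolution a b lam v)
    (hu1 : Tendsto (fun n : ℤ => z ^ (-n) * u n) atTop (𝓝 1))
    (hv1 : Tendsto (fun n : ℤ => z ^ n * v n) atTop (𝓝 1)) (n : ℤ) :
    wr a u v n = A * (z⁻¹ - z) := by
  have h1 := h.tendsto_a_pred.mul ((((tendsto_pred hu1).mul hv1).const_mul z⁻¹).sub
    ((hu1.mul (tendsto_pred hv1)).const_mul z))
  simp only [mul_one] at h1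
  refine tendsto_nhds_unique (tendsto_const_nhds.congr fun k => ?_) h1
  rw [wr_const hu hv n k, wr]
  have e1 : z⁻¹ * (z ^ (-(k - 1)) * z ^ k) = 1 := by
    rw [← zpow_neg_one, ← zpow_add₀ hz0, ← zpow_add₀ hz0,
      show -1 + (-(k - 1) + k) = 0 by ring, zpow_zero]
  have e2 : z * (z ^ (-k) * z ^ (k - 1)) = 1 := by
    nth_rewrite 1 [← zpow_one z]
    rw [← zpow_add₀ hz0, ← zpow_add₀ hz0,
      show 1 + (-k + (k - 1)) = 0 by ring, zpow_zero]
  linear_combination -(a (k - 1) : ℂ) * u (k - 1) * v k * e1 + (a (k - 1) : ℂ) * u k * v (k - 1) * e2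

end Background

end Jost

end

section

/-! ### Jost solutions of steplike Jacobi operators -/

/-- Exponentially fast convergence to the two backgrounds. -/
structure Steplike (c d : ℝ) (a b : ℤ → ℝ) : Prop where
  left : ∃ m Q ρ, Background d (-c) m Q ρ (fun k => a (-k - 1)) (fun k => b (-k))
  right : ∃ m Q ρ, Background (1 / 2) 0 m Q ρ a b

/-- The normalized left Jost function `z₁ⁿ ψ₁(n)`, as a function of `z₁`. -/
def leftF (c d : ℝ) (a b : ℤ → ℝ) (n : ℤ) (z : ℂ) : ℂ :=
  jostF (fun k => a (-k - 1)) (fun k => b (-k)) d (-c) (-n) z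

/-- The normalized right Jost function `z₂⁻ⁿ ψ₂(n)`, as a function of `z₂`. -/
def rightF (a b : ℤ → ℝ) (n : ℤ) (z : ℂ) : ℂ := jostF a b (1 / 2) 0 n z

variable {c d : ℝ} {a b : ℤ → ℝ} {p : Curve c d}

theorem Steplike.a_pos (hs : Steplike c d a b) (n : ℤ) : 0 < a n := by
  obtain ⟨m, Q, ρ, h⟩ := hs.right
  exact h.a_pos n

theorem Steplike.a_ne (hs : Steplike c d a b) (n : ℤ) : a n ≠ 0 := (hs.a_pos n).ne'

section Existence

theorem Steplike.isJost2 (hg : BandGap c d) (hs : Steplike c d a b) (hp : p ∈ closU c d) :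
    IsJost2 a b p (fun n => z2 p ^ n * rightF a b n (z2 p)) := by
  obtain ⟨m, Q, ρ, h⟩ := hs.right
  obtain ⟨h0, hl, -⟩ := hg.z2_relations hp
  have hz := hg.norm_z2_le hp
  exact ⟨h.isJacobiSolution hz h0 (by push_cast; exact hl), h.tendsto_jost hz h0⟩

theorem tendsto_neg_comp {f : ℤ → ℂ} {x : ℂ} (h : Tendsto f atTop (𝓝 x)) :
    Tendsto (fun n => f (-n)) atBot (𝓝 x) := h.comp tendsto_neg_atBot_atTop

theorem tendsto_neg_comp' {f : ℤ → ℂ} {x : ℂ} (h : Tendsto f atBot (𝓝 x)) :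
    Tendsto (fun n => f (-n)) atTop (𝓝 x) := h.comp tendsto_neg_atTop_atBot

theorem Steplike.isJost1 (hg : BandGap c d) (hs : Steplike c d a b) (hp : p ∈ closU c d) :
    IsJost1 a b p (fun n => z1 p ^ (-n) * leftF c d a b n (z1 p)) := by
  obtain ⟨m, Q, ρ, h⟩ := hs.left
  obtain ⟨h0, hl, -⟩ := hg.z1_relations hp
  have hz := hg.norm_z1_le hp
  refine ⟨(h.isJacobiSolution hz h0 (lam := p.lam) (by push_cast; exact hl)).of_reflect, ?_⟩
  simpa [leftF] using tendsto_neg_comp (h.tendsto_jost hz h0)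

theorem Steplike.jost2_spec (hg : BandGap c d) (hs : Steplike c d a b) (hp : p ∈ closU c d) :
    IsJost2 a b p (jost2 a b p) := Classical.epsilon_spec ⟨_, hs.isJost2 hg hp⟩

theorem Steplike.jost1_spec (hg : BandGap c d) (hs : Steplike c d a b) (hp : p ∈ closU c d) :
    IsJost1 a b p (jost1 a b p) := Classical.epsilon_spec ⟨_, hs.isJost1 hg hp⟩

/-- Uniqueness of the normalized solution identifies the abstractly chosen Jost solution with the
constructed one, so regularity in z passes to it. -/
theorem Steplike.jost2_eq (hg : BandGap c d) (hs : Steplike c d a b) (hp : p ∈ closU c d)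
    (n : ℤ) : jost2 a b p n = z2 p ^ n * rightF a b n (z2 p) := by
  obtain ⟨m, Q, ρ, h⟩ := hs.right
  have h1 := hs.isJost2 hg hp
  have h2 := hs.jost2_spec hg hp
  exact congrFun (h.jost_unique (hg.norm_z2_le hp) (hg.z2_relations hp).1 h1.1 h2.1 h1.2 h2.2) n

theorem Steplike.jost1_eq (hg : BandGap c d) (hs : Steplike c d a b) (hp : p ∈ closU c d)
    (n : ℤ) : jost1 a b p n = z1 p ^ (-n) * leftF c d a b n (z1 p) := by
  obtain ⟨m, Q, ρ, h⟩ := hs.left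
  have h1 := hs.isJost1 hg hp
  have h2 := hs.jost1_spec hg hp
  have := congrFun (h.jost_unique (hg.norm_z1_le hp) (hg.z1_relations hp).1 h1.1.reflect
    h2.1.reflect (tendsto_neg_comp' h1.2) (tendsto_neg_comp' h2.2)) (-n)
  simpa using this

theorem ne_zero_of_isJost2 {ψ : ℤ → ℂ} (h : IsJost2 a b p ψ) : ψ ≠ 0 := by
  rintro rfl
  have := h.2
  simp only [Pi.zero_apply, mul_zero] at this
  exact zero_ne_one (tendsto_nhds_unique tendsto_const_nhds this)

theorem ne_zero_of_isJost1 {ψ : ℤ → ℂ} (h : IsJost1 a b p ψ) : ψ ≠ 0 := by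
  rintro rfl
  have := h.2
  simp only [Pi.zero_apply, mul_zero] at this
  exact zero_ne_one (tendsto_nhds_unique tendsto_const_nhds this)

theorem wronskian_eq_wr (a b : ℤ → ℝ) (p : Curve c d) :
    wronskian a b p = wr a (jost1 a b p) (jost2 a b p) 0 := by
  simp [wronskian, wr]

end Existence

/-! ### Behaviour on the cuts -/

section Cuts

theorem Steplike.rightF_conj (hs : Steplike c d a b) {z : ℂ} (hz : ‖z‖ ≤ 1) (n : ℤ) :
    rightF a b n (starRingEnd ℂ z) = starRingEnd ℂ (rightF a b n z) := by
  obtain ⟨m, Q, ρ, h⟩ := hs.right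
  exact h.jostF_conj hz n

theorem Steplike.leftF_conj (hs : Steplike c d a b) {z : ℂ} (hz : ‖z‖ ≤ 1) (n : ℤ) :
    leftF c d a b n (starRingEnd ℂ z) = starRingEnd ℂ (leftF c d a b n z) := by
  obtain ⟨m, Q, ρ, h⟩ := hs.left
  exact h.jostF_conj hz (-n)

theorem Steplike.jost2_star (hg : BandGap c d) (hs : Steplike c d a b) (hp : p ∈ Sig c d)
    (n : ℤ) : jost2 a b p.star n = starRingEnd ℂ (jost2 a b p n) := by
  rw [hs.jost2_eq hg (Or.inr hp), hs.jost2_eq hg (p := p.star) (Or.inr hp), hg.z2_star hp,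
    hs.rightF_conj (hg.norm_z2_le (Or.inr hp)), map_mul, map_zpow₀]

theorem Steplike.jost1_star (hg : BandGap c d) (hs : Steplike c d a b) (hp : p ∈ Sig c d)
    (n : ℤ) : jost1 a b p.star n = starRingEnd ℂ (jost1 a b p n) := by
  rw [hs.jost1_eq hg (Or.inr hp), hs.jost1_eq hg (p := p.star) (Or.inr hp), hg.z1_star hp,
    hs.leftF_conj (hg.norm_z1_le (Or.inr hp)), map_mul, map_zpow₀]

/-- Over I₁ the variable z₂ is real, and the normalized Jost function has real coefficients. -/
theorem Steplike.jost2_real (hg : BandGap c d) (hs : Steplike c d a b) (hp : p ∈ Sigma1 c d)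
    (n : ℤ) : starRingEnd ℂ (jost2 a b p n) = jost2 a b p n := by
  rw [hs.jost2_eq hg (Or.inr (Or.inl hp)), map_mul, map_zpow₀,
    ← hs.rightF_conj (hg.norm_z2_le (Or.inr (Or.inl hp))), hg.conj_z2_of_Sigma1 hp]

theorem Steplike.jost1_real (hg : BandGap c d) (hs : Steplike c d a b) (hp : p ∈ Sigma2 c d)
    (n : ℤ) : starRingEnd ℂ (jost1 a b p n) = jost1 a b p n := by
  rw [hs.jost1_eq hg (Or.inr (Or.inr hp)), map_mul, map_zpow₀,
    ← hs.leftF_conj (hg.norm_z1_le (Or.inr (Or.inr hp))), hg.conj_z1_of_Sigma2 hp]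

theorem Steplike.wronskian_star (hg : BandGap c d) (hs : Steplike c d a b) (hp : p ∈ Sig c d) :
    wronskian a b p.star = starRingEnd ℂ (wronskian a b p) := by
  simp [wronskian, hs.jost1_star hg hp, hs.jost2_star hg hp]

theorem Steplike.T1_star (hg : BandGap c d) (hs : Steplike c d a b) (hp : p ∈ Sig c d) :
    T1 a b p.star = starRingEnd ℂ (T1 a b p) := by
  simp [T1, hs.wronskian_star hg hp, hg.s1_star hp]

theorem Steplike.T2_star (hg : BandGap c d) (hs : Steplike c d a b) (hp : p ∈ Sig c d) :
    T2 a b p.star = starRingEnd ℂ (T2 a b p) := by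
  simp [T2, hs.wronskian_star hg hp, hg.s2_star hp]

theorem wr_conj (a : ℤ → ℝ) (u v : ℤ → ℂ) (n : ℤ) :
    starRingEnd ℂ (wr a u v n) =
      wr a (fun k => starRingEnd ℂ (u k)) (fun k => starRingEnd ℂ (v k)) n := by
  simp [wr]

theorem wr_swap (a : ℤ → ℝ) (u v : ℤ → ℂ) (n : ℤ) : wr a u v n = -wr a v u n := by
  simp only [wr]; ring

/-- The relation between `ψ₁`, `ψ₂` and `conj ψ₂` on `Σ₂`. -/
theorem Steplike.relation_Sigma2 (hg : BandGap c d) (hs : Steplike c d a b)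
    (hp : p ∈ Sigma2 c d) (n : ℤ) :
    wronskian a b p * starRingEnd ℂ (jost2 a b p n) -
      starRingEnd ℂ (wronskian a b p) * jost2 a b p n = -s2 p * jost1 a b p n := by
  have hp' : p ∈ closU c d := Or.inr (Or.inr hp)
  obtain ⟨m, Q, ρ, h⟩ := hs.right
  have h1 := hs.jost1_spec hg hp'
  have h2 := hs.jost2_spec hg hp'
  have hc := h2.1.conj (BandGap.conj_lam (Or.inr hp))
  obtain ⟨h0, -, hsz⟩ := hg.z2_relations hp'
  have hlim : Tendsto (fun n : ℤ => z2 p ^ n * starRingEnd ℂ (jost2 a b p n)) atTop (𝓝 1) := by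
    have := (Complex.continuous_conj.tendsto _).comp h2.2
    simpa [Function.comp_def, map_zpow₀, hg.conj_z2_of_Sigma2 hp] using this
  have hW := h.wr_eq_of_asymptotics h0 h2.1 hc h2.2 hlim n
  -- Since ψ₁ is real over I₂, the Wronskian of conj ψ₂ and ψ₁ is minus the conjugate of W. Together
  -- with the Wronskian s₂ of ψ₂ and conj ψ₂ this fills in the Plücker identity.
  have hWc : wr a (fun k => starRingEnd ℂ (jost2 a b p k)) (jost1 a b p) n =
      -starRingEnd ℂ (wronskian a b p) := by
    rw [wronskian_eq_wr, wr_const h1.1 h2.1 0 n, wr_conj, wr_swap]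
    simp only [hs.jost1_real hg hp]
  have hpl := wr_plucker a (jost1 a b p) (jost2 a b p)
    (fun k => starRingEnd ℂ (jost2 a b p k)) n
  rw [wr_const h1.1 h2.1 n 0, ← wronskian_eq_wr, hW, hWc] at hpl
  push_cast at hpl
  rw [hsz]
  linear_combination hpl

/-- The relation between `ψ₂`, `ψ₁` and `conj ψ₁` on `Σ₁`. -/
theorem Steplike.relation_Sigma1 (hg : BandGap c d) (hs : Steplike c d a b)
    (hp : p ∈ Sigma1 c d) (n : ℤ) :
    wronskian a b p * starRingEnd ℂ (jost1 a b p n) -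
      starRingEnd ℂ (wronskian a b p) * jost1 a b p n = -s1 p * jost2 a b p n := by
  have hp' : p ∈ closU c d := Or.inr (Or.inl hp)
  obtain ⟨m, Q, ρ, h⟩ := hs.left
  have h1 := hs.jost1_spec hg hp'
  have h2 := hs.jost2_spec hg hp'
  have hc := h1.1.conj (BandGap.conj_lam (Or.inl hp))
  obtain ⟨h0, -, hsz⟩ := hg.z1_relations hp'
  have hlim : Tendsto (fun n : ℤ => z1 p ^ (-n) * starRingEnd ℂ (jost1 a b p n)) atBot (𝓝 1) := by
    have := (Complex.continuous_conj.tendsto _).comp h1.2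
    simpa [Function.comp_def, map_zpow₀, hg.conj_z1_of_Sigma1 hp] using this
  -- Asymptotics at -∞ are read off on the reflected lattice. The site -n + 1 is chosen because
  -- reflection returns it to n, at the price of a sign.
  have hW := h.wr_eq_of_asymptotics h0 h1.1.reflect hc.reflect (tendsto_neg_comp' h1.2)
    (by simpa using tendsto_neg_comp' hlim) (-n + 1)
  replace hW := (wr_reflect a (jost1 a b p) (fun k => starRingEnd ℂ (jost1 a b p k))
    (-n + 1)).symm.trans hW
  rw [show -(-n + 1) + 1 = n by ring, wr_swap, neg_neg] at hW
  have hWc : wr a (jost2 a b p) (fun k => starRingEnd ℂ (jost1 a b p k)) n =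
      -starRingEnd ℂ (wronskian a b p) := by
    rw [wronskian_eq_wr, wr_const h1.1 h2.1 0 n, wr_conj, wr_swap]
    simp only [hs.jost2_real hg hp]
  have hpl := wr_plucker a (jost1 a b p) (jost2 a b p)
    (fun k => starRingEnd ℂ (jost1 a b p k)) n
  rw [wr_const h1.1 h2.1 n 0, ← wronskian_eq_wr, hW, hWc] at hpl
  rw [hsz]
  linear_combination hpl

end Cuts

/-! ### Continuity and holomorphy -/

section Regularity

theorem Steplike.continuousOn_rightF (hs : Steplike c d a b) (n : ℤ) :
    ContinuousOn (rightF a b n) (Metric.closedBall 0 1) := by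
  obtain ⟨m, Q, ρ, h⟩ := hs.right
  exact h.continuousOn_jostF n

theorem Steplike.continuousOn_leftF (hs : Steplike c d a b) (n : ℤ) :
    ContinuousOn (leftF c d a b n) (Metric.closedBall 0 1) := by
  obtain ⟨m, Q, ρ, h⟩ := hs.left
  exact h.continuousOn_jostF (-n)

theorem Steplike.differentiableOn_rightF (hs : Steplike c d a b) (n : ℤ) :
    DifferentiableOn ℂ (rightF a b n) (Metric.ball 0 1) := by
  obtain ⟨m, Q, ρ, h⟩ := hs.right
  exact h.differentiableOn_jostF n

theorem Steplike.differentiableOn_leftF (hs : Steplike c d a b) (n : ℤ) :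
    DifferentiableOn ℂ (leftF c d a b n) (Metric.ball 0 1) := by
  obtain ⟨m, Q, ρ, h⟩ := hs.left
  exact h.differentiableOn_jostF (-n)

theorem Steplike.tendsto_rightF (hg : BandGap c d) (hs : Steplike c d a b) (hp : p ∈ Sig c d)
    (n : ℤ) : Tendsto (fun q => rightF a b n (z2 q)) (𝓝[PiU c d] p)
      (𝓝 (rightF a b n (z2 p))) := by
  have h1 := hs.continuousOn_rightF n (z2 p) (by simpa using hg.norm_z2_le (Or.inr hp))
  refine h1.tendsto.comp (tendsto_nhdsWithin_iff.2 ⟨hg.tendsto_z2 hp, ?_⟩)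
  exact eventually_nhdsWithin_of_forall fun q hq => by simpa using hg.norm_z2_le (Or.inl hq)

theorem Steplike.tendsto_leftF (hg : BandGap c d) (hs : Steplike c d a b) (hp : p ∈ Sig c d)
    (n : ℤ) : Tendsto (fun q => leftF c d a b n (z1 q)) (𝓝[PiU c d] p)
      (𝓝 (leftF c d a b n (z1 p))) := by
  have h1 := hs.continuousOn_leftF n (z1 p) (by simpa using hg.norm_z1_le (Or.inr hp))
  refine h1.tendsto.comp (tendsto_nhdsWithin_iff.2 ⟨hg.tendsto_z1 hp, ?_⟩)
  exact eventually_nhdsWithin_of_forall fun q hq => by simpa using hg.norm_z1_le (Or.inl hq)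

theorem BandGap.tendsto_z1_zpow (hg : BandGap c d) (hp : p ∈ Sig c d) (n : ℤ) :
    Tendsto (fun q => z1 q ^ n) (𝓝[PiU c d] p) (𝓝 (z1 p ^ n)) :=
  (hg.tendsto_z1 hp).zpow₀ n (Or.inl (hg.z1_relations (Or.inr hp)).1)

theorem BandGap.tendsto_z2_zpow (hg : BandGap c d) (hp : p ∈ Sig c d) (n : ℤ) :
    Tendsto (fun q => z2 q ^ n) (𝓝[PiU c d] p) (𝓝 (z2 p ^ n)) :=
  (hg.tendsto_z2 hp).zpow₀ n (Or.inl (hg.z2_relations (Or.inr hp)).1)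

theorem Steplike.tendsto_jost2 (hg : BandGap c d) (hs : Steplike c d a b) (hp : p ∈ Sig c d)
    (n : ℤ) : Tendsto (fun q => jost2 a b q n) (𝓝[PiU c d] p) (𝓝 (jost2 a b p n)) := by
  rw [hs.jost2_eq hg (Or.inr hp)]
  refine ((hg.tendsto_z2_zpow hp n).mul (hs.tendsto_rightF hg hp n)).congr' ?_
  exact eventually_nhdsWithin_of_forall fun q hq => (hs.jost2_eq hg (Or.inl hq) n).symm

theorem Steplike.tendsto_jost1 (hg : BandGap c d) (hs : Steplike c d a b) (hp : p ∈ Sig c d)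
    (n : ℤ) : Tendsto (fun q => jost1 a b q n) (𝓝[PiU c d] p) (𝓝 (jost1 a b p n)) := by
  rw [hs.jost1_eq hg (Or.inr hp)]
  refine ((hg.tendsto_z1_zpow hp (-n)).mul (hs.tendsto_leftF hg hp n)).congr' ?_
  exact eventually_nhdsWithin_of_forall fun q hq => (hs.jost1_eq hg (Or.inl hq) n).symm

theorem Steplike.tendsto_wronskian (hg : BandGap c d) (hs : Steplike c d a b)
    (hp : p ∈ Sig c d) : Tendsto (wronskian a b) (𝓝[PiU c d] p) (𝓝 (wronskian a b p)) :=
  (((hs.tendsto_jost1 hg hp (-1)).mul (hs.tendsto_jost2 hg hp 0)).sub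
    ((hs.tendsto_jost1 hg hp 0).mul (hs.tendsto_jost2 hg hp (-1)))).const_mul _

theorem Steplike.tendsto_T1 (hg : BandGap c d) (hs : Steplike c d a b) (hp : p ∈ Sig c d)
    (hW : wronskian a b p ≠ 0) : Tendsto (T1 a b) (𝓝[PiU c d] p) (𝓝 (T1 a b p)) :=
  (hg.tendsto_s1 hp).neg.div (hs.tendsto_wronskian hg hp) hW

theorem Steplike.tendsto_T2 (hg : BandGap c d) (hs : Steplike c d a b) (hp : p ∈ Sig c d)
    (hW : wronskian a b p ≠ 0) : Tendsto (T2 a b) (𝓝[PiU c d] p) (𝓝 (T2 a b p)) :=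
  (hg.tendsto_s2 hp).neg.div (hs.tendsto_wronskian hg hp) hW

/-- Functions on the upper sheet given by holomorphic functions of `lam`. -/
theorem differentiableOn_upperPt {f : Curve c d → ℂ} {g : ℂ → ℂ}
    (hfg : ∀ p ∈ PiU c d, f p = g p.lam)
    (hgd : ∀ lam ∉ bands c d, DifferentiableAt ℂ g lam) :
    DifferentiableOn ℂ (fun lam => f (upperPt c d lam)) (bands c d)ᶜ := by
  have : DifferentiableOn ℂ g (bands c d)ᶜ := fun lam hl => (hgd lam hl).differentiableWithinAt
  exact this.congr fun lam hl => hfg _ (upperPt_mem hl)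

theorem BandGap.differentiableOn_z1 (hg : BandGap c d) :
    DifferentiableOn ℂ (fun lam => z1 (upperPt c d lam)) (bands c d)ᶜ :=
  differentiableOn_upperPt (fun _ hp => BandGap.z1_of_mem hp) fun _ hl =>
    differentiableAt_jouk hg.d_pos fun h => hl (Or.inl h)

theorem differentiableOn_z2 :
    DifferentiableOn ℂ (fun lam => z2 (upperPt c d lam)) (bands c d)ᶜ :=
  differentiableOn_upperPt (fun _ hp => BandGap.z2_of_mem hp) fun _ hl =>
    differentiableAt_jouk (by norm_num) fun h => hl (Or.inr (I2_eq ▸ h))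

theorem BandGap.differentiableOn_s1 (hg : BandGap c d) :
    DifferentiableOn ℂ (fun lam => s1 (upperPt c d lam)) (bands c d)ᶜ :=
  differentiableOn_upperPt (fun _ hp => BandGap.s1_of_mem hp) fun _ hl =>
    differentiableAt_root hg.d_pos fun h => hl (Or.inl h)

theorem differentiableOn_s2 :
    DifferentiableOn ℂ (fun lam => s2 (upperPt c d lam)) (bands c d)ᶜ :=
  differentiableOn_upperPt (fun _ hp => BandGap.s2_of_mem hp) fun _ hl =>
    differentiableAt_root (by norm_num) fun h => hl (Or.inr (I2_eq ▸ h))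

theorem BandGap.differentiableOn_z1_zpow (hg : BandGap c d) (n : ℤ) :
    DifferentiableOn ℂ (fun lam => z1 (upperPt c d lam) ^ n) (bands c d)ᶜ :=
  hg.differentiableOn_z1.zpow (Or.inl fun _ hl => (hg.z1_relations (Or.inl (upperPt_mem hl))).1)

theorem BandGap.differentiableOn_z2_zpow (hg : BandGap c d) (n : ℤ) :
    DifferentiableOn ℂ (fun lam => z2 (upperPt c d lam) ^ n) (bands c d)ᶜ :=
  differentiableOn_z2.zpow (Or.inl fun _ hl => (hg.z2_relations (Or.inl (upperPt_mem hl))).1)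

theorem Steplike.differentiableOn_jost1 (hg : BandGap c d) (hs : Steplike c d a b) (n : ℤ) :
    DifferentiableOn ℂ (fun lam => jost1 a b (upperPt c d lam) n) (bands c d)ᶜ := by
  refine ((hg.differentiableOn_z1_zpow (-n)).fun_mul
    ((hs.differentiableOn_leftF n).fun_comp hg.differentiableOn_z1 fun lam hl => ?_)).congr
    fun lam hl => hs.jost1_eq hg (Or.inl (upperPt_mem hl)) n
  simpa using hg.norm_z1_lt (Or.inl (upperPt_mem hl))

theorem Steplike.differentiableOn_jost2 (hg : BandGap c d) (hs : Steplike c d a b) (n : ℤ) :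
    DifferentiableOn ℂ (fun lam => jost2 a b (upperPt c d lam) n) (bands c d)ᶜ := by
  refine ((hg.differentiableOn_z2_zpow n).fun_mul
    ((hs.differentiableOn_rightF n).fun_comp differentiableOn_z2 fun lam hl => ?_)).congr
    fun lam hl => hs.jost2_eq hg (Or.inl (upperPt_mem hl)) n
  simpa using hg.norm_z2_lt (Or.inl (upperPt_mem hl))

theorem Steplike.differentiableOn_wronskian (hg : BandGap c d) (hs : Steplike c d a b) :
    DifferentiableOn ℂ (fun lam => wronskian a b (upperPt c d lam)) (bands c d)ᶜ :=
  (((hs.differentiableOn_jost1 hg (-1)).fun_mul (hs.differentiableOn_jost2 hg 0)).fun_sub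
    ((hs.differentiableOn_jost1 hg 0).fun_mul (hs.differentiableOn_jost2 hg (-1)))).const_mul _

theorem Steplike.differentiableOn_T1 (hg : BandGap c d) (hs : Steplike c d a b)
    (hW : ∀ p ∈ closU c d, wronskian a b p ≠ 0) :
    DifferentiableOn ℂ (fun lam => T1 a b (upperPt c d lam)) (bands c d)ᶜ :=
  hg.differentiableOn_s1.fun_neg.fun_div (hs.differentiableOn_wronskian hg)
    fun _ hl => hW _ (Or.inl (upperPt_mem hl))

theorem Steplike.differentiableOn_T2 (hg : BandGap c d) (hs : Steplike c d a b)
    (hW : ∀ p ∈ closU c d, wronskian a b p ≠ 0) :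
    DifferentiableOn ℂ (fun lam => T2 a b (upperPt c d lam)) (bands c d)ᶜ :=
  differentiableOn_s2.fun_neg.fun_div (hs.differentiableOn_wronskian hg)
    fun _ hl => hW _ (Or.inl (upperPt_mem hl))

end Regularity

/-! ### The Wronskian does not vanish -/

section Nonvanishing

theorem decay_of_tendsto {z : ℂ} {u : ℤ → ℂ} (hz0 : z ≠ 0) (hz : ‖z‖ < 1)
    (hu : Tendsto (fun n : ℤ => z ^ (-n) * u n) atTop (𝓝 1)) :
    Tendsto u atTop (𝓝 0) ∧ Summable fun n : ℕ => ‖u n‖ ^ 2 := by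
  have hb : ∀ᶠ n : ℤ in atTop, ‖u n‖ ≤ 2 * ‖z‖ ^ n := by
    filter_upwards [hu.norm.eventually_le_const (show ‖(1 : ℂ)‖ < 2 by norm_num)] with n hn
    rw [norm_mul, norm_zpow, zpow_neg, inv_mul_le_iff₀ (by positivity)] at hn
    linarith
  have hpos : 0 < ‖z‖ := norm_pos_iff.2 hz0
  constructor
  · have h1 := tendsto_of_zpow_bound (f := fun n : ℤ => 2 * ‖z‖ ^ n) (x := 0) (D := 2) hpos hz
      (fun n => by rw [sub_zero, abs_of_nonneg (by positivity)])
    exact squeeze_zero_norm' hb h1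
  · have h2 : Summable fun n : ℕ => 4 * (‖z‖ ^ 2) ^ n :=
      (summable_geometric_of_lt_one (by positivity)
        (pow_lt_one₀ hpos.le hz two_ne_zero)).mul_left 4
    refine Summable.of_norm_bounded_eventually_nat h2 ?_
    filter_upwards [tendsto_natCast_atTop_atTop.eventually hb] with n hn
    rw [norm_pow, norm_norm]
    calc ‖u n‖ ^ 2 ≤ (2 * ‖z‖ ^ (n : ℤ)) ^ 2 := pow_le_pow_left₀ (norm_nonneg _) hn 2
      _ = 4 * (‖z‖ ^ 2) ^ n := by rw [zpow_natCast]; ring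

/-- On the sheet a zero of W makes the Jost solutions proportional, hence square summable: for real
lam this is a discrete eigenvalue, for nonreal lam it is impossible. On a cut the Plücker relation
leaves s φ = 0 with φ nontrivial, so s = 0 and the point is a band edge, which nonresonance
excludes. -/
theorem Steplike.wronskian_ne_zero (hg : BandGap c d) (hs : Steplike c d a b) {M : ℝ}
    (hM : ∀ n, |a n| ≤ M) (hspec : discreteSpectrum c d a b = ∅) (hres : NonResonant c d a b)
    (hp : p ∈ closU c d) : wronskian a b p ≠ 0 := by
  have j1 := hs.jost1_spec hg hp
  have j2 := hs.jost2_spec hg hp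
  have n1 := ne_zero_of_isJost1 j1
  have n2 := ne_zero_of_isJost2 j2
  intro hW
  rcases hp with hp | hp | hp
  · rw [wronskian_eq_wr] at hW
    obtain ⟨k, hk⟩ := exists_smul_of_wr_eq_zero hs.a_ne j1.1 j2.1 n1 hW
    obtain ⟨d1, d2⟩ := decay_of_tendsto (hg.z2_relations (Or.inl hp)).1
      (hg.norm_z2_lt (Or.inl hp)) j2.2
    obtain ⟨d3, d4⟩ := decay_of_tendsto (hg.z1_relations (Or.inl hp)).1
      (hg.norm_z1_lt (Or.inl hp)) (tendsto_neg_comp' j1.2)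
    have d5 : Tendsto (jost2 a b p) atBot (𝓝 0) := by
      have := (tendsto_neg_comp d3).const_mul k
      rw [mul_zero] at this
      refine this.congr fun n => ?_
      rw [hk, neg_neg]
    by_cases him : p.lam.im = 0
    · have hre : p.lam = (p.lam.re : ℂ) := Complex.ext rfl (by simpa using him)
      have hmem : p.lam.re ∈ discreteSpectrum c d a b := by
        refine ⟨hre ▸ hp.1, jost2 a b p, n2, ?_, hre ▸ j2.1⟩
        have : Summable fun n : ℤ => ‖jost2 a b p n‖ ^ 2 := by
          refine Summable.of_nat_of_neg d2 ((d4.mul_left (‖k‖ ^ 2)).congr fun n => ?_)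
          rw [hk, norm_mul, mul_pow]
        refine memℓp_gen ?_
        simpa using this
      rw [hspec] at hmem
      exact hmem
    · exact n2 (j2.1.eq_zero_of_im him hM d1 d5)
  · have hrel := hs.relation_Sigma1 hg hp
    have hs0 : s1 p = 0 := by
      by_contra h0
      refine n2 (funext fun n => ?_)
      have := hrel n
      rw [hW, map_zero, zero_mul, zero_mul, sub_zero, zero_eq_mul] at this
      exact this.resolve_left (neg_ne_zero.2 h0)
    have := hg.s1_sq (Or.inr (Or.inl hp))
    rw [hs0] at this
    have h4 : (p.lam + c - 2 * d) * (p.lam + c + 2 * d) = 0 := by linear_combination -this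
    refine hres p ?_ hW
    rcases mul_eq_zero.1 h4 with h5 | h5
    · exact Or.inr (Or.inl (by linear_combination h5))
    · exact Or.inl (by linear_combination h5)
  · have hrel := hs.relation_Sigma2 hg hp
    have hs0 : s2 p = 0 := by
      by_contra h0
      refine n1 (funext fun n => ?_)
      have := hrel n
      rw [hW, map_zero, zero_mul, zero_mul, sub_zero, zero_eq_mul] at this
      exact this.resolve_left (neg_ne_zero.2 h0)
    have := hg.s2_sq (Or.inr (Or.inr hp))
    rw [hs0] at this
    have h4 : (p.lam - 1) * (p.lam + 1) = 0 := by linear_combination -this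
    refine hres p ?_ hW
    rcases mul_eq_zero.1 h4 with h5 | h5
    · exact Or.inr (Or.inr (Or.inr (by linear_combination h5)))
    · exact Or.inr (Or.inr (Or.inl (by linear_combination h5)))

end Nonvanishing

end

section

/-! ### Time evolution of the Wronskian -/

section Evolution

variable {c d : ℝ} {a b : ℤ → ℝ → ℝ} {p : Curve c d}

/-- A Toda solution which approaches the two backgrounds, locally uniformly in time. -/
structure TodaSteplike (c d : ℝ) (a b : ℤ → ℝ → ℝ) : Prop where
  toda : IsTodaSolution a b
  background : ∀ τ, ∃ ρ m₁ Q₁ m₂ Q₂, ∀ t, |t| ≤ τ →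
    Background d (-c) m₁ Q₁ ρ (fun k => a (-k - 1) t) (fun k => b (-k) t) ∧
    Background (1 / 2) 0 m₂ Q₂ ρ (fun k => a k t) (fun k => b k t)

namespace TodaSteplike

theorem steplike (h : TodaSteplike c d a b) (t : ℝ) :
    Steplike c d (fun k => a k t) (fun k => b k t) := by
  obtain ⟨ρ, m₁, Q₁, m₂, Q₂, hb⟩ := h.background |t|
  exact ⟨⟨_, _, _, (hb t le_rfl).1⟩, ⟨_, _, _, (hb t le_rfl).2⟩⟩

theorem a_ne (h : TodaSteplike c d a b) (n : ℤ) (t : ℝ) : a n t ≠ 0 := (h.steplike t).a_ne n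

/-- Here lam + s₂ = 1/z₂, which rewrites the normalized Lax equation in terms of ψ₂. The time window
|t| + 1 supplies background constants valid on a neighbourhood of t. -/
theorem hasDerivAt_jost2 (hg : BandGap c d) (h : TodaSteplike c d a b) (hp : p ∈ closU c d)
    (n : ℤ) (t : ℝ) :
    HasDerivAt (fun t => jost2 (fun k => a k t) (fun k => b k t) p n)
      ((p.lam + s2 p - b n t) * jost2 (fun k => a k t) (fun k => b k t) p n -
        2 * a (n - 1) t * jost2 (fun k => a k t) (fun k => b k t) p (n - 1)) t := by
  obtain ⟨ρ, m₁, Q₁, m₂, Q₂, hb⟩ := h.background (|t| + 1)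
  obtain ⟨h0, hl, hs⟩ := hg.z2_relations hp
  have ht : t ∈ Set.Ioo (-(|t| + 1)) (|t| + 1) := abs_lt.1 (lt_add_one _)
  have hd := (hasDerivAt_jostF h.toda h.a_ne isOpen_Ioo
    (fun s (hs : s ∈ Set.Ioo (-(|t| + 1)) (|t| + 1)) => (hb s (abs_lt.2 hs).le).2)
    (hg.norm_z2_le hp) h0 n ht).const_mul (z2 p ^ n)
  have e : ∀ s k, jost2 (fun k => a k s) (fun k => b k s) p k =
      z2 p ^ k * jostF (fun k => a k s) (fun k => b k s) (1 / 2) 0 k (z2 p) := fun s k =>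
    (h.steplike s).jost2_eq hg hp k
  simp only [e]
  refine hd.congr_deriv ?_
  rw [zpow_sub_one₀ h0, hs, hl]
  push_cast
  linear_combination -(z2 p ^ n) * b n t *
    jostF (fun k => a k t) (fun k => b k t) (1 / 2) 0 n (z2 p) * (inv_mul_cancel₀ h0)

/-- Reflection of the lattice reverses time, which accounts for the signs; here lam + c + s₁ =
2d/z₁. -/
theorem hasDerivAt_jost1 (hg : BandGap c d) (h : TodaSteplike c d a b) (hp : p ∈ closU c d)
    (n : ℤ) (t : ℝ) :
    HasDerivAt (fun t => jost1 (fun k => a k t) (fun k => b k t) p n)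
      ((b n t - p.lam - s1 p) * jost1 (fun k => a k t) (fun k => b k t) p n +
        2 * a n t * jost1 (fun k => a k t) (fun k => b k t) p (n + 1)) t := by
  obtain ⟨ρ, m₁, Q₁, m₂, Q₂, hb⟩ := h.background (|t| + 1)
  obtain ⟨h0, hl, hs⟩ := hg.z1_relations hp
  have ht : -t ∈ Set.Ioo (-(|t| + 1)) (|t| + 1) := by
    have := lt_add_one |t|
    rw [← abs_neg] at this
    exact abs_lt.1 (by rwa [abs_neg t] at this ⊢)
  have hd := ((hasDerivAt_jostF (A := d) (B := -c) h.toda.reflect (fun n t => h.a_ne _ _)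
    isOpen_Ioo (fun s (hs : s ∈ Set.Ioo (-(|t| + 1)) (|t| + 1)) =>
      (hb (-s) (by rw [abs_neg]; exact (abs_lt.2 hs).le)).1)
    (hg.norm_z1_le hp) h0 (-n) ht).scomp t (hasDerivAt_neg t)).const_mul (z1 p ^ (-n))
  have e : ∀ s k, jost1 (fun k => a k s) (fun k => b k s) p k =
      z1 p ^ (-k) * jostF (fun k => a (-k - 1) s) (fun k => b (-k) s) d (-c) (-k) (z1 p) :=
    fun s k => (h.steplike s).jost1_eq hg hp k
  simp only [e]
  simp only [Function.comp_def, neg_neg] at hd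
  refine hd.congr_deriv ?_
  rw [show -(n + 1) = -n - 1 by ring, zpow_sub_one₀ h0, hs, hl,
    show -(-n - 1) - 1 = n by ring]
  simp only [neg_smul, one_smul]
  push_cast
  linear_combination (z1 p ^ (-n)) * (b n t + c) *
    jostF (fun k => a (-k - 1) t) (fun k => b (-k) t) d (-c) (-n) (z1 p) * (inv_mul_cancel₀ h0)

/-- Modulo the Jacobi equation the derivatives of ψ₁ and ψ₂ are a(n)ψ(n+1) - a(n-1)ψ(n-1) plus -s₁ψ₁
and s₂ψ₂ respectively. The common part, together with the derivative of a(-1), contributes nothing.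
The equations at sites 0 and -1 eliminate ψ₁(1) and ψ₂(-2). -/
theorem hasDerivAt_wronskian (hg : BandGap c d) (h : TodaSteplike c d a b) (hp : p ∈ closU c d)
    (t : ℝ) :
    HasDerivAt (fun t => wronskian (fun k => a k t) (fun k => b k t) p)
      (-(s1 p - s2 p) * wronskian (fun k => a k t) (fun k => b k t) p) t := by
  have e1 := ((h.steplike t).jost1_spec hg hp).1 0
  have e2 := ((h.steplike t).jost2_spec hg hp).1 (-1)
  have hd := (h.toda.a_eq (-1) t).ofReal_comp.mul
    (((h.hasDerivAt_jost1 hg hp (-1) t).mul (h.hasDerivAt_jost2 hg hp 0 t)).sub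
    ((h.hasDerivAt_jost1 hg hp 0 t).mul (h.hasDerivAt_jost2 hg hp (-1) t)))
  refine hd.congr_deriv ?_
  simp only [wronskian]
  norm_num at e1 e2 ⊢
  linear_combination (-2 * (a (-1) t : ℂ) * jost2 (fun k => a k t) (fun k => b k t) p (-1)) * e1 +
    (2 * (a (-1) t : ℂ) * jost1 (fun k => a k t) (fun k => b k t) p 0) * e2

/-- The Wronskian evolves exponentially in time. -/
theorem wronskian_zero (hg : BandGap c d) (h : TodaSteplike c d a b) (hp : p ∈ closU c d)
    (t : ℝ) :
    wronskian (fun k => a k 0) (fun k => b k 0) p =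
      wronskian (fun k => a k t) (fun k => b k t) p * Complex.exp ((s1 p - s2 p) * t) := by
  have hE : ∀ t : ℝ, HasDerivAt (fun t : ℝ => Complex.exp ((s1 p - s2 p) * t))
      (Complex.exp ((s1 p - s2 p) * t) * (s1 p - s2 p)) t := fun t => by
    simpa using ((hasDerivAt_id t).ofReal_comp.const_mul (s1 p - s2 p)).cexp
  have hd : ∀ t : ℝ, HasDerivAt (fun t : ℝ => wronskian (fun k => a k t) (fun k => b k t) p *
      Complex.exp ((s1 p - s2 p) * t)) 0 t := fun t =>
    ((h.hasDerivAt_wronskian hg hp t).mul (hE t)).congr_deriv (by ring)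
  have := is_const_of_deriv_eq_zero (fun t => (hd t).differentiableAt)
    (fun t => (hd t).deriv) 0 t
  simpa using this

theorem wronskian_ne (hg : BandGap c d) (h : TodaSteplike c d a b) (hp : p ∈ closU c d)
    (hW : wronskian (fun k => a k 0) (fun k => b k 0) p ≠ 0) (t : ℝ) :
    wronskian (fun k => a k t) (fun k => b k t) p ≠ 0 := by
  rw [h.wronskian_zero hg hp t] at hW
  exact left_ne_zero_of_mul hW

end TodaSteplike

end Evolution

/-! ### Scattering data -/

section Scattering

variable {c d : ℝ} {a b : ℤ → ℝ} {p : Curve c d}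

theorem Steplike.scattering_left (hg : BandGap c d) (hs : Steplike c d a b)
    (hp : p ∈ Sigma1 c d) (hW : wronskian a b p ≠ 0) (n : ℤ) :
    T1 a b p * jost2 a b p n = starRingEnd ℂ (jost1 a b p n) +
      -(starRingEnd ℂ (wronskian a b p) / wronskian a b p) * jost1 a b p n := by
  rw [T1]
  field_simp
  linear_combination -hs.relation_Sigma1 hg hp n

theorem Steplike.scattering_right (hg : BandGap c d) (hs : Steplike c d a b)
    (hp : p ∈ Sigma2 c d) (hW : wronskian a b p ≠ 0) (n : ℤ) :
    T2 a b p * jost1 a b p n = starRingEnd ℂ (jost2 a b p n) +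
      -(starRingEnd ℂ (wronskian a b p) / wronskian a b p) * jost2 a b p n := by
  rw [T2]
  field_simp
  linear_combination -hs.relation_Sigma2 hg hp n

theorem Steplike.R1_spec (hg : BandGap c d) (hs : Steplike c d a b)
    (hp : p ∈ Sigma1 c d) (hW : wronskian a b p ≠ 0) (n : ℤ) :
    T1 a b p * jost2 a b p n = starRingEnd ℂ (jost1 a b p n) + R1 a b p * jost1 a b p n :=
  Classical.epsilon_spec (p := fun r : ℂ => ∀ n : ℤ, T1 a b p * jost2 a b p n =
    starRingEnd ℂ (jost1 a b p n) + r * jost1 a b p n) ⟨_, hs.scattering_left hg hp hW⟩ n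

theorem Steplike.R2_spec (hg : BandGap c d) (hs : Steplike c d a b)
    (hp : p ∈ Sigma2 c d) (hW : wronskian a b p ≠ 0) (n : ℤ) :
    T2 a b p * jost1 a b p n = starRingEnd ℂ (jost2 a b p n) + R2 a b p * jost2 a b p n :=
  Classical.epsilon_spec (p := fun r : ℂ => ∀ n : ℤ, T2 a b p * jost1 a b p n =
    starRingEnd ℂ (jost2 a b p n) + r * jost2 a b p n) ⟨_, hs.scattering_right hg hp hW⟩ n

/-- A nonzero value of ψ₁ determines the coefficient in the scattering relation; the relation
divided by W displays it. -/
theorem Steplike.R1_eq (hg : BandGap c d) (hs : Steplike c d a b)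
    (hp : p ∈ Sigma1 c d) (hW : wronskian a b p ≠ 0) :
    R1 a b p = -(starRingEnd ℂ (wronskian a b p) / wronskian a b p) := by
  obtain ⟨n, hn⟩ := Function.ne_iff.1
    (ne_zero_of_isJost1 (hs.jost1_spec hg (Or.inr (Or.inl hp))))
  have h := (hs.R1_spec hg hp hW n).symm.trans (hs.scattering_left hg hp hW n)
  exact mul_right_cancel₀ hn (add_left_cancel h)

theorem Steplike.R2_eq (hg : BandGap c d) (hs : Steplike c d a b)
    (hp : p ∈ Sigma2 c d) (hW : wronskian a b p ≠ 0) :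
    R2 a b p = -(starRingEnd ℂ (wronskian a b p) / wronskian a b p) := by
  obtain ⟨n, hn⟩ := Function.ne_iff.1
    (ne_zero_of_isJost2 (hs.jost2_spec hg (Or.inr (Or.inr hp))))
  have h := (hs.R2_spec hg hp hW n).symm.trans (hs.scattering_right hg hp hW n)
  exact mul_right_cancel₀ hn (add_left_cancel h)

theorem Steplike.chi_eq (hg : BandGap c d) (hs : Steplike c d a b)
    (hp : p ∈ Sig c d) (hW : wronskian a b p ≠ 0) :
    chi a b p = -(T1 a b p * starRingEnd ℂ (T2 a b p)) := by
  have := hg.neBot_PiU hp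
  exact congrArg Neg.neg (Tendsto.limUnder_eq ((hs.tendsto_T1 hg hp hW).mul
    ((Complex.continuous_conj.tendsto _).comp (hs.tendsto_T2 hg hp hW))))

theorem Steplike.isScatteringData (hg : BandGap c d) (hs : Steplike c d a b)
    (hW : ∀ p ∈ closU c d, wronskian a b p ≠ 0) :
    IsScatteringData (c := c) (d := d) a b (jost1 a b) (jost2 a b) (T1 a b) (T2 a b) (R1 a b)
      (R2 a b) where
  jost_left _ hp := hs.jost1_spec hg hp
  jost_right _ hp := hs.jost2_spec hg hp
  left_relation p hp n := hs.R1_spec hg hp (hW p (Or.inr (Or.inl hp))) n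
  right_relation p hp n := hs.R2_spec hg hp (hW p (Or.inr (Or.inr hp))) n
  left_holomorphic := hs.differentiableOn_T1 hg hW
  right_holomorphic := hs.differentiableOn_T2 hg hW
  left_boundary p hp := hs.tendsto_T1 hg hp (hW p (Or.inr hp))
  right_boundary p hp := hs.tendsto_T2 hg hp (hW p (Or.inr hp))

end Scattering

end

section

/-! ### Boundary values of the phases -/

section Phases

variable {c d : ℝ} {p : Curve c d}

theorem exp_mul_log {z : ℂ} (hz : z ≠ 0) (n : ℤ) : Complex.exp (n * Complex.log z) = z ^ n := by
  rw [Complex.exp_int_mul, Complex.exp_log hz]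

/-- Since t·ξ = n is an integer, the logarithm becomes an integer power of z₁. This form is single
valued and extends continuously to the cuts. -/
theorem BandGap.exp_Phi1 (hg : BandGap c d) {n : ℤ} {t : ℝ} (ht : t ≠ 0) (hp : p ∈ PiU c d) :
    Complex.exp (t * Phi1 (n / t) p) = Complex.exp (t * s1 p) * z1 p ^ (-n) := by
  obtain ⟨h0, -, hs⟩ := hg.z1_relations (Or.inl hp)
  have ht' : (t : ℂ) ≠ 0 := by exact_mod_cast ht
  rw [Phi1, extendOdd, if_pos hp, ← hs, ← exp_mul_log h0, ← Complex.exp_add]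
  congr 1
  push_cast
  field_simp
  ring

theorem BandGap.exp_Phi2 (hg : BandGap c d) {n : ℤ} {t : ℝ} (ht : t ≠ 0) (hp : p ∈ PiU c d) :
    Complex.exp (t * Phi2 (n / t) p) = Complex.exp (-(t * s2 p)) * z2 p ^ n := by
  obtain ⟨h0, -, hs⟩ := hg.z2_relations (Or.inl hp)
  have ht' : (t : ℂ) ≠ 0 := by exact_mod_cast ht
  have e : (z2 p - (z2 p)⁻¹) / 2 = -s2 p := by rw [hs]; ring
  rw [Phi2, extendOdd, if_pos hp, e, ← exp_mul_log h0, ← Complex.exp_add]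
  congr 1
  push_cast
  field_simp

theorem BandGap.exp_Phi1_of_mem_PiL (hg : BandGap c d) {n : ℤ} {t : ℝ} (hp : p ∈ PiL c d) :
    Complex.exp (t * Phi1 (n / t) p) = (Complex.exp (t * Phi1 (n / t) p.star))⁻¹ := by
  rw [← Complex.exp_neg, Phi1, extendOdd, extendOdd, if_neg (hg.not_mem_PiU_of_mem_PiL hp),
    if_pos (star_mem_PiU.2 hp), mul_neg]

theorem BandGap.exp_Phi2_of_mem_PiL (hg : BandGap c d) {n : ℤ} {t : ℝ} (hp : p ∈ PiL c d) :
    Complex.exp (t * Phi2 (n / t) p) = (Complex.exp (t * Phi2 (n / t) p.star))⁻¹ := by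
  rw [← Complex.exp_neg, Phi2, extendOdd, extendOdd, if_neg (hg.not_mem_PiU_of_mem_PiL hp),
    if_pos (star_mem_PiU.2 hp), mul_neg]

theorem BandGap.tendsto_exp_Phi1 (hg : BandGap c d) {n : ℤ} {t : ℝ} (ht : t ≠ 0)
    (hp : p ∈ Sig c d) : Tendsto (fun q => Complex.exp (t * Phi1 (n / t) q)) (𝓝[PiU c d] p)
      (𝓝 (Complex.exp (t * s1 p) * z1 p ^ (-n))) := by
  have h1 := ((Complex.continuous_exp.tendsto _).comp
    ((hg.tendsto_s1 hp).const_mul (t : ℂ))).mul (hg.tendsto_z1_zpow hp (-n))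
  exact h1.congr' (eventually_nhdsWithin_of_forall fun q hq => (hg.exp_Phi1 ht hq).symm)

theorem BandGap.tendsto_exp_Phi2 (hg : BandGap c d) {n : ℤ} {t : ℝ} (ht : t ≠ 0)
    (hp : p ∈ Sig c d) : Tendsto (fun q => Complex.exp (t * Phi2 (n / t) q)) (𝓝[PiU c d] p)
      (𝓝 (Complex.exp (-(t * s2 p)) * z2 p ^ n)) := by
  have h1 := ((Complex.continuous_exp.tendsto _).comp
    ((hg.tendsto_s2 hp).const_mul (t : ℂ)).neg).mul (hg.tendsto_z2_zpow hp n)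
  exact h1.congr' (eventually_nhdsWithin_of_forall fun q hq => (hg.exp_Phi2 ht hq).symm)

theorem BandGap.expPlus_Phi1 (hg : BandGap c d) {n : ℤ} {t : ℝ} (ht : t ≠ 0)
    (hp : p ∈ Sig c d) :
    expPlus t (Phi1 (n / t)) p = Complex.exp (t * s1 p) * z1 p ^ (-n) := by
  have := hg.neBot_PiU hp
  exact (hg.tendsto_exp_Phi1 ht hp).limUnder_eq

theorem BandGap.expPlus_Phi2 (hg : BandGap c d) {n : ℤ} {t : ℝ} (ht : t ≠ 0)
    (hp : p ∈ Sig c d) :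
    expPlus t (Phi2 (n / t)) p = Complex.exp (-(t * s2 p)) * z2 p ^ n := by
  have := hg.neBot_PiU hp
  exact (hg.tendsto_exp_Phi2 ht hp).limUnder_eq

/-- Oddness of the phase turns the limit from below at p into the inverse of the limit from above at
p*. Over the other band s₁ and z₁ are real, hence equal at p and p*, and the two boundary values are
reciprocal. -/
theorem BandGap.expMinus_Phi1 (hg : BandGap c d) {n : ℤ} {t : ℝ} (ht : t ≠ 0)
    (hp : p ∈ Sigma2 c d) :
    expMinus t (Phi1 (n / t)) p = (Complex.exp (t * s1 p) * z1 p ^ (-n))⁻¹ := by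
  have hp' : p ∈ Sig c d := Or.inr hp
  have := hg.neBot_PiL hp'
  have h1 := (hg.tendsto_exp_Phi1 (n := n) ht (star_mem_Sig.2 hp')).comp (tendsto_star_PiL p)
  rw [hg.s1_star hp', hg.z1_star hp', hg.conj_s1_of_Sigma2 hp, hg.conj_z1_of_Sigma2 hp] at h1
  have h2 := h1.inv₀ (mul_ne_zero (Complex.exp_ne_zero _)
    (zpow_ne_zero _ (hg.z1_relations (Or.inr hp')).1))
  refine Tendsto.limUnder_eq (h2.congr' ?_)
  exact eventually_nhdsWithin_of_forall fun q hq => (hg.exp_Phi1_of_mem_PiL hq).symm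

theorem BandGap.expMinus_Phi2 (hg : BandGap c d) {n : ℤ} {t : ℝ} (ht : t ≠ 0)
    (hp : p ∈ Sigma1 c d) :
    expMinus t (Phi2 (n / t)) p = (Complex.exp (-(t * s2 p)) * z2 p ^ n)⁻¹ := by
  have hp' : p ∈ Sig c d := Or.inl hp
  have := hg.neBot_PiL hp'
  have h1 := (hg.tendsto_exp_Phi2 (n := n) ht (star_mem_Sig.2 hp')).comp (tendsto_star_PiL p)
  rw [hg.s2_star hp', hg.z2_star hp', hg.conj_s2_of_Sigma1 hp, hg.conj_z2_of_Sigma1 hp] at h1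
  have h2 := h1.inv₀ (mul_ne_zero (Complex.exp_ne_zero _)
    (zpow_ne_zero _ (hg.z2_relations (Or.inr hp')).1))
  refine Tendsto.limUnder_eq (h2.congr' ?_)
  exact eventually_nhdsWithin_of_forall fun q hq => (hg.exp_Phi2_of_mem_PiL hq).symm

end Phases

/-! ### Behaviour at infinity -/

section Infinity

variable {c d : ℝ} {a b : ℤ → ℝ}

/-- At infinity lam·z₁ → d and lam·z₂ → 1/2. -/
theorem BandGap.tendsto_z2_div_z1 (hg : BandGap c d) :
    Tendsto (fun p : Curve c d => z2 p / z1 p) (atInfPlus c d) (𝓝 (2 * d : ℂ)⁻¹) := by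
  have hd : (d : ℂ) ≠ 0 := by exact_mod_cast hg.d_pos.ne'
  have h1 := hg.tendsto_z1_atInfPlus
  have h2 := BandGap.tendsto_z2_atInfPlus (c := c) (d := d)
  have h3 : Tendsto (fun p : Curve c d => 1 / 2 * (z2 p ^ 2 + 1)) (atInfPlus c d)
      (𝓝 (1 / 2 * (0 ^ 2 + 1))) := ((h2.pow 2).add_const 1).const_mul _
  have h4 : Tendsto (fun p : Curve c d => -c * z1 p + d * (z1 p ^ 2 + 1)) (atInfPlus c d)
      (𝓝 (-(c : ℂ) * 0 + d * (0 ^ 2 + 1))) :=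
    (h1.const_mul _).add (((h1.pow 2).add_const 1).const_mul _)
  have h5 := h3.div h4 (by simpa using hd)
  have e : (1 / 2 * (0 ^ 2 + 1) : ℂ) / (-c * 0 + d * (0 ^ 2 + 1)) = (2 * d : ℂ)⁻¹ := by
    simp [div_eq_inv_mul]
  rw [e] at h5
  refine h5.congr' ?_
  have hne : ∀ᶠ p in atInfPlus c d, p.lam ≠ 0 :=
    BandGap.tendsto_lam_atInfPlus.eventually (Bornology.eventually_ne_cobounded 0)
  filter_upwards [BandGap.eventually_mem_atInfPlus, hne] with p hp hl
  obtain ⟨n1, l1, -⟩ := hg.z1_relations (Or.inl hp)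
  obtain ⟨n2, l2, -⟩ := hg.z2_relations (Or.inl hp)
  have e1 : -c * z1 p + d * (z1 p ^ 2 + 1) = p.lam * z1 p := by
    rw [l1]; field_simp
  have e2 : 1 / 2 * (z2 p ^ 2 + 1) = p.lam * z2 p := by
    rw [l2]; field_simp; ring
  simp only [Pi.div_apply]
  rw [e1, e2, mul_div_mul_left _ _ hl]

theorem Steplike.tendsto_rightF_atInfPlus (hg : BandGap c d) (hs : Steplike c d a b) (n : ℤ) :
    Tendsto (fun p : Curve c d => rightF a b n (z2 p)) (atInfPlus c d) (𝓝 (rightF a b n 0)) := by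
  have h1 := hs.continuousOn_rightF n 0 (by simp)
  refine h1.tendsto.comp (tendsto_nhdsWithin_iff.2 ⟨BandGap.tendsto_z2_atInfPlus, ?_⟩)
  filter_upwards [BandGap.eventually_mem_atInfPlus] with p hp
  simpa using hg.norm_z2_le (Or.inl hp)

theorem Steplike.tendsto_leftF_atInfPlus (hg : BandGap c d) (hs : Steplike c d a b) (n : ℤ) :
    Tendsto (fun p : Curve c d => leftF c d a b n (z1 p)) (atInfPlus c d)
      (𝓝 (leftF c d a b n 0)) := by
  have h1 := hs.continuousOn_leftF n 0 (by simp)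
  refine h1.tendsto.comp (tendsto_nhdsWithin_iff.2 ⟨hg.tendsto_z1_atInfPlus, ?_⟩)
  filter_upwards [BandGap.eventually_mem_atInfPlus] with p hp
  simpa using hg.norm_z1_le (Or.inl hp)

theorem Steplike.rightF_zero_pos (hs : Steplike c d a b) (n : ℤ) :
    ∃ r : ℝ, 0 < r ∧ rightF a b n 0 = r := by
  obtain ⟨m, Q, ρ, h⟩ := hs.right
  exact h.jostF_zero_pos (by norm_num) n

theorem Steplike.leftF_zero_pos (hg : BandGap c d) (hs : Steplike c d a b) (n : ℤ) :
    ∃ r : ℝ, 0 < r ∧ leftF c d a b n 0 = r := by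
  obtain ⟨m, Q, ρ, h⟩ := hs.left
  exact h.jostF_zero_pos hg.d_pos (-n)

theorem Steplike.rightF_zero_pred (hs : Steplike c d a b) (n : ℤ) :
    (a (n - 1) : ℂ) * rightF a b (n - 1) 0 = 1 / 2 * rightF a b n 0 := by
  obtain ⟨m, Q, ρ, h⟩ := hs.right
  simpa [rightF] using h.jostF_zero_pred n

theorem Steplike.leftF_zero_succ (hs : Steplike c d a b) (n : ℤ) :
    (a n : ℂ) * leftF c d a b (n + 1) 0 = d * leftF c d a b n 0 := by
  obtain ⟨m, Q, ρ, h⟩ := hs.left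
  have := h.jostF_zero_pred (-n)
  simp only [show -(-n - 1) - 1 = n by ring] at this
  rw [leftF, leftF, show -(n + 1) = -n - 1 by ring]
  exact this

/-- The product of the normalized Jost functions at infinity. -/
theorem Steplike.leftF_mul_rightF_zero (hg : BandGap c d) (hs : Steplike c d a b) (n : ℤ) :
    leftF c d a b n 0 * rightF a b n 0 =
      (2 * d : ℂ) ^ n * (leftF c d a b 0 0 * rightF a b 0 0) := by
  have hd0 : (d : ℂ) ≠ 0 := by exact_mod_cast hg.d_pos.ne'
  have hd : (2 * d : ℂ) ≠ 0 := by simpa using hd0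
  have step : ∀ n, leftF c d a b (n + 1) 0 * rightF a b (n + 1) 0 =
      2 * d * (leftF c d a b n 0 * rightF a b n 0) := fun n => by
    have h1 := hs.leftF_zero_succ n
    have h2 := hs.rightF_zero_pred (n + 1)
    rw [add_sub_cancel_right] at h2
    have ha : (a n : ℂ) ≠ 0 := by exact_mod_cast hs.a_ne n
    refine mul_left_cancel₀ ha ?_
    -- The two first-order recursions involve the same a(n), which cancels in the product and leaves
    -- the ratio 2d of the background constants.
    linear_combination rightF a b (n + 1) 0 * h1 - 2 * d * leftF c d a b n 0 * h2
  induction n using Int.induction_on with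
  | zero => simp
  | succ i ih => rw [step, ih, zpow_add_one₀ hd]; ring
  | pred i ih =>
    have := step (-i - 1)
    rw [sub_add_cancel, ih] at this
    refine mul_left_cancel₀ hd ?_
    rw [← this, zpow_sub_one₀ hd]
    field_simp

/-- The factor z₂ compensates the pole of ψ₂(-1); the other product in W carries z₁z₂ and
disappears. -/
theorem Steplike.tendsto_z2_mul_wronskian (hg : BandGap c d) (hs : Steplike c d a b) :
    Tendsto (fun p : Curve c d => z2 p * wronskian a b p) (atInfPlus c d)
      (𝓝 (-(1 / 2 * (leftF c d a b 0 0 * rightF a b 0 0)))) := by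
  have h1 := hg.tendsto_z1_atInfPlus
  have h2 := BandGap.tendsto_z2_atInfPlus (c := c) (d := d)
  have h3 := ((((h2.mul h1).mul (hs.tendsto_leftF_atInfPlus hg (-1))).mul
    (hs.tendsto_rightF_atInfPlus hg 0)).sub ((hs.tendsto_leftF_atInfPlus hg 0).mul
    (hs.tendsto_rightF_atInfPlus hg (-1)))).const_mul (a (-1) : ℂ)
  have e := hs.rightF_zero_pred 0
  rw [zero_sub] at e
  have e' : (a (-1) : ℂ) * (0 * 0 * leftF c d a b (-1) 0 * rightF a b 0 0 -
      leftF c d a b 0 0 * rightF a b (-1) 0) =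
      -(1 / 2 * (leftF c d a b 0 0 * rightF a b 0 0)) := by
    linear_combination -leftF c d a b 0 0 * e
  rw [e'] at h3
  refine h3.congr' ?_
  filter_upwards [BandGap.eventually_mem_atInfPlus] with p hp
  have n2 := (hg.z2_relations (Or.inl hp)).1
  rw [wronskian, hs.jost1_eq hg (Or.inl hp), hs.jost1_eq hg (Or.inl hp),
    hs.jost2_eq hg (Or.inl hp), hs.jost2_eq hg (Or.inl hp)]
  simp only [neg_neg, neg_zero, zpow_one, zpow_zero, zpow_neg_one, one_mul]
  field_simp

/-- After expanding by z₂ both numerators tend to -1/2: z₂s₂ directly, and z₂s₁ because d times the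
limit of z₂/z₁ is again 1/2. -/
theorem Steplike.tendsto_T_atInfPlus (hg : BandGap c d) (hs : Steplike c d a b) :
    Tendsto (T1 a b) (atInfPlus c d) (𝓝 (leftF c d a b 0 0 * rightF a b 0 0)⁻¹) ∧
      Tendsto (T2 a b) (atInfPlus c d) (𝓝 (leftF c d a b 0 0 * rightF a b 0 0)⁻¹) := by
  have hd : (d : ℂ) ≠ 0 := by exact_mod_cast hg.d_pos.ne'
  have h1 := hg.tendsto_z1_atInfPlus
  have h2 := BandGap.tendsto_z2_atInfPlus (c := c) (d := d)
  have hW := hs.tendsto_z2_mul_wronskian hg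
  obtain ⟨r, hr, er⟩ := hs.rightF_zero_pos 0
  obtain ⟨l, hl, el⟩ := hs.leftF_zero_pos hg 0
  have hP : leftF c d a b 0 0 * rightF a b 0 0 ≠ 0 := by
    rw [er, el]; exact_mod_cast (mul_pos hl hr).ne'
  have hP' : -(1 / 2 * (leftF c d a b 0 0 * rightF a b 0 0)) ≠ 0 := by
    simpa using hP
  set P := leftF c d a b 0 0 * rightF a b 0 0
  constructor
  · have h3 : Tendsto (fun p : Curve c d => -(d * (1 - z1 p ^ 2) * (z2 p / z1 p)))
        (atInfPlus c d) (𝓝 (-(d * (1 - 0 ^ 2) * (2 * d : ℂ)⁻¹))) :=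
      ((((h1.pow 2).const_sub 1).const_mul _).mul hg.tendsto_z2_div_z1).neg
    have h4 := h3.div hW hP'
    have e : -(d * (1 - 0 ^ 2) * (2 * d : ℂ)⁻¹) / (-(1 / 2 * P)) = P⁻¹ := by
      field_simp; ring
    rw [e] at h4
    refine h4.congr' ?_
    filter_upwards [BandGap.eventually_mem_atInfPlus] with p hp
    obtain ⟨n1, -, e1⟩ := hg.z1_relations (Or.inl hp)
    obtain ⟨n2, -, -⟩ := hg.z2_relations (Or.inl hp)
    simp only [Pi.div_apply]
    have e2 : -(d * (1 - z1 p ^ 2) * (z2 p / z1 p)) = z2 p * -s1 p := by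
      rw [e1]; field_simp
    rw [T1, e2, mul_div_mul_left _ _ n2]
  · have h3 : Tendsto (fun p : Curve c d => -(1 / 2 * (1 - z2 p ^ 2)))
        (atInfPlus c d) (𝓝 (-(1 / 2 * (1 - 0 ^ 2) : ℂ))) :=
      (((h2.pow 2).const_sub 1).const_mul _).neg
    have h4 := h3.div hW hP'
    have e : -(1 / 2 * (1 - 0 ^ 2) : ℂ) / (-(1 / 2 * P)) = P⁻¹ := by
      field_simp; ring
    rw [e] at h4
    refine h4.congr' ?_
    filter_upwards [BandGap.eventually_mem_atInfPlus] with p hp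
    obtain ⟨n2, -, e1⟩ := hg.z2_relations (Or.inl hp)
    simp only [Pi.div_apply]
    have e2 : -(1 / 2 * (1 - z2 p ^ 2)) = z2 p * -s2 p := by
      rw [e1]; field_simp
    rw [T2, e2, mul_div_mul_left _ _ n2]

end Infinity

end

section

/-! ### The Riemann-Hilbert problems -/

section Extension

variable {c d : ℝ} {f : Curve c d → Fin 2 → ℂ} {p : Curve c d}

theorem tendsto_extendSym_PiU {x : Fin 2 → ℂ} (h : Tendsto f (𝓝[PiU c d] p) (𝓝 x)) :
    Tendsto (extendSym f) (𝓝[PiU c d] p) (𝓝 x) :=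
  h.congr' (eventually_nhdsWithin_of_forall fun _ hq => (if_pos hq).symm)

theorem BandGap.extendSym_of_mem_PiL (hg : BandGap c d) (hp : p ∈ PiL c d) :
    extendSym f p = ![f p.star 1, f p.star 0] := if_neg (hg.not_mem_PiU_of_mem_PiL hp)

theorem tendsto_swap {α : Type*} {l : Filter α} {g : α → Fin 2 → ℂ} {x : Fin 2 → ℂ}
    (h : Tendsto g l (𝓝 x)) : Tendsto (fun q => ![g q 1, g q 0]) l (𝓝 ![x 1, x 0]) := by
  rw [tendsto_pi_nhds] at h ⊢
  intro i
  fin_cases i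
  · simpa using h 1
  · simpa using h 0

theorem BandGap.tendsto_extendSym_PiL (hg : BandGap c d) {y : Fin 2 → ℂ}
    (h : Tendsto f (𝓝[PiU c d] p.star) (𝓝 y)) :
    Tendsto (extendSym f) (𝓝[PiL c d] p) (𝓝 ![y 1, y 0]) :=
  (tendsto_swap (h.comp (tendsto_star_PiL p))).congr' (eventually_nhdsWithin_of_forall
    fun _ hq => (hg.extendSym_of_mem_PiL hq).symm)

theorem vecMul_two (x y p q r s : ℂ) :
    Matrix.vecMul ![x, y] !![p, q; r, s] = ![x * p + y * r, x * q + y * s] := by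
  ext i; fin_cases i <;> simp [Matrix.vecMul, dotProduct, Fin.sum_univ_two]

/-- A symmetric extension solves a Riemann-Hilbert problem if its values on the upper sheet and on
the cuts have the required properties. -/
theorem BandGap.solvesRHP_extendSym (hg : BandGap c d)
    {v : Curve c d → Matrix (Fin 2) (Fin 2) ℂ}
    (hol : DifferentiableOn ℂ (fun lam => f (upperPt c d lam)) (bands c d)ᶜ)
    (hlim : ∀ p ∈ Sig c d, Tendsto f (𝓝[PiU c d] p) (𝓝 (f p)))
    (hjump : ∀ p ∈ Sig c d, f p = Matrix.vecMul ![f p.star 1, f p.star 0] (v p))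
    (hinf : ∃ mhat mtilde : ℝ, Tendsto f (atInfPlus c d) (𝓝 ![(mhat : ℂ), (mtilde : ℂ)]) ∧
      mhat * mtilde = 1 ∧ 0 < mhat) :
    SolvesRHP v (extendSym f) where
  holomorphic_upper := hol.congr fun lam hl => if_pos (upperPt_mem hl)
  holomorphic_lower := by
    have : DifferentiableOn ℂ (fun lam => ![f (upperPt c d lam) 1, f (upperPt c d lam) 0])
        (bands c d)ᶜ := by
      rw [differentiableOn_pi] at hol ⊢
      intro i
      fin_cases i
      · exact hol 1
      · exact hol 0
    refine this.congr fun lam hl => ?_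
    rw [hg.extendSym_of_mem_PiL (star_mem_PiL.2 (upperPt_mem hl)), Curve.star_star]
  jump p hp := ⟨f p, ![f p.star 1, f p.star 0], tendsto_extendSym_PiU (hlim p hp),
    hg.tendsto_extendSym_PiL (hlim p.star (star_mem_Sig.2 hp)), hjump p hp⟩
  symmetry p hp := by
    rcases hp with hp | hp
    · rw [hg.extendSym_of_mem_PiL (star_mem_PiL.2 hp), Curve.star_star, extendSym, if_pos hp]
      ext i; fin_cases i <;> simp [Matrix.vecMul, dotProduct, Fin.sum_univ_two]
    · rw [hg.extendSym_of_mem_PiL hp, extendSym, if_pos (star_mem_PiU.2 hp), vecMul_two]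
      ext i; fin_cases i <;> simp
  normalization := by
    obtain ⟨x, y, h, hxy⟩ := hinf
    refine ⟨x, y, h.congr' ?_, hxy⟩
    filter_upwards [BandGap.eventually_mem_atInfPlus] with p hp
    exact (if_pos hp).symm

end Extension

/-! ### The two jump identities as pure algebra. -/

section JumpAlgebra

variable {s σ ψ ψ' φ φ' W V X ζ R : ℂ}

/-- This is used over the band of ψ: V and ψ' are the conjugates of W and ψ, φ is the other Jost
solution and is real, ζ is the power of z that normalizes ψ, inverted by conjugation, and X is the
exponential of the root term in the phase. The first component only uses the value of R; the second
is the scattering relation. -/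
theorem jump_own (hW : W ≠ 0) (hV : V ≠ 0) (hX : X ≠ 0) (hζ : ζ ≠ 0)
    (hrel : W * ψ' - V * ψ = -s * φ) (hR : R = -(V / W) * (X ^ 2)⁻¹)
    (hR' : starRingEnd ℂ R = -(W / V) * X ^ 2) :
    ![-s / W * φ * ζ⁻¹, ψ * ζ] =
      Matrix.vecMul ![ψ' * ζ⁻¹, s / V * φ * ζ] (jumpOwn R (X * ζ⁻¹)) := by
  rw [jumpOwn, vecMul_two, hR', hR]
  congr 1
  · field_simp; ring
  · congr 1
    field_simp
    linear_combination -hrel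

/-- This is used over the band of φ, where ψ and ζ are real and σ is the root of that band. The
reciprocal boundary values of the phase make the off-diagonal entries 1, so the second component is
immediate; the first is the scattering relation of φ. -/
theorem jump_other (hW : W ≠ 0) (hV : V ≠ 0) (hX : X ≠ 0) (hζ : ζ ≠ 0)
    (hrel : W * φ' - V * φ = -σ * ψ) (hR : R = -(s * σ) / (W * V) * (X ^ 2)⁻¹) :
    ![-s / W * φ * ζ⁻¹, ψ * ζ] =
      Matrix.vecMul ![ψ * ζ, -s / V * φ' * ζ⁻¹] (jumpOther R (X * ζ⁻¹) (X * ζ⁻¹)⁻¹) := by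
  rw [jumpOther, vecMul_two, hR]
  congr 1
  · field_simp
    linear_combination s * hrel
  · congr 1
    field_simp
    ring

end JumpAlgebra

section Main

variable {c d : ℝ} {a b : ℤ → ℝ → ℝ} {p : Curve c d}

/-! ### Jumps at time t expressed by the data at time 0. -/

namespace TodaSteplike

theorem conj_wronskian_zero (hg : BandGap c d) (h : TodaSteplike c d a b) (hp : p ∈ closU c d)
    (t : ℝ) :
    starRingEnd ℂ (wronskian (fun k => a k 0) (fun k => b k 0) p) =
      starRingEnd ℂ (wronskian (fun k => a k t) (fun k => b k t) p) *
        Complex.exp ((starRingEnd ℂ (s1 p) - starRingEnd ℂ (s2 p)) * t) := by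
  rw [h.wronskian_zero hg hp t, map_mul, ← Complex.exp_conj]
  simp

/-- The algebraic jump identities hold with the Wronskian at time t. The exponential evolution of W
then converts the scattering data at time 0 into those at time t together with the phase factors. -/
theorem jump_m1 (hg : BandGap c d) (h : TodaSteplike c d a b)
    (hW : ∀ p ∈ closU c d, wronskian (fun k => a k 0) (fun k => b k 0) p ≠ 0) (n : ℤ) {t : ℝ}
    (ht : t ≠ 0) {f : Curve c d → Fin 2 → ℂ}
    (hf : f = fun p => ![T1 (fun k => a k t) (fun k => b k t) p *
      jost2 (fun k => a k t) (fun k => b k t) p n * z1 p ^ (-n),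
      jost1 (fun k => a k t) (fun k => b k t) p n * z1 p ^ n]) (hp : p ∈ Sig c d) :
    f p = Matrix.vecMul ![f p.star 1, f p.star 0]
      (v1 (fun k => a k 0) (fun k => b k 0) n t p) := by
  have hs := h.steplike t
  have hs0 := h.steplike 0
  have hp' : p ∈ closU c d := Or.inr hp
  have hW0 := hW p hp'
  have hWt := h.wronskian_ne hg hp' hW0 t
  have hVt := (map_ne_zero (starRingEnd ℂ)).2 hWt
  have eW := h.wronskian_zero hg hp' t
  have eV := h.conj_wronskian_zero hg hp' t
  have hz := (hg.z1_relations hp').1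
  have hζ : z1 p ^ n ≠ 0 := zpow_ne_zero n hz
  have hX := Complex.exp_ne_zero (t * s1 p)
  have eE := hg.expPlus_Phi1 (n := n) ht hp
  simp only [hf, Matrix.cons_val_zero, Matrix.cons_val_one]
  rw [hs.T1_star hg hp, hs.jost1_star hg hp, hs.jost2_star hg hp, hg.z1_star hp]
  rw [zpow_neg] at eE
  by_cases hp1 : p ∈ Sigma1 c d
  · rw [hg.conj_s1_of_Sigma1 hp1, hg.conj_s2_of_Sigma1 hp1] at eV
    rw [v1, if_pos hp1, eE, hg.conj_z1_of_Sigma1 hp1, hs.jost2_real hg hp1, T1, map_div₀, map_neg,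
      hg.conj_s1_of_Sigma1 hp1, neg_neg, inv_zpow, inv_zpow, zpow_neg, inv_inv]
    -- Only s₁ changes sign under conjugation over I₁, so conj W / W at time 0 differs from that at
    -- time t by exp(-2ts₁).
    have e1 : Complex.exp ((-s1 p - s2 p) * t) =
        Complex.exp ((s1 p - s2 p) * t) * (Complex.exp (t * s1 p) ^ 2)⁻¹ := by
      rw [← Complex.exp_nat_mul, ← Complex.exp_neg, ← Complex.exp_add]
      congr 1; push_cast; ring
    have hE := Complex.exp_ne_zero ((s1 p - s2 p) * t)
    refine jump_own hWt hVt hX hζ (hs.relation_Sigma1 hg hp1 n) ?_ ?_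
    · rw [hs0.R1_eq hg hp1 hW0, eV, eW, e1]
      field_simp
    · rw [hs0.R1_eq hg hp1 hW0, map_neg, map_div₀, Complex.conj_conj, eV, eW, e1]
      field_simp
  · have hp2 : p ∈ Sigma2 c d := hp.resolve_left hp1
    have eM := hg.expMinus_Phi1 (n := n) ht hp2
    rw [zpow_neg] at eM
    rw [hg.conj_s1_of_Sigma2 hp2, hg.conj_s2_of_Sigma2 hp2] at eV
    rw [v1, if_neg hp1, eE, eM, hg.conj_z1_of_Sigma2 hp2, hs.jost1_real hg hp2, T1, map_div₀,
      map_neg, hg.conj_s1_of_Sigma2 hp2, zpow_neg]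
    -- Over I₂ conjugation flips s₂ instead. In the product of W and conj W occurring in `chi` the
    -- s₂ exponents cancel and exp(2ts₁) remains.
    have e1 : Complex.exp ((s1 p - -s2 p) * t) =
        (Complex.exp ((s1 p - s2 p) * t))⁻¹ * Complex.exp (t * s1 p) ^ 2 := by
      rw [← Complex.exp_nat_mul, ← Complex.exp_neg, ← Complex.exp_add]
      congr 1; push_cast; ring
    have hE := Complex.exp_ne_zero ((s1 p - s2 p) * t)
    refine jump_other (σ := s2 p) hWt hVt hX hζ (hs.relation_Sigma2 hg hp2 n) ?_
    rw [hs0.chi_eq hg hp hW0, T1, T2]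
    simp only [map_neg, map_mul, map_div₀, Complex.conj_conj]
    rw [eV, eW, e1, hg.conj_s1_of_Sigma2 hp2]
    field_simp

theorem jump_m2 (hg : BandGap c d) (h : TodaSteplike c d a b)
    (hW : ∀ p ∈ closU c d, wronskian (fun k => a k 0) (fun k => b k 0) p ≠ 0) (n : ℤ) {t : ℝ}
    (ht : t ≠ 0) {f : Curve c d → Fin 2 → ℂ}
    (hf : f = fun p => ![T2 (fun k => a k t) (fun k => b k t) p *
      jost1 (fun k => a k t) (fun k => b k t) p n * z2 p ^ n,
      jost2 (fun k => a k t) (fun k => b k t) p n * z2 p ^ (-n)]) (hp : p ∈ Sig c d) :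
    f p = Matrix.vecMul ![f p.star 1, f p.star 0]
      (v2 (fun k => a k 0) (fun k => b k 0) n t p) := by
  have hs := h.steplike t
  have hs0 := h.steplike 0
  have hp' : p ∈ closU c d := Or.inr hp
  have hW0 := hW p hp'
  have hWt := h.wronskian_ne hg hp' hW0 t
  have hVt := (map_ne_zero (starRingEnd ℂ)).2 hWt
  have eW := h.wronskian_zero hg hp' t
  have eV := h.conj_wronskian_zero hg hp' t
  have hz := (hg.z2_relations hp').1
  have hζ : z2 p ^ (-n) ≠ 0 := zpow_ne_zero _ hz
  -- The role of ζ falls to z₂⁻ⁿ, the power that normalizes ψ₂; with X = exp(-ts₂) the same algebra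
  -- applies.
  have eζ : z2 p ^ n = (z2 p ^ (-n))⁻¹ := by rw [zpow_neg, inv_inv]
  have hX := Complex.exp_ne_zero (-(t * s2 p))
  have eE := hg.expPlus_Phi2 (n := n) ht hp
  simp only [hf, Matrix.cons_val_zero, Matrix.cons_val_one]
  rw [hs.T2_star hg hp, hs.jost1_star hg hp, hs.jost2_star hg hp, hg.z2_star hp]
  by_cases hp1 : p ∈ Sigma2 c d
  · rw [hg.conj_s1_of_Sigma2 hp1, hg.conj_s2_of_Sigma2 hp1] at eV
    rw [v2, if_pos hp1, eE, hg.conj_z2_of_Sigma2 hp1, hs.jost1_real hg hp1, T2, map_div₀, map_neg,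
      hg.conj_s2_of_Sigma2 hp1, neg_neg, inv_zpow, inv_zpow, eζ, inv_inv]
    have e1 : Complex.exp ((s1 p - -s2 p) * t) =
        Complex.exp ((s1 p - s2 p) * t) * (Complex.exp (-(t * s2 p)) ^ 2)⁻¹ := by
      rw [← Complex.exp_nat_mul, ← Complex.exp_neg, ← Complex.exp_add]
      congr 1; push_cast; ring
    have hE := Complex.exp_ne_zero ((s1 p - s2 p) * t)
    refine jump_own hWt hVt hX hζ (hs.relation_Sigma2 hg hp1 n) ?_ ?_
    · rw [hs0.R2_eq hg hp1 hW0, eV, eW, e1]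
      field_simp
    · rw [hs0.R2_eq hg hp1 hW0, map_neg, map_div₀, Complex.conj_conj, eV, eW, e1]
      field_simp
  · have hp2 : p ∈ Sigma1 c d := hp.resolve_right hp1
    have eM := hg.expMinus_Phi2 (n := n) ht hp2
    rw [hg.conj_s1_of_Sigma1 hp2, hg.conj_s2_of_Sigma1 hp2] at eV
    rw [v2, if_neg hp1, eE, eM, hg.conj_z2_of_Sigma1 hp2, hs.jost2_real hg hp2, T2, map_div₀,
      map_neg, hg.conj_s2_of_Sigma1 hp2, eζ]
    have e1 : Complex.exp ((-s1 p - s2 p) * t) =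
        (Complex.exp ((s1 p - s2 p) * t))⁻¹ * Complex.exp (-(t * s2 p)) ^ 2 := by
      rw [← Complex.exp_nat_mul, ← Complex.exp_neg, ← Complex.exp_add]
      congr 1; push_cast; ring
    have hE := Complex.exp_ne_zero ((s1 p - s2 p) * t)
    refine jump_other (σ := s1 p) hWt hVt hX hζ (hs.relation_Sigma1 hg hp2 n) ?_
    rw [hs0.chi_eq hg hp hW0, T1, T2]
    simp only [map_neg, map_div₀]
    rw [eV, eW, e1, hg.conj_s2_of_Sigma1 hp2]
    field_simp

end TodaSteplike

/-! ### Vector limits and the normalization at infinity. -/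

section Vectors

variable {a₀ b₀ : ℤ → ℝ}

theorem tendsto_vec_two {α : Type*} {l : Filter α} {f g : α → ℂ} {x y : ℂ}
    (hf : Tendsto f l (𝓝 x)) (hg : Tendsto g l (𝓝 y)) :
    Tendsto (fun q => ![f q, g q]) l (𝓝 ![x, y]) := by
  rw [tendsto_pi_nhds]
  intro i
  fin_cases i
  · simpa using hf
  · simpa using hg

theorem differentiableOn_vec_two {f g : ℂ → ℂ} {s : Set ℂ} (hf : DifferentiableOn ℂ f s)
    (hg : DifferentiableOn ℂ g s) : DifferentiableOn ℂ (fun q => ![f q, g q]) s := by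
  rw [differentiableOn_pi]
  intro i
  fin_cases i
  · simpa using hf
  · simpa using hg

/-- The factor (2d)ⁿ in the product of the normalized Jost functions at n is undone by the limit of
(z₂/z₁)ⁿ, so the limit of T_j times this power is the reciprocal of that product at n. -/
theorem Steplike.normalization (hg : BandGap c d) (hs : Steplike c d a₀ b₀) (n : ℤ) :
    ∃ x r l : ℝ, 0 < x ∧ 0 < r ∧ 0 < l ∧ x * r * l = 1 ∧ rightF a₀ b₀ n 0 = r ∧
      leftF c d a₀ b₀ n 0 = l ∧
      (leftF c d a₀ b₀ 0 0 * rightF a₀ b₀ 0 0)⁻¹ * ((2 * d : ℂ)⁻¹) ^ n = x := by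
  obtain ⟨r, hr, er⟩ := hs.rightF_zero_pos n
  obtain ⟨l, hl, el⟩ := hs.leftF_zero_pos hg n
  have key := hs.leftF_mul_rightF_zero hg n
  have hd := hg.d_pos
  have hr' : (r : ℂ) ≠ 0 := by exact_mod_cast hr.ne'
  have hl' : (l : ℂ) ≠ 0 := by exact_mod_cast hl.ne'
  refine ⟨(l * r)⁻¹, r, l, by positivity, hr, hl, by field_simp, er, el, ?_⟩
  rw [inv_zpow, ← mul_inv, mul_comm, ← key, er, el]
  push_cast
  rfl

/-- The first component factors as T₁ · (z₂/z₁)ⁿ · `rightF`, the second is `leftF`, and each factor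
has a positive limit. -/
theorem Steplike.exists_tendsto_m1_atInfPlus (hg : BandGap c d) (hs : Steplike c d a₀ b₀) (n : ℤ) :
    ∃ mhat mtilde : ℝ, Tendsto (fun p : Curve c d => ![T1 a₀ b₀ p * jost2 a₀ b₀ p n * z1 p ^ (-n),
      jost1 a₀ b₀ p n * z1 p ^ n]) (atInfPlus c d) (𝓝 ![(mhat : ℂ), (mtilde : ℂ)]) ∧
      mhat * mtilde = 1 ∧ 0 < mhat := by
  have hd : (2 * d : ℂ)⁻¹ ≠ 0 := by
    have : (d : ℂ) ≠ 0 := by exact_mod_cast hg.d_pos.ne'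
    simpa using this
  obtain ⟨x, r, l, hx, hr, hl, hxrl, er, el, ex⟩ := hs.normalization hg n
  refine ⟨x * r, l, ?_, hxrl, mul_pos hx hr⟩
  have h1 := ((hs.tendsto_T_atInfPlus hg).1.mul (hg.tendsto_z2_div_z1.zpow₀ n (Or.inl hd))).mul
    (hs.tendsto_rightF_atInfPlus hg n)
  rw [ex, er] at h1
  have h2 := hs.tendsto_leftF_atInfPlus hg n
  rw [el] at h2
  push_cast
  refine (tendsto_vec_two h1 h2).congr' ?_
  filter_upwards [BandGap.eventually_mem_atInfPlus] with p hp
  have n1 := (hg.z1_relations (Or.inl hp)).1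
  have hζ : z1 p ^ n ≠ 0 := zpow_ne_zero n n1
  rw [hs.jost1_eq hg (Or.inl hp), hs.jost2_eq hg (Or.inl hp), div_zpow, zpow_neg]
  congr 1
  · field_simp
  · congr 1
    field_simp

theorem Steplike.exists_tendsto_m2_atInfPlus (hg : BandGap c d) (hs : Steplike c d a₀ b₀) (n : ℤ) :
    ∃ mhat mtilde : ℝ, Tendsto (fun p : Curve c d => ![T2 a₀ b₀ p * jost1 a₀ b₀ p n * z2 p ^ n,
      jost2 a₀ b₀ p n * z2 p ^ (-n)]) (atInfPlus c d) (𝓝 ![(mhat : ℂ), (mtilde : ℂ)]) ∧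
      mhat * mtilde = 1 ∧ 0 < mhat := by
  have hd : (2 * d : ℂ)⁻¹ ≠ 0 := by
    have : (d : ℂ) ≠ 0 := by exact_mod_cast hg.d_pos.ne'
    simpa using this
  obtain ⟨x, r, l, hx, hr, hl, hxrl, er, el, ex⟩ := hs.normalization hg n
  refine ⟨x * l, r, ?_, by linarith, mul_pos hx hl⟩
  have h1 := ((hs.tendsto_T_atInfPlus hg).2.mul (hg.tendsto_z2_div_z1.zpow₀ n (Or.inl hd))).mul
    (hs.tendsto_leftF_atInfPlus hg n)
  rw [ex, el] at h1
  have h2 := hs.tendsto_rightF_atInfPlus hg n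
  rw [er] at h2
  push_cast
  refine (tendsto_vec_two h1 h2).congr' ?_
  filter_upwards [BandGap.eventually_mem_atInfPlus] with p hp
  have n1 := (hg.z2_relations (Or.inl hp)).1
  have hζ : z2 p ^ n ≠ 0 := zpow_ne_zero n n1
  have hζ1 : z1 p ^ n ≠ 0 := zpow_ne_zero n (hg.z1_relations (Or.inl hp)).1
  rw [hs.jost1_eq hg (Or.inl hp), hs.jost2_eq hg (Or.inl hp), div_zpow, zpow_neg, zpow_neg]
  congr 1
  · field_simp
  · congr 1
    field_simp

end Vectors

namespace TodaSteplike

theorem solvesRHP_m1 (hg : BandGap c d) (h : TodaSteplike c d a b)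
    (hW : ∀ p ∈ closU c d, wronskian (fun k => a k 0) (fun k => b k 0) p ≠ 0) (n : ℤ) {t : ℝ}
    (ht : t ≠ 0) :
    SolvesRHP (c := c) (d := d) (v1 (fun k => a k 0) (fun k => b k 0) n t)
      (m1 (fun k => a k t) (fun k => b k t) n) := by
  have hs := h.steplike t
  have hWt : ∀ p ∈ closU c d, wronskian (fun k => a k t) (fun k => b k t) p ≠ 0 :=
    fun p hp => h.wronskian_ne hg hp (hW p hp) t
  refine hg.solvesRHP_extendSym ?_ (fun p hp => ?_) (fun p hp => h.jump_m1 hg hW n ht rfl hp)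
    (hs.exists_tendsto_m1_atInfPlus hg n)
  · exact differentiableOn_vec_two (((hs.differentiableOn_T1 hg hWt).fun_mul
      (hs.differentiableOn_jost2 hg n)).fun_mul (hg.differentiableOn_z1_zpow (-n)))
      ((hs.differentiableOn_jost1 hg n).fun_mul (hg.differentiableOn_z1_zpow n))
  · exact tendsto_vec_two (((hs.tendsto_T1 hg hp (hWt p (Or.inr hp))).mul
      (hs.tendsto_jost2 hg hp n)).mul (hg.tendsto_z1_zpow hp (-n)))
      ((hs.tendsto_jost1 hg hp n).mul (hg.tendsto_z1_zpow hp n))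

theorem solvesRHP_m2 (hg : BandGap c d) (h : TodaSteplike c d a b)
    (hW : ∀ p ∈ closU c d, wronskian (fun k => a k 0) (fun k => b k 0) p ≠ 0) (n : ℤ) {t : ℝ}
    (ht : t ≠ 0) :
    SolvesRHP (c := c) (d := d) (v2 (fun k => a k 0) (fun k => b k 0) n t)
      (m2 (fun k => a k t) (fun k => b k t) n) := by
  have hs := h.steplike t
  have hWt : ∀ p ∈ closU c d, wronskian (fun k => a k t) (fun k => b k t) p ≠ 0 :=
    fun p hp => h.wronskian_ne hg hp (hW p hp) t
  refine hg.solvesRHP_extendSym ?_ (fun p hp => ?_) (fun p hp => h.jump_m2 hg hW n ht rfl hp)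
    (hs.exists_tendsto_m2_atInfPlus hg n)
  · exact differentiableOn_vec_two (((hs.differentiableOn_T2 hg hWt).fun_mul
      (hs.differentiableOn_jost1 hg n)).fun_mul (hg.differentiableOn_z2_zpow n))
      ((hs.differentiableOn_jost2 hg n).fun_mul (hg.differentiableOn_z2_zpow (-n)))
  · exact tendsto_vec_two (((hs.tendsto_T2 hg hp (hWt p (Or.inr hp))).mul
      (hs.tendsto_jost1 hg hp n)).mul (hg.tendsto_z2_zpow hp n))
      ((hs.tendsto_jost2 hg hp n).mul (hg.tendsto_z2_zpow hp (-n)))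

end TodaSteplike

end Main

end

end

end TodaShock

theorem theorem2p3 (c d C : ℝ) (hc : 1 < c) (hd : 0 < d) (hcd : 2 * d < c - 1)
    (hC : max (c + 2 * d + Real.sqrt ((c + 2 * d) ^ 2 - 1))
      (1 / (2 * d) * (1 + c + Real.sqrt ((1 + c) ^ 2 - 4 * d ^ 2))) ≤ C)
    (a b : ℤ → ℝ → ℝ) (hToda : TodaShock.IsTodaSolution a b)
    (hpos : ∀ n, 0 < a n 0)
    (hdecay : TodaShock.SteplikeDecay c d C (fun n => a n 0) (fun n => b n 0))
    (hspec : TodaShock.discreteSpectrum c d (fun n => a n 0) (fun n => b n 0) = ∅)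
    (hres : TodaShock.NonResonant c d (fun n => a n 0) (fun n => b n 0)) :
    (∀ t : ℝ, TodaShock.IsScatteringData (c := c) (d := d) (fun k => a k t) (fun k => b k t)
      (TodaShock.jost1 (fun k => a k t) (fun k => b k t))
      (TodaShock.jost2 (fun k => a k t) (fun k => b k t))
      (TodaShock.T1 (fun k => a k t) (fun k => b k t))
      (TodaShock.T2 (fun k => a k t) (fun k => b k t))
      (TodaShock.R1 (fun k => a k t) (fun k => b k t))
      (TodaShock.R2 (fun k => a k t) (fun k => b k t))) ∧
    ∀ (n : ℤ) (t : ℝ), t ≠ 0 →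
      TodaShock.SolvesRHP (c := c) (d := d)
        (TodaShock.v1 (fun k => a k 0) (fun k => b k 0) n t)
        (TodaShock.m1 (fun k => a k t) (fun k => b k t) n) ∧
      TodaShock.SolvesRHP (c := c) (d := d)
        (TodaShock.v2 (fun k => a k 0) (fun k => b k 0) n t)
        (TodaShock.m2 (fun k => a k t) (fun k => b k t) n) := by
  have hg : TodaShock.BandGap c d := ⟨hd, hcd⟩
  have hC0 : 0 < C := by
    have h1 := (le_max_left _ _).trans hC
    have h2 := Real.sqrt_nonneg ((c + 2 * d) ^ 2 - 1)
    linarith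
  have h : TodaShock.TodaSteplike c d a b :=
    ⟨hToda, hToda.exists_backgrounds hC0 hd hpos hdecay⟩
  obtain ⟨M, hM⟩ := hToda.bounded 0
  have hW : ∀ p ∈ TodaShock.closU c d,
      TodaShock.wronskian (fun k => a k 0) (fun k => b k 0) p ≠ 0 := fun p hp =>
    (h.steplike 0).wronskian_ne_zero hg (fun n => (hM n 0 (by simp)).1) hspec hres hp
  exact ⟨fun t => (h.steplike t).isScatteringData hg
    fun p hp => h.wronskian_ne hg hp (hW p hp) t,
    fun n t ht => ⟨h.solvesRHP_m1 hg hW n ht, h.solvesRHP_m2 hg hW n ht⟩⟩
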